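/- Fix a finite alphabet $\Sigma$. There are a program for the unit-cost word RAM and a constant $C$, both depending only on $|\Sigma|$, such that for all $n,\ell\ge 1$, all strings $s_1,\dots,s_n\in\Sigma^\ell$ and every real $q\in[0,1]$ the following holds. Given $n$, $\ell$, the threshold $\lceil qn\rceil$ and the letters of $s_1,\dots,s_n$, the program outputs, each exactly once, all nonempty strings that occur as a (contiguous) substring in at least one $s_i$ and in at least $qn$ of the $s_i$; each substring is reported as a reference consisting of a string index, a start position in that string and a length. If $r$ is the number of substrings reported, the program halts after at most $C\cdot(n\ell+r)$ steps and uses at most $C\cdot n\ell$ words of storage (the input included, the write-only output stream not included). Here the word RAM has a fixed number of registers and of memory arrays of $B$ cells each; every register, cell, address and intermediate value is a natural number smaller than $B$; its storage is the total number of registers and cells; and each access to a register or cell, each constant, each arithmetic operation (addition, truncated subtraction, multiplication, integer division, remainder) or comparison, each assignment, each output of a word and each test of a condition counts as one step. -/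

import Mathlib

/-! ### A word RAM with explicit time and space

A machine of capacity `B` with `m` registers and `k + 1` memory banks. Every register and every
memory cell holds a word, that is, a natural number smaller than `B`, and every bank has the
cells `0, …, B - 1`. Hence the machine has `m + (k + 1) * B` words of storage, each of
`⌈log₂ B⌉` bits. Results are written to a write-only output stream of words. -/

namespace WordRAM

/-- The state of a machine with `m` registers and `k + 1` memory banks; `out` is the output
written so far. -/
structure State (m k : ℕ) where
  reg : Fin m → ℕ
  mem : Fin (k + 1) → ℕ → ℕ
  out : List ℕ

/-- Elementary word operations. -/
inductive Op where
  | add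
  | sub
  | mul
  | div
  | mod
  | lt
  | eq

/-- Subtraction is cut off at `0`, `x / 0 = 0`, `x mod 0 = x`; a comparison yields `1` if it
holds and `0` otherwise. -/
def Op.eval : Op → ℕ → ℕ → ℕ
  | .add, x, y => x + y
  | .sub, x, y => x - y
  | .mul, x, y => x * y
  | .div, x, y => x / y
  | .mod, x, y => x % y
  | .lt, x, y => if x < y then 1 else 0
  | .eq, x, y => if x = y then 1 else 0

/-- Expressions: constants, registers, the cell of bank `b` at a computed address, and
elementary operations. -/
inductive Expr (m k : ℕ) where
  | const (c : ℕ)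
  | reg (i : Fin m)
  | load (b : Fin (k + 1)) (addr : Expr m k)
  | op (o : Op) (e₁ e₂ : Expr m k)

namespace Expr

variable {m k : ℕ}

/-- The value of an expression. -/
def eval (s : State m k) : Expr m k → ℕ
  | const c => c
  | reg i => s.reg i
  | load b e => s.mem b (e.eval s)
  | op o e₁ e₂ => o.eval (e₁.eval s) (e₂.eval s)

/-- All values that occur in the evaluation of the expression, addresses included, are words
of a machine of capacity `B`. -/
def Fits (B : ℕ) (s : State m k) : Expr m k → Prop
  | const c => c < B
  | reg i => s.reg i < B
  | load b e => e.Fits B s ∧ s.mem b (e.eval s) < B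
  | op o e₁ e₂ => e₁.Fits B s ∧ e₂.Fits B s ∧ o.eval (e₁.eval s) (e₂.eval s) < B

/-- The number of steps for evaluating an expression: one for each constant, register access,
memory access and elementary operation. -/
def cost : Expr m k → ℕ
  | const _ => 1
  | reg _ => 1
  | load _ e => e.cost + 1
  | op _ e₁ e₂ => e₁.cost + e₂.cost + 1

end Expr

/-- Programs. A condition holds if its value is not `0`. -/
inductive Cmd (m k : ℕ) where
  | skip
  | assign (i : Fin m) (e : Expr m k)
  | store (b : Fin (k + 1)) (addr e : Expr m k)
  | emit (e : Expr m k)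
  | seq (P Q : Cmd m k)
  | ite (c : Expr m k) (P Q : Cmd m k)
  | loop (c : Expr m k) (P : Cmd m k)

/-- `Exec B P s t s'`: on a machine of capacity `B`, the program `P` started in state `s` halts
after exactly `t` steps in state `s'`, without ever computing a value or address that is not
smaller than `B`. -/
inductive Exec {m k : ℕ} (B : ℕ) : Cmd m k → State m k → ℕ → State m k → Prop
  | skip (s : State m k) : Exec B .skip s 1 s
  | assign (s : State m k) (i : Fin m) (e : Expr m k) (he : e.Fits B s) :
      Exec B (.assign i e) s (e.cost + 1)
        { s with reg := Function.update s.reg i (e.eval s) }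
  | store (s : State m k) (b : Fin (k + 1)) (a e : Expr m k) (ha : a.Fits B s)
      (he : e.Fits B s) :
      Exec B (.store b a e) s (a.cost + e.cost + 1)
        { s with mem := Function.update s.mem b
                          (Function.update (s.mem b) (a.eval s) (e.eval s)) }
  | emit (s : State m k) (e : Expr m k) (he : e.Fits B s) :
      Exec B (.emit e) s (e.cost + 1) { s with out := s.out ++ [e.eval s] }
  | seq {P Q : Cmd m k} {s₁ s₂ s₃ : State m k} {t₁ t₂ : ℕ}
      (h₁ : Exec B P s₁ t₁ s₂) (h₂ : Exec B Q s₂ t₂ s₃) :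
      Exec B (.seq P Q) s₁ (t₁ + t₂) s₃
  | ite_true {c : Expr m k} {P Q : Cmd m k} {s s' : State m k} {t : ℕ}
      (hc : c.Fits B s) (hv : c.eval s ≠ 0) (h : Exec B P s t s') :
      Exec B (.ite c P Q) s (c.cost + 1 + t) s'
  | ite_false {c : Expr m k} {P Q : Cmd m k} {s s' : State m k} {t : ℕ}
      (hc : c.Fits B s) (hv : c.eval s = 0) (h : Exec B Q s t s') :
      Exec B (.ite c P Q) s (c.cost + 1 + t) s'
  | loop_true {c : Expr m k} {P : Cmd m k} {s₁ s₂ s₃ : State m k} {t₁ t₂ : ℕ}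
      (hc : c.Fits B s₁) (hv : c.eval s₁ ≠ 0) (h₁ : Exec B P s₁ t₁ s₂)
      (h₂ : Exec B (.loop c P) s₂ t₂ s₃) :
      Exec B (.loop c P) s₁ (c.cost + 1 + t₁ + t₂) s₃
  | loop_false {c : Expr m k} {P : Cmd m k} {s : State m k}
      (hc : c.Fits B s) (hv : c.eval s = 0) :
      Exec B (.loop c P) s (c.cost + 1) s

/-- The initial state: the input words stand at the start of bank `0`; all other cells and all
registers are `0`; nothing has been written. -/
def init (m k : ℕ) (input : List ℕ) : State m k where
  reg := fun _ => 0
  mem := fun b a => if b = 0 then input.getD a 0 else 0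
  out := []

/-- On the given input, which has to fit into the machine, the program halts with the given
output after at most `time` steps, on a machine with at most `space` words of storage. -/
def Cmd.RunsWithin {m k : ℕ} (P : Cmd m k) (input output : List ℕ) (time space : ℕ) : Prop :=
  ∃ (B t : ℕ) (s' : State m k),
    m + (k + 1) * B ≤ space ∧ t ≤ time ∧
    input.length ≤ B ∧ (∀ x ∈ input, x < B) ∧
    Exec B P (init m k input) t s' ∧ s'.out = output

end WordRAM

/-! ### Frequent substrings -/

/-- The nonempty substrings (contiguous blocks) of the strings `s i` that occur in at least a
`q` fraction of these `n` strings. -/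
def frequentSubstrings {α : Type*} [DecidableEq α] {n : ℕ} (s : Fin n → List α) (q : ℝ) :
    Set (List α) :=
  {w | w ≠ [] ∧ (∃ i, w <:+: s i) ∧
    q * (n : ℝ) ≤ ((Finset.univ.filter fun i => w <:+: s i).card : ℝ)}

/-- A reference to a substring: the index of a string, a start position in it, a length. -/
abbrev SubstringRef (n : ℕ) := Fin n × ℕ × ℕ

/-- The block of length `x.2.2` of the string `s x.1` that starts at position `x.2.1`. -/
def SubstringRef.substring {α : Type*} {n : ℕ} (s : Fin n → List α) (x : SubstringRef n) :
    List α :=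
  ((s x.1).drop x.2.1).take x.2.2

/-- The references in `L` stay inside their strings, and the substrings they denote are
exactly the frequent substrings, each listed exactly once. -/
def IsFrequentReport {α : Type*} [DecidableEq α] {n : ℕ} (s : Fin n → List α) (q : ℝ)
    (L : List (SubstringRef n)) : Prop :=
  (∀ x ∈ L, x.2.1 + x.2.2 ≤ (s x.1).length) ∧
  (L.map (SubstringRef.substring s)).Nodup ∧
  ∀ w, w ∈ L.map (SubstringRef.substring s) ↔ w ∈ frequentSubstrings s q

/-- The input words: `n`, the common length `ℓ`, the least number `⌈q * n⌉` of strings in which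
a reported substring has to occur, and the letters of the strings, one word each. -/
noncomputable def inputWords {σ n : ℕ} (ℓ : ℕ) (s : Fin n → List (Fin σ)) (q : ℝ) : List ℕ :=
  [n, ℓ, ⌈q * (n : ℝ)⌉₊] ++ ((List.ofFn s).flatten.map fun c => (c : ℕ))

/-- A report as a sequence of words, three for each reference. -/
def reportWords {n : ℕ} (L : List (SubstringRef n)) : List ℕ :=
  L.flatMap fun x => [(x.1 : ℕ), x.2.1, x.2.2]

/-! ### A weakest-precondition calculus with a clock -/

namespace WordRAM

variable {m k : ℕ}

/-! The strings are joined to one text of `N = n * (ℓ + 1)` letters, each string being followed by a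
separator. The number of strings that contain a nonempty word is the number of occurrences of the
word that are the first ones in their string, that is, all its occurrences in the text minus the
repeated ones. An occurrence with end `e` is repeated exactly if the word is a suffix of `xs e`, the
longest suffix of the current string up to `e` that already ended earlier in the same string
(`Repeats.occCount_eq`).

Words with the same set of ends form a class, represented by its longest member, a saturated word
(`exists_hull`, `Hull.unique`). The saturated words are the states of the suffix automaton of the
text, at most linearly many, and the class of the state `v` consists of the suffixes of `W v` that
are longer than `W (link v)` (`hull_take`, `length_link_lt`). The words `xs e` are themselves
saturated in the whole text (`Repeats.saturated`). Hence both counts are constant on classes, and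
both are sums over the states whose words end with `W v`: of the indicator of prefixes of the text,
and of the number of `e` with `xs e = W u`. Such sums are obtained by passing each value on to the
link, in an order that puts every state before its suffixes. Reporting then takes constant time for
each state and each reference, and every word is reported once because its hull determines its
state.

The automaton is built letter by letter. A new letter creates at most two saturated words, the whole
text and its longest repeated suffix (`saturated_succ_iff`); `Split.step` and `Split.step_clone`
update links and transitions accordingly. The cost is amortized against the number of saturated
suffixes of the text (`IsSAM.depth_link`, `Split.numSat_le`). Running the construction on each
string alone gives the lengths of the `xs e`, since the link of the newest state is the longest
repeated suffix; a further run treats the whole text. The states of the `xs e` are then found in one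
walk, because `xs (e + 1)` is empty or arises from a suffix of `xs e` by one letter
(`Repeats.step`).

Time is a part of every postcondition: the clock is bounded in the loop invariants, with the
potentials added to it. -/

instance : Add (Expr m k) := ⟨.op .add⟩
instance : Sub (Expr m k) := ⟨.op .sub⟩
instance : Mul (Expr m k) := ⟨.op .mul⟩
instance : Div (Expr m k) := ⟨.op .div⟩
instance : Mod (Expr m k) := ⟨.op .mod⟩

namespace Expr

@[simp] lemma add_def (a b : Expr m k) : a + b = .op .add a b := rfl
@[simp] lemma sub_def (a b : Expr m k) : a - b = .op .sub a b := rfl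
@[simp] lemma mul_def (a b : Expr m k) : a * b = .op .mul a b := rfl
@[simp] lemma div_def (a b : Expr m k) : a / b = .op .div a b := rfl
@[simp] lemma mod_def (a b : Expr m k) : a % b = .op .mod a b := rfl

end Expr

attribute [simp] Expr.eval Expr.Fits Expr.cost Op.eval

namespace State

/-- Assign the register `i`. -/
def setR (s : State m k) (i : Fin m) (x : ℕ) : State m k :=
  { s with reg := Function.update s.reg i x }

/-- Replace the contents of the bank `b`. -/
def setB (s : State m k) (b : Fin (k + 1)) (M : ℕ → ℕ) : State m k :=
  { s with mem := Function.update s.mem b M }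

/-- Append a word to the output. -/
def write (s : State m k) (x : ℕ) : State m k :=
  { s with out := s.out ++ [x] }

variable (s : State m k)

@[simp] lemma setR_reg (i j : Fin m) (x : ℕ) :
    (s.setR i x).reg j = if j = i then x else s.reg j := by
  simp [setR, Function.update_apply]
@[simp] lemma setR_mem (i : Fin m) (x : ℕ) : (s.setR i x).mem = s.mem := rfl
@[simp] lemma setR_out (i : Fin m) (x : ℕ) : (s.setR i x).out = s.out := rfl
@[simp] lemma setB_reg (b : Fin (k + 1)) (M : ℕ → ℕ) : (s.setB b M).reg = s.reg := rfl
@[simp] lemma setB_mem (b b' : Fin (k + 1)) (M : ℕ → ℕ) :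
    (s.setB b M).mem b' = if b' = b then M else s.mem b' := by
  simp [setB, Function.update_apply]
@[simp] lemma setB_out (b : Fin (k + 1)) (M : ℕ → ℕ) : (s.setB b M).out = s.out := rfl
@[simp] lemma write_reg (x : ℕ) : (s.write x).reg = s.reg := rfl
@[simp] lemma write_mem (x : ℕ) : (s.write x).mem = s.mem := rfl
@[simp] lemma write_out (x : ℕ) : (s.write x).out = s.out ++ [x] := rfl

@[simp] lemma setR_setR (i : Fin m) (x y : ℕ) : (s.setR i x).setR i y = s.setR i y := by
  simp [setR]
@[simp] lemma setB_setB (b : Fin (k + 1)) (M M' : ℕ → ℕ) :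
    (s.setB b M).setB b M' = s.setB b M' := by
  simp [setB]
lemma setB_setR (b : Fin (k + 1)) (M : ℕ → ℕ) (i : Fin m) (x : ℕ) :
    (s.setB b M).setR i x = (s.setR i x).setB b M := rfl
@[simp] lemma setR_self (i : Fin m) : s.setR i (s.reg i) = s := by simp [setR]
@[simp] lemma setB_self (b : Fin (k + 1)) : s.setB b (s.mem b) = s := by simp [setB]

end State

/-- `WP B P Q s τ`: started in the state `s` at time `τ`, the program halts in a state and at a
time that satisfy `Q`. -/
def WP (B : ℕ) (P : Cmd m k) (Q : State m k → ℕ → Prop) (s : State m k) (τ : ℕ) : Prop :=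
  ∃ t s', Exec B P s t s' ∧ Q s' (τ + t)

variable {B : ℕ} {P P' : Cmd m k} {Q I : State m k → ℕ → Prop} {s : State m k} {τ : ℕ}

lemma wp_skip (h : Q s (τ + 1)) : WP B .skip Q s τ := ⟨_, _, .skip s, h⟩

lemma wp_assign {i : Fin m} {e : Expr m k} (he : e.Fits B s)
    (h : Q (s.setR i (e.eval s)) (τ + (e.cost + 1))) : WP B (.assign i e) Q s τ :=
  ⟨_, _, .assign s i e he, h⟩

lemma wp_store {b : Fin (k + 1)} {a e : Expr m k} (ha : a.Fits B s) (he : e.Fits B s)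
    (h : Q (s.setB b (Function.update (s.mem b) (a.eval s) (e.eval s)))
      (τ + (a.cost + e.cost + 1))) : WP B (.store b a e) Q s τ :=
  ⟨_, _, .store s b a e ha he, h⟩

lemma wp_emit {e : Expr m k} (he : e.Fits B s)
    (h : Q (s.write (e.eval s)) (τ + (e.cost + 1))) : WP B (.emit e) Q s τ :=
  ⟨_, _, .emit s e he, h⟩

lemma wp_seq (h : WP B P (WP B P' Q) s τ) : WP B (.seq P P') Q s τ := by
  obtain ⟨t, s', he, t', s'', he', hq⟩ := h
  exact ⟨_, _, .seq he he', by rwa [← add_assoc]⟩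

lemma wp_ite {c : Expr m k} (hc : c.Fits B s)
    (h₁ : c.eval s ≠ 0 → WP B P Q s (τ + (c.cost + 1)))
    (h₂ : c.eval s = 0 → WP B P' Q s (τ + (c.cost + 1))) : WP B (.ite c P P') Q s τ := by
  by_cases hv : c.eval s = 0
  · obtain ⟨t, s', he, hq⟩ := h₂ hv
    exact ⟨_, _, .ite_false hc hv he, by rwa [← add_assoc]⟩
  · obtain ⟨t, s', he, hq⟩ := h₁ hv
    exact ⟨_, _, .ite_true hc hv he, by rwa [← add_assoc]⟩

/-- The invariant bounds the clock, which ticks in every round: hence the loop terminates. -/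
lemma wp_loop {c : Expr m k} (M : ℕ) (I : State m k → ℕ → Prop)
    (hM : ∀ s τ, I s τ → τ ≤ M) (hF : ∀ s τ, I s τ → c.Fits B s)
    (hB : ∀ s τ, I s τ → c.eval s ≠ 0 → WP B P I s (τ + (c.cost + 1)))
    (hQ : ∀ s τ, I s τ → c.eval s = 0 → Q s (τ + (c.cost + 1)))
    (h : I s τ) : WP B (.loop c P) Q s τ := by
  induction hd : M + 1 - τ using Nat.strong_induction_on generalizing s τ with
  | _ d ih =>
    by_cases hv : c.eval s = 0
    · exact ⟨_, _, .loop_false (hF _ _ h) hv, hQ _ _ h hv⟩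
    · obtain ⟨t, s', he, hi⟩ := hB _ _ h hv
      have h1 := hM _ _ h
      obtain ⟨t', s'', he', hq⟩ := ih (M + 1 - (τ + (c.cost + 1) + t)) (by omega) hi rfl
      exact ⟨_, _, .loop_true (hF _ _ h) hv he he', by
        rwa [show τ + (c.cost + 1 + t + t') = τ + (c.cost + 1) + t + t' by ring]⟩

end WordRAM

/-! ### Factors of a text and their canonical extensions

Words are written backwards: `revPrefix T e` is the reversed prefix of length `e` of the text
`T`, so that a suffix of a prefix of the text becomes a prefix of a list. -/

/-- The first `e` letters of the text `T`, the last one first. -/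
def revPrefix (T : ℕ → ℕ) : ℕ → List ℕ
  | 0 => []
  | e + 1 => T e :: revPrefix T e

/-- The (reversed) word `w` occurs in the first `p` letters of `T`. -/
def Fac (T : ℕ → ℕ) (p : ℕ) (w : List ℕ) : Prop := ∃ e ≤ p, w <+: revPrefix T e

/-- Every occurrence of `w` in the first `p` letters of `T` extends to one of `u` with the same
end. -/
def OccLe (T : ℕ → ℕ) (p : ℕ) (w u : List ℕ) : Prop :=
  ∀ e ≤ p, w <+: revPrefix T e → u <+: revPrefix T e

/-- `w` cannot be extended without losing an occurrence. -/
def Saturated (T : ℕ → ℕ) (p : ℕ) (w : List ℕ) : Prop := Fac T p w ∧ ∀ a, ¬ OccLe T p w (w ++ [a])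

/-- `u` is the longest extension of `w` with the same occurrences. -/
def Hull (T : ℕ → ℕ) (p : ℕ) (w u : List ℕ) : Prop := w <+: u ∧ OccLe T p w u ∧ Saturated T p u

section Words

variable {T : ℕ → ℕ} {p : ℕ} {w u z x : List ℕ}

@[simp] lemma length_revPrefix (e : ℕ) : (revPrefix T e).length = e := by
  induction e with
  | zero => rfl
  | succ e ih => simp [revPrefix, ih]

lemma cons_prefix_revPrefix {c e : ℕ} :
    c :: w <+: revPrefix T e ↔ ∃ e', e = e' + 1 ∧ T e' = c ∧ w <+: revPrefix T e' := by
  cases e with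
  | zero => simp [revPrefix]
  | succ e =>
    simp only [revPrefix, List.cons_prefix_cons]
    constructor
    · rintro ⟨rfl, h⟩; exact ⟨e, rfl, rfl, h⟩
    · rintro ⟨e', h, rfl, h'⟩
      obtain rfl : e = e' := by omega
      exact ⟨rfl, h'⟩

lemma prefix_total {a b l : List ℕ} (ha : a <+: l) (hb : b <+: l) : a <+: b ∨ b <+: a :=
  List.prefix_or_prefix_of_prefix ha hb

lemma exists_append_singleton_prefix (h : w <+: u) (hl : w.length < u.length) :
    ∃ a, w ++ [a] <+: u := by
  obtain ⟨t, rfl⟩ := h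
  cases t with
  | nil => simp at hl
  | cons a t => exact ⟨a, t, by simp⟩

lemma prefix_antisymm (h : w <+: u) (h' : u <+: w) : w = u :=
  h.eq_of_length (le_antisymm h.length_le h'.length_le)

lemma Fac.mono {p' : ℕ} (h : Fac T p w) (hp : p ≤ p') : Fac T p' w := by
  obtain ⟨e, he, h⟩ := h
  exact ⟨e, he.trans hp, h⟩

lemma Fac.of_prefix (h : Fac T p w) (hu : u <+: w) : Fac T p u := by
  obtain ⟨e, he, h⟩ := h
  exact ⟨e, he, hu.trans h⟩

lemma Fac.length_le (h : Fac T p w) : w.length ≤ p := by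
  obtain ⟨e, he, h⟩ := h
  have := h.length_le
  simp at this
  omega

lemma Fac.occLe (h : Fac T p w) (hu : OccLe T p w u) : Fac T p u := by
  obtain ⟨e, he, h⟩ := h
  exact ⟨e, he, hu e he h⟩

lemma Fac.tail {c : ℕ} (h : Fac T p (c :: w)) : Fac T p w := by
  obtain ⟨e, he, h⟩ := h
  obtain ⟨e', rfl, -, h⟩ := cons_prefix_revPrefix.1 h
  exact ⟨e', by omega, h⟩

lemma fac_succ : Fac T (p + 1) w ↔ Fac T p w ∨ w <+: revPrefix T (p + 1) := by
  constructor
  · rintro ⟨e, he, h⟩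
    rcases Nat.lt_or_eq_of_le he with he | rfl
    · exact .inl ⟨e, by omega, h⟩
    · exact .inr h
  · rintro (h | h)
    · exact h.mono (by omega)
    · exact ⟨_, le_rfl, h⟩

lemma OccLe.of_prefix (h : u <+: w) : OccLe T p w u := fun _ _ h' => h.trans h'

lemma OccLe.trans (h : OccLe T p w u) (h' : OccLe T p u z) : OccLe T p w z :=
  fun e he hw => h' e he (h e he hw)

lemma OccLe.cons (h : OccLe T p w u) (c : ℕ) : OccLe T (p + 1) (c :: w) (c :: u) := by
  intro e he hw
  obtain ⟨e', rfl, hc, hw⟩ := cons_prefix_revPrefix.1 hw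
  exact cons_prefix_revPrefix.2 ⟨e', rfl, hc, h e' (by omega) hw⟩

lemma OccLe.cons_same (h : OccLe T p w u) (c : ℕ) : OccLe T p (c :: w) (c :: u) := by
  intro e he hw
  obtain ⟨e', rfl, hc, hw⟩ := cons_prefix_revPrefix.1 hw
  exact cons_prefix_revPrefix.2 ⟨e', rfl, hc, h e' (by omega) hw⟩

lemma OccLe.of_succ (h : OccLe T (p + 1) w u) : OccLe T p w u := fun e he => h e (by omega)

lemma OccLe.succ (h : OccLe T p w u)
    (h' : w <+: revPrefix T (p + 1) → u <+: revPrefix T (p + 1)) : OccLe T (p + 1) w u := by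
  intro e he hw
  rcases Nat.lt_or_eq_of_le he with he | rfl
  · exact h e (by omega) hw
  · exact h' hw

lemma Saturated.eq_of_occLe (hu : Saturated T p u) (h : u <+: z) (h' : OccLe T p u z) : u = z := by
  by_contra hne
  have hl : u.length < z.length :=
    lt_of_le_of_ne h.length_le fun hl => hne (h.eq_of_length hl)
  obtain ⟨a, ha⟩ := exists_append_singleton_prefix h hl
  exact hu.2 a (h'.trans (.of_prefix ha))

/-- An extension that loses no occurrence of `w` loses none of `c :: w` either. This confines the
saturated suffixes of a longer text to single transitions out of saturated suffixes, which is the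
basis of the amortization. -/
lemma Saturated.tail {c : ℕ} (h : Saturated T p (c :: w)) : Saturated T p w := by
  refine ⟨h.1.tail, fun a ha => h.2 a ?_⟩
  simpa using ha.cons_same c

lemma Saturated.hull (h : Saturated T p w) : Hull T p w w :=
  ⟨List.prefix_rfl, .of_prefix List.prefix_rfl, h⟩

lemma saturated_revPrefix (T : ℕ → ℕ) (p : ℕ) : Saturated T p (revPrefix T p) := by
  refine ⟨⟨p, le_rfl, List.prefix_rfl⟩, fun a ha => ?_⟩
  have := (ha p le_rfl List.prefix_rfl).length_le
  simp at this

lemma saturated_nil (T : ℕ → ℕ) (p : ℕ) : Saturated T p [] := by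
  refine ⟨⟨0, by omega, List.nil_prefix⟩, fun a ha => ?_⟩
  simpa [revPrefix] using ha 0 (by omega) List.nil_prefix

lemma Saturated.succ (h : Saturated T p w) : Saturated T (p + 1) w :=
  ⟨h.1.mono (by omega), fun a ha => h.2 a ha.of_succ⟩

/-- Letters are appended as long as no occurrence is lost; factors have length at most `p`, so this
stops. -/
lemma exists_hull (h : Fac T p w) : ∃ u, Hull T p w u := by
  induction hd : p - w.length generalizing w with
  | zero =>
    refine ⟨w, Saturated.hull ⟨h, fun a ha => ?_⟩⟩
    have := (h.occLe ha).length_le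
    simp at this
    omega
  | succ d ih =>
    by_cases hm : Saturated T p w
    · exact ⟨w, hm.hull⟩
    · have : ∃ a, OccLe T p w (w ++ [a]) := by
        by_contra hc
        exact hm ⟨h, fun a ha => hc ⟨a, ha⟩⟩
      obtain ⟨a, ha⟩ := this
      obtain ⟨u, hu⟩ := ih (h.occLe ha) (by simp; omega)
      exact ⟨u, (List.prefix_append _ _).trans hu.1, ha.trans hu.2.1, hu.2.2⟩

/-- At an occurrence of `w'` both hulls are suffixes of the text, hence comparable. If `u'` is the
shorter one, its occurrences are occurrences of `w` and therefore of `u`, and saturation of `u'`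
forces equality. -/
lemma Hull.mono {w' u' : List ℕ} (h : Hull T p w u) (h' : Hull T p w' u') (hw : w <+: w')
    (hf : Fac T p w') : u <+: u' := by
  obtain ⟨e, he, hwe⟩ := hf
  rcases prefix_total (h.2.1 e he (hw.trans hwe)) (h'.2.1 e he hwe) with h1 | h1
  · exact h1
  · rw [h'.2.2.eq_of_occLe h1 ((OccLe.of_prefix (hw.trans h'.1)).trans h.2.1)]

lemma Hull.fac (h : Hull T p w u) : Fac T p w := h.2.2.1.of_prefix h.1

lemma Hull.unique {u' : List ℕ} (h : Hull T p w u) (h' : Hull T p w u') : u = u' :=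
  prefix_antisymm (h.mono h' List.prefix_rfl h.fac) (h'.mono h List.prefix_rfl h.fac)

/-- `x` is the longest suffix of the first `p + 1` letters that occurs in the first `p` ones. -/
def IsLongest (T : ℕ → ℕ) (p : ℕ) (x : List ℕ) : Prop :=
  x <+: revPrefix T (p + 1) ∧ Fac T p x ∧ ∀ w, w <+: revPrefix T (p + 1) → Fac T p w → w <+: x

lemma not_fac_revPrefix_succ : ¬ Fac T p (revPrefix T (p + 1)) := fun h => by
  have := h.length_le
  simp at this

/-- An extension of `x` without loss would be a longer repeated suffix. -/
lemma IsLongest.saturated (hx : IsLongest T p x) : Saturated T (p + 1) x := by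
  refine ⟨hx.2.1.mono (by omega), fun a ha => ?_⟩
  have h1 := hx.2.2 _ (ha _ le_rfl hx.1) (hx.2.1.occLe ha.of_succ)
  have := h1.length_le
  simp at this

/-- The only new occurrences are those at the end of the text, so saturation is never lost and is
gained only by suffixes of the new text. A suffix that did not occur before has the whole text as
its hull. A repeated one has had a forced extension, which the new occurrence must violate; this is
possible only for `x`, since a shorter suffix is extended inside `x` by the forced letter. -/
lemma saturated_succ_iff (hx : IsLongest T p x) :
    Saturated T (p + 1) w ↔ Saturated T p w ∨ w = x ∨ w = revPrefix T (p + 1) := by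
  constructor
  · intro h
    by_cases hm : Saturated T p w
    · exact .inl hm
    by_cases hf : Fac T p w
    · right; left
      have : ∃ a, OccLe T p w (w ++ [a]) := by
        by_contra hc
        exact hm ⟨hf, fun a ha => hc ⟨a, ha⟩⟩
      obtain ⟨a, ha⟩ := this
      have hwR : w <+: revPrefix T (p + 1) := by
        by_contra hc
        exact h.2 a (ha.succ fun h => absurd h hc)
      have hwx := hx.2.2 w hwR hf
      by_contra hne
      have hl : w.length < x.length :=
        lt_of_le_of_ne hwx.length_le fun hl => hne (hwx.eq_of_length hl)
      obtain ⟨b, hb⟩ := exists_append_singleton_prefix hwx hl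
      -- At an earlier occurrence of `x`, the word `w` is extended by the forced letter `a` and by
      -- the letter `b` of `x`. So `a = b`, and the extension survives the new occurrence.
      obtain ⟨e, he, hxe⟩ := hx.2.1
      have h1 := ha e he (hwx.trans hxe)
      have h2 := hb.trans hxe
      have h3 : w ++ [a] = w ++ [b] :=
        (List.prefix_of_prefix_length_le h1 h2 (by simp)).eq_of_length (by simp)
      rw [← h3] at hb
      exact h.2 a (ha.succ fun _ => hb.trans hx.1)
    · right; right
      obtain hw | hw := fac_succ.1 h.1
      · exact absurd hw hf
      refine h.eq_of_occLe hw ?_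
      exact OccLe.succ (fun e he hwe => absurd ⟨e, he, hwe⟩ hf) fun _ => List.prefix_rfl
  · rintro (h | rfl | rfl)
    · exact h.succ
    · exact hx.saturated
    · exact saturated_revPrefix T (p + 1)

/-- An extension of a factor survives the next letter, unless the next letter ends an occurrence
of the factor but not of the extension. -/
lemma Hull.succ (h : Hull T p w u)
    (h' : w <+: revPrefix T (p + 1) → u <+: revPrefix T (p + 1)) : Hull T (p + 1) w u :=
  ⟨h.1, h.2.1.succ h', h.2.2.succ⟩

lemma hull_revPrefix_succ (h : w <+: revPrefix T (p + 1)) (hf : ¬ Fac T p w) :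
    Hull T (p + 1) w (revPrefix T (p + 1)) :=
  ⟨h, .succ (fun e he hwe => absurd ⟨e, he, hwe⟩ hf) fun _ => List.prefix_rfl,
    saturated_revPrefix T _⟩

end Words

/-! ### Suffix automata -/

/-- The states `1, …, sz - 1` of the automaton are the saturated words of the first `p` letters,
`1` being the empty word and `link` leading to the longest shorter suffix; `0` is an auxiliary
state, from which every letter leads to `1`. A missing transition is a transition to `0`. -/
structure IsSAM (T : ℕ → ℕ) (A p sz : ℕ) (W : ℕ → List ℕ) (link : ℕ → ℕ) (nxt : ℕ → ℕ → ℕ) :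
    Prop where
  two_le : 2 ≤ sz
  W_one : W 1 = []
  inj : ∀ u v, 1 ≤ u → u < sz → 1 ≤ v → v < sz → W u = W v → u = v
  sat : ∀ v, 1 ≤ v → v < sz → Saturated T p (W v)
  surj : ∀ w, Saturated T p w → ∃ v, 1 ≤ v ∧ v < sz ∧ W v = w
  link_one : link 1 = 0
  link_pos : ∀ v, 2 ≤ v → v < sz → 1 ≤ link v ∧ link v < sz
  link_lt : ∀ v, 2 ≤ v → v < sz → W (link v) <+: W v ∧ (W (link v)).length < (W v).length
  link_max : ∀ v w, 2 ≤ v → v < sz → Saturated T p w → w <+: W v → w ≠ W v → w <+: W (link v)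
  nxt_zero : ∀ c < A, nxt 0 c = 1
  nxt_fac : ∀ v c, 1 ≤ v → v < sz → c < A → Fac T p (c :: W v) →
    1 ≤ nxt v c ∧ nxt v c < sz ∧ Hull T p (c :: W v) (W (nxt v c))
  nxt_not : ∀ v c, 1 ≤ v → v < sz → c < A → ¬ Fac T p (c :: W v) → nxt v c = 0

/-- The length of the word of a state plus one, and `0` for the auxiliary state. -/
def stLen (W : ℕ → List ℕ) (v : ℕ) : ℕ := if v = 0 then 0 else (W v).length + 1

/-- The word of a state followed by the letter `c`; the empty word for the auxiliary state. -/
def extWord (W : ℕ → List ℕ) (v c : ℕ) : List ℕ := if v = 0 then [] else c :: W v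

/-- The word of the state `v` is a suffix of `z`. -/
def OnPath (sz : ℕ) (W : ℕ → List ℕ) (z : List ℕ) (v : ℕ) : Prop := v < sz ∧ (v ≠ 0 → W v <+: z)

/-- The number of saturated suffixes of `w`. -/
noncomputable def numSat (T : ℕ → ℕ) (p : ℕ) (w : List ℕ) : ℕ :=
  open Classical in ((w.inits.toFinset).filter (Saturated T p)).card

/-- The number of states on the path of links from `v` to `1`. -/
noncomputable def depth (T : ℕ → ℕ) (p : ℕ) (W : ℕ → List ℕ) (v : ℕ) : ℕ :=
  if v = 0 then 0 else numSat T p (W v)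

/-- `nxt'` is obtained from `nxt` by redirecting to `val` the transitions with the letter `c` from
all the states on the path of `z` that lie strictly below `v`. -/
def Redirected (A sz : ℕ) (W : ℕ → List ℕ) (z : List ℕ) (v c val : ℕ) (nxt nxt' : ℕ → ℕ → ℕ) :
    Prop :=
  ∀ u d, d < A → ((1 ≤ u ∧ u < sz ∧ d = c ∧ W u <+: z ∧ stLen W v ≤ (W u).length) →
    nxt' u d = val) ∧ (¬ (1 ≤ u ∧ u < sz ∧ d = c ∧ W u <+: z ∧ stLen W v ≤ (W u).length) →
    nxt' u d = nxt u d)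

section SAM

variable {T : ℕ → ℕ} {A p sz : ℕ} {W : ℕ → List ℕ} {link : ℕ → ℕ} {nxt : ℕ → ℕ → ℕ}
  {z : List ℕ} {v c : ℕ}

@[simp] lemma stLen_zero : stLen W 0 = 0 := rfl

lemma stLen_pos (hv : v ≠ 0) : stLen W v = (W v).length + 1 := if_neg hv

lemma length_extWord : (extWord W v c).length = stLen W v := by
  unfold extWord stLen
  split_ifs <;> simp

lemma extWord_pos (hv : v ≠ 0) : extWord W v c = c :: W v := if_neg hv

lemma isSAM_init (h1 : link 1 = 0) (h0 : ∀ c < A, nxt 0 c = 1) (h2 : ∀ c < A, nxt 1 c = 0) :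
    IsSAM T A 0 2 (fun _ => []) link nxt where
  two_le := le_rfl
  W_one := rfl
  inj u v hu hu' hv hv' _ := by omega
  sat v _ _ := saturated_nil T 0
  surj w hw := ⟨1, le_rfl, by omega, (List.eq_nil_of_length_eq_zero (by
    have := hw.1.length_le; omega)).symm⟩
  link_one := h1
  link_pos v _ _ := by omega
  link_lt v _ _ := by omega
  link_max v w _ _ := by omega
  nxt_zero := h0
  nxt_fac v c _ _ _ h := by
    have := h.length_le
    simp at this
  nxt_not v c hv hv' hc _ := by
    obtain rfl : v = 1 := by omega
    exact h2 c hc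

namespace IsSAM

lemma link_lt_size (h : IsSAM T A p sz W link nxt) (hv : v ≠ 0) (hv' : v < sz) : link v < sz := by
  have := h.two_le
  by_cases h1 : v = 1
  · rw [h1, h.link_one]; omega
  · exact (h.link_pos v (by omega) hv').2

lemma stLen_link_le (h : IsSAM T A p sz W link nxt) (hv : v ≠ 0) (hv' : v < sz) :
    stLen W (link v) ≤ (W v).length := by
  by_cases h1 : v = 1
  · rw [h1, h.link_one]; simp
  · have h2 := h.link_pos v (by omega) hv'
    have h3 := (h.link_lt v (by omega) hv').2
    rw [stLen_pos (by omega)]; omega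

/-- Following a link passes exactly one state of the path. -/
lemma climb (h : IsSAM T A p sz W link nxt) (hp : OnPath sz W z v) (hv : v ≠ 0) :
    OnPath sz W z (link v) ∧ ∀ u, 1 ≤ u → u < sz → W u <+: z →
      (stLen W (link v) ≤ (W u).length ↔ stLen W v ≤ (W u).length ∨ u = v) := by
  obtain ⟨hvs, hvz⟩ := hp
  have hvz := hvz hv
  have hle := h.stLen_link_le hv hvs
  refine ⟨⟨h.link_lt_size hv hvs, fun h0 => ?_⟩, fun u hu hus huz => ⟨fun hl => ?_, ?_⟩⟩
  · by_cases h1 : v = 1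
    · rw [h1, h.link_one] at h0; exact absurd rfl h0
    · exact (h.link_lt v (by omega) hvs).1.trans hvz
  · by_contra! hc
    have hc1 := hc.1
    rw [stLen_pos hv] at hc1
    have huv : W u <+: W v := List.prefix_of_prefix_length_le huz hvz (by omega)
    by_cases he : W u = W v
    · exact hc.2 (h.inj u v hu hus (by omega) hvs he)
    · by_cases h1 : v = 1
      · rw [h1, h.W_one] at huv he
        exact he (List.prefix_nil.1 huv)
      · have h3 := (h.link_max v _ (by omega) hvs (h.sat u hu hus) huv he).length_le
        have h4 := h.link_pos v (by omega) hvs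
        rw [stLen_pos (by omega)] at hl
        omega
  · rintro (hl | rfl)
    · rw [stLen_pos hv] at hl; omega
    · exact hle

/-- The saturated suffixes of `W (link v)` are among those of `W v`, and `W v` itself drops out.
This pays for following a link. -/
lemma depth_link (h : IsSAM T A p sz W link nxt) (hv : v ≠ 0) (hv' : v < sz) :
    depth T p W (link v) + 1 ≤ depth T p W v := by
  classical
  have hself : W v ∈ ((W v).inits.toFinset).filter (Saturated T p) := by
    simp [h.sat v (by omega) hv']
  unfold depth
  rw [if_neg hv]
  split_ifs with h0
  · exact Finset.card_pos.2 ⟨_, hself⟩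
  · have h1 : v ≠ 1 := fun h1 => h0 (by rw [h1, h.link_one])
    have h2 := h.link_lt v (by omega) hv'
    unfold numSat
    refine Finset.card_lt_card ⟨fun w hw => ?_, fun hs => ?_⟩
    · simp only [Finset.mem_filter, List.mem_toFinset, List.mem_inits] at hw ⊢
      exact ⟨hw.1.trans h2.1, hw.2⟩
    · have := hs hself
      simp only [Finset.mem_filter, List.mem_toFinset, List.mem_inits] at this
      have := this.1.length_le
      omega

/-- Below a state on the path of `z` every state of the path is one of its suffixes. -/
lemma prefix_of_lt (hp : OnPath sz W z v) {u : ℕ} (hu : W u <+: z)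
    (hl : (W u).length < stLen W v) : v ≠ 0 ∧ W u <+: W v := by
  have hv : v ≠ 0 := by rintro rfl; simp at hl
  rw [stLen_pos hv] at hl
  exact ⟨hv, List.prefix_of_prefix_length_le hu (hp.2 hv) (by omega)⟩

end IsSAM

/-- No suffix of `W v` is longer than `W v`, so at the start of a climb nothing has to be
redirected. -/
lemma redirected_refl {val : ℕ} (hv : z = W v) (h0 : v ≠ 0) :
    Redirected A sz W z v c val nxt nxt := by
  refine fun u d _ => ⟨fun h => ?_, fun _ => rfl⟩
  have h1 := h.2.2.2.1.length_le
  have h2 := h.2.2.2.2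
  rw [stLen_pos h0, ← hv] at h2
  omega

/-- By `IsSAM.climb`, replacing `v` by its link adds exactly the state `v` to those that have to be
redirected. -/
lemma Redirected.step {val : ℕ} {nxt' nxt'' : ℕ → ℕ → ℕ} {base : ℕ → ℕ → ℕ}
    (h : IsSAM T A p sz W link nxt) (hr : Redirected A sz W z v c val base nxt')
    (hp : OnPath sz W z v) (hv : v ≠ 0)
    (hn : ∀ u d, d < A → nxt'' u d = if u = v ∧ d = c then val else nxt' u d) :
    Redirected A sz W z (link v) c val base nxt'' := by
  intro u d hd
  have hc := (h.climb hp hv).2 u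
  rw [hn u d hd]
  constructor
  · rintro ⟨h1, h2, rfl, h3, h4⟩
    split_ifs with hif
    · rfl
    · refine (hr u d hd).1 ⟨h1, h2, rfl, h3, ?_⟩
      exact ((hc h1 h2 h3).1 h4).resolve_right fun he => hif ⟨he, rfl⟩
  · intro hneg
    rw [if_neg]
    · refine (hr u d hd).2 fun ⟨h1, h2, h3, h4, h5⟩ => hneg ⟨h1, h2, h3, h4, ?_⟩
      exact (hc h1 h2 h4).2 (.inl h5)
    · rintro ⟨rfl, rfl⟩
      exact hneg ⟨by omega, hp.1, rfl, hp.2 hv, (hc (by omega) hp.1 (hp.2 hv)).2 (.inr rfl)⟩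

/-- The state reached by a climb is still untouched, so the loop test reads its original entry. -/
lemma Redirected.self {val : ℕ} {nxt' : ℕ → ℕ → ℕ} (hr : Redirected A sz W z v c val nxt nxt')
    {d : ℕ} (hd : d < A) : nxt' v d = nxt v d := by
  refine (hr v d hd).2 fun h => ?_
  have := h.2.2.2.2
  rw [stLen_pos (by omega)] at this
  omega

/-! ### One step of the online construction -/

/-- The situation after the new state `sz` has been made the target of all missing transitions
with the next letter from suffixes of the text: `v` is the longest suffix that had one. -/
structure Split (T : ℕ → ℕ) (A p sz : ℕ) (W : ℕ → List ℕ) (link : ℕ → ℕ) (nxt nxt₁ : ℕ → ℕ → ℕ)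
    (v : ℕ) : Prop where
  sam : IsSAM T A p sz W link nxt
  letter : T p < A
  path : OnPath sz W (revPrefix T p) v
  longest : IsLongest T p (extWord W v (T p))
  hull : Hull T p (extWord W v (T p)) (W (nxt v (T p)))
  target : 1 ≤ nxt v (T p) ∧ nxt v (T p) < sz
  zero : ∀ d < A, nxt₁ 0 d = 1
  old : ∀ u d, 1 ≤ u → u < sz → d < A → Fac T p (d :: W u) → nxt₁ u d = nxt u d
  new : ∀ u d, 1 ≤ u → u < sz → d < A → ¬ Fac T p (d :: W u) →
    d :: W u <+: revPrefix T (p + 1) → nxt₁ u d = sz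
  none : ∀ u d, 1 ≤ u → u < sz → d < A → ¬ Fac T p (d :: W u) →
    ¬ d :: W u <+: revPrefix T (p + 1) → nxt₁ u d = 0

/-- The climb stops at the longest suffix state that had a transition with the new letter. Looking
at states only loses nothing: if `T p :: w'` is a repeated suffix, then so is the hull of `w'`
followed by that letter. -/
lemma IsSAM.split (h : IsSAM T A p sz W link nxt) (hA : T p < A) {nxt₁ : ℕ → ℕ → ℕ}
    (hp : OnPath sz W (revPrefix T p) v)
    (hall : ∀ u, 1 ≤ u → u < sz → W u <+: revPrefix T p → stLen W v ≤ (W u).length →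
      nxt u (T p) = 0)
    (hr : Redirected A sz W (revPrefix T p) v (T p) sz nxt nxt₁)
    (hv : nxt v (T p) ≠ 0) : Split T A p sz W link nxt nxt₁ v := by
  have h2 := h.two_le
  have hnot : ∀ u, 1 ≤ u → u < sz → W u <+: revPrefix T p → stLen W v ≤ (W u).length →
      ¬ Fac T p (T p :: W u) := fun u h1 h2 h3 h4 hf => by
    have := (h.nxt_fac u _ h1 h2 hA hf).1
    have := hall u h1 h2 h3 h4
    omega
  have hfac : v ≠ 0 → Fac T p (T p :: W v) := fun h0 => by
    by_contra hf
    exact hv (h.nxt_not v _ (by omega) hp.1 hA hf)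
  have hx : IsLongest T p (extWord W v (T p)) := by
    have hmax : ∀ w', w' <+: revPrefix T p → Fac T p (T p :: w') →
        w'.length < stLen W v := by
      intro w' hw' hf
      -- The hull of `w'` also ends at `p`, and it precedes the letter wherever `w'` does. Its state
      -- therefore has the transition and cannot have been passed by the climb.
      obtain ⟨u, hu⟩ := exists_hull hf.tail
      obtain ⟨i, hi1, hi2, rfl⟩ := h.surj u hu.2.2
      by_contra hlt
      have hf' : Fac T p (T p :: W i) := hf.occLe (hu.2.1.cons_same _)
      refine hnot i hi1 hi2 (hu.2.1 p le_rfl hw') ?_ hf'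
      have := hu.1.length_le
      omega
    have hgen : ∀ w, w <+: revPrefix T (p + 1) → Fac T p w → w <+: extWord W v (T p) := by
      intro w hw hf
      cases w with
      | nil => exact List.nil_prefix
      | cons d w' =>
        simp only [revPrefix, List.cons_prefix_cons] at hw
        obtain ⟨rfl, hw⟩ := hw
        have hl := hmax w' hw hf
        have h0 : v ≠ 0 := by rintro rfl; simp at hl
        rw [stLen_pos h0] at hl
        rw [extWord_pos h0, List.cons_prefix_cons]
        exact ⟨rfl, List.prefix_of_prefix_length_le hw (hp.2 h0) (by omega)⟩
    by_cases h0 : v = 0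
    · refine ⟨?_, ?_, hgen⟩
      · simp [extWord, h0]
      · simpa [extWord, h0] using (saturated_nil T p).1
    · refine ⟨?_, ?_, hgen⟩
      · rw [extWord_pos h0]
        simpa [revPrefix] using hp.2 h0
      · rw [extWord_pos h0]
        exact hfac h0
  -- A transition is redirected exactly if it leads to a suffix of the new text that did not occur
  -- before.
  have key : ∀ u d, 1 ≤ u → u < sz → d < A →
      ((1 ≤ u ∧ u < sz ∧ d = T p ∧ W u <+: revPrefix T p ∧ stLen W v ≤ (W u).length) ↔
      (¬ Fac T p (d :: W u) ∧ d :: W u <+: revPrefix T (p + 1))) := by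
    intro u d h1 h2 hd
    constructor
    · rintro ⟨-, -, rfl, h3, h4⟩
      exact ⟨hnot u h1 h2 h3 h4, by simpa [revPrefix] using h3⟩
    · rintro ⟨h3, h4⟩
      simp only [revPrefix, List.cons_prefix_cons] at h4
      obtain ⟨rfl, h4⟩ := h4
      refine ⟨h1, h2, rfl, h4, ?_⟩
      by_contra hlt
      obtain ⟨h0, h5⟩ := IsSAM.prefix_of_lt hp h4 (by omega)
      exact h3 ((hfac h0).of_prefix (by simpa using h5))
  have hq : 1 ≤ nxt v (T p) ∧ nxt v (T p) < sz ∧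
      Hull T p (extWord W v (T p)) (W (nxt v (T p))) := by
    by_cases h0 : v = 0
    · rw [h0, h.nxt_zero _ hA, h.W_one]
      refine ⟨le_rfl, by omega, ?_⟩
      simpa [extWord] using (saturated_nil T p).hull
    · rw [extWord_pos h0]
      exact h.nxt_fac v _ (by omega) hp.1 hA (hfac h0)
  refine ⟨h, hA, hp, hx, hq.2.2, ⟨hq.1, hq.2.1⟩, fun d hd => ?_, fun u d h1 h2 hd hf => ?_,
    fun u d h1 h2 hd hf hpre => ?_, fun u d h1 h2 hd hf hpre => ?_⟩
  · rw [(hr 0 d hd).2 (by omega), h.nxt_zero d hd]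
  · exact (hr u d hd).2 fun hc => ((key u d h1 h2 hd).1 hc).1 hf
  · exact (hr u d hd).1 ((key u d h1 h2 hd).2 ⟨hf, hpre⟩)
  · rw [(hr u d hd).2 fun hc => hpre ((key u d h1 h2 hd).1 hc).2]
    exact h.nxt_not u d h1 h2 hd hf

end SAM

section SAM

variable {T : ℕ → ℕ} {A p sz : ℕ} {W : ℕ → List ℕ} {link : ℕ → ℕ} {nxt nxt₁ : ℕ → ℕ → ℕ}
  {v : ℕ}

namespace Split

lemma not_prefix (S : Split T A p sz W link nxt nxt₁ v) {u : ℕ} (h1 : 1 ≤ u) (h2 : u < sz) :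
    ¬ revPrefix T (p + 1) <+: W u := fun h =>
  not_fac_revPrefix_succ ((S.sam.sat u h1 h2).1.of_prefix h)

lemma prefix_ext (S : Split T A p sz W link nxt nxt₁ v) {w : List ℕ} (hf : Fac T p w)
    (hw : w <+: revPrefix T (p + 1)) : w <+: extWord W v (T p) := S.longest.2.2 w hw hf

lemma length_ext_le (S : Split T A p sz W link nxt nxt₁ v) :
    (extWord W v (T p)).length ≤ p := S.longest.2.1.length_le

/-- The step of the construction in which the longest repeated suffix is already a state. -/
lemma step (S : Split T A p sz W link nxt nxt₁ v) (hq : W (nxt v (T p)) = extWord W v (T p))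
    {W' : ℕ → List ℕ} {link' : ℕ → ℕ}
    (hW : ∀ u < sz, W' u = W u) (hW' : W' sz = revPrefix T (p + 1))
    (hl : ∀ u < sz, link' u = link u) (hl' : link' sz = nxt v (T p))
    (hrow : ∀ d < A, nxt₁ sz d = 0) : IsSAM T A (p + 1) (sz + 1) W' link' nxt₁ := by
  have h := S.sam
  have h2 := h.two_le
  have hx := S.longest
  have hxl := S.length_ext_le
  obtain ⟨hq1, hq2⟩ := S.target
  have cases : ∀ u, u < sz + 1 → u < sz ∨ u = sz := fun u hu => by omega
  refine ⟨by omega, by rw [hW 1 (by omega), h.W_one], ?_, ?_, ?_, by rw [hl 1 (by omega),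
    h.link_one], ?_, ?_, ?_, S.zero, ?_, ?_⟩
  · intro u u' hu1 hu2 hu1' hu2' he
    rcases cases u hu2 with hu | rfl <;> rcases cases u' hu2' with hu' | rfl
    · rw [hW u hu, hW u' hu'] at he
      exact h.inj u u' hu1 hu hu1' hu' he
    · rw [hW u hu, hW'] at he
      exact absurd (he ▸ List.prefix_rfl) (S.not_prefix hu1 hu)
    · rw [hW u' hu', hW'] at he
      exact absurd (he ▸ List.prefix_rfl) (S.not_prefix hu1' hu')
    · rfl
  · intro u hu1 hu2
    rcases cases u hu2 with hu | rfl
    · rw [hW u hu]; exact (h.sat u hu1 hu).succ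
    · rw [hW']; exact saturated_revPrefix T _
  · intro w hw
    rcases (saturated_succ_iff hx).1 hw with hw | rfl | rfl
    · obtain ⟨u, hu1, hu2, rfl⟩ := h.surj w hw
      exact ⟨u, hu1, by omega, hW u hu2⟩
    · exact ⟨_, hq1, by omega, by rw [hW _ hq2, hq]⟩
    · exact ⟨sz, by omega, by omega, hW'⟩
  · intro u hu1 hu2
    rcases cases u hu2 with hu | rfl
    · rw [hl u hu]
      have := h.link_pos u hu1 hu
      omega
    · rw [hl']; omega
  · intro u hu1 hu2
    rcases cases u hu2 with hu | rfl
    · rw [hl u hu, hW u hu, hW _ (h.link_pos u hu1 hu).2]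
      exact h.link_lt u hu1 hu
    · rw [hl', hW', hW _ hq2, hq]
      refine ⟨hx.1, ?_⟩
      simp; omega
  · intro u w hu1 hu2 hw hwu hne
    rcases cases u hu2 with hu | rfl
    · rw [hW u hu] at hwu hne
      rw [hl u hu, hW _ (h.link_pos u hu1 hu).2]
      refine h.link_max u w hu1 hu ?_ hwu hne
      rcases (saturated_succ_iff hx).1 hw with hw | rfl | rfl
      · exact hw
      · rw [← hq]; exact h.sat _ hq1 hq2
      · exact absurd hwu (S.not_prefix (by omega) hu)
    · rw [hW'] at hwu hne
      rw [hl', hW _ hq2, hq]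
      rcases (saturated_succ_iff hx).1 hw with hw | rfl | rfl
      · exact S.prefix_ext hw.1 hwu
      · exact List.prefix_rfl
      · exact absurd rfl hne
  · intro u d hu1 hu2 hd hf
    rcases cases u hu2 with hu | rfl
    · rw [hW u hu] at hf ⊢
      by_cases hf' : Fac T p (d :: W u)
      · rw [S.old u d hu1 hu hd hf']
        obtain ⟨h3, h4, h5⟩ := h.nxt_fac u d hu1 hu hd hf'
        refine ⟨h3, by omega, ?_⟩
        rw [hW _ h4]
        refine h5.succ fun hpre => ?_
        have h6 := S.prefix_ext hf' hpre
        have h7 : Hull T p (extWord W v (T p)) (extWord W v (T p)) := by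
          have := S.hull; rwa [hq] at this
        exact (h5.mono h7 h6 hx.2.1).trans hx.1
      · have hpre := (fac_succ.1 hf).resolve_left hf'
        rw [S.new u d hu1 hu hd hf' hpre, hW']
        exact ⟨by omega, by omega, hull_revPrefix_succ hpre hf'⟩
    · rw [hW'] at hf
      have := hf.length_le
      simp at this
  · intro u d hu1 hu2 hd hf
    rcases cases u hu2 with hu | rfl
    · rw [hW u hu, fac_succ, not_or] at hf
      exact S.none u d hu1 hu hd hf.1 hf.2
    · exact hrow d hd

/-- The step of the construction in which the longest repeated suffix becomes a new state, split
off the state `nxt v (T p)`. -/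
lemma step_clone (S : Split T A p sz W link nxt nxt₁ v)
    (hq : W (nxt v (T p)) ≠ extWord W v (T p))
    {W' : ℕ → List ℕ} {link' : ℕ → ℕ} {nxt₂ nxt₃ : ℕ → ℕ → ℕ} {v' : ℕ}
    (hW : ∀ u < sz, W' u = W u) (hW' : W' sz = revPrefix T (p + 1))
    (hW'' : W' (sz + 1) = extWord W v (T p))
    (hl : ∀ u < sz, u ≠ nxt v (T p) → link' u = link u)
    (hlq : link' (nxt v (T p)) = sz + 1) (hl' : link' sz = sz + 1)
    (hl'' : link' (sz + 1) = link (nxt v (T p)))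
    (hcopy : ∀ u d, d < A → nxt₂ u d = if u = sz + 1 then nxt₁ (nxt v (T p)) d else nxt₁ u d)
    (hp : OnPath sz W (W v) v')
    (hall : ∀ u, 1 ≤ u → u < sz → W u <+: W v → stLen W v' ≤ (W u).length →
      nxt₁ u (T p) = nxt v (T p))
    (hr : Redirected A sz W (W v) v' (T p) (sz + 1) nxt₂ nxt₃)
    (hv' : nxt₁ v' (T p) ≠ nxt v (T p))
    (hrow : ∀ d < A, nxt₁ sz d = 0) : IsSAM T A (p + 1) (sz + 2) W' link' nxt₃ := by
  have h := S.sam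
  have h2 := h.two_le
  have hx := S.longest
  have hxl := S.length_ext_le
  have hA := S.letter
  have hh := S.hull
  obtain ⟨hq1, hq2⟩ := S.target
  set q := nxt v (T p) with hqdef
  set x := extWord W v (T p) with hxdef
  have hv0 : v ≠ 0 := by
    intro h0
    apply hq
    rw [hxdef, hqdef, h0, h.nxt_zero _ hA, h.W_one]
    rfl
  have hxc : x = T p :: W v := extWord_pos hv0
  have hfx : Fac T p (T p :: W v) := hxc ▸ hx.2.1
  have hxns : ¬ Saturated T p x := fun hs => hq (hh.unique hs.hull)
  have hxq : x <+: W q := hh.1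
  have hxql : x.length < (W q).length :=
    lt_of_le_of_ne hxq.length_le fun hl => hq (hxq.eq_of_length hl).symm
  have hq_two : 2 ≤ q := by
    by_contra hc
    obtain h1 : q = 1 := by omega
    rw [h1, h.W_one] at hxql
    simp at hxql
  -- A saturated word above `x` lies above `W q`.
  have habove : ∀ w, Saturated T p w → x <+: w → W q <+: w := fun w hw hxw =>
    hh.mono hw.hull hxw hw.1
  -- A saturated proper suffix of `W q` is a suffix of `x`.
  have hbelow : ∀ w, Saturated T p w → w <+: W q → w ≠ W q → w <+: x := by
    intro w hw hwq hne
    rcases prefix_total hwq hxq with h3 | h3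
    · exact h3
    · exact absurd (prefix_antisymm hwq (habove w hw h3)) hne
  have hlq1 := h.link_pos q hq_two hq2
  have hlq2 := h.link_lt q hq_two hq2
  have hlqx : W (link q) <+: x := hbelow _ (h.sat _ hlq1.1 hlq1.2) hlq2.1 fun he => by
    rw [he] at hlq2; omega
  have hlqxl : (W (link q)).length < x.length := by
    refine lt_of_le_of_ne hlqx.length_le fun he => hxns ?_
    rw [← hlqx.eq_of_length he]
    exact h.sat _ hlq1.1 hlq1.2
  have hpv : ∀ u, W u <+: W v → W u <+: revPrefix T p := fun u hu => hu.trans (S.path.2 hv0)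
  have hfv : ∀ u, W u <+: W v → Fac T p (T p :: W u) := fun u hu =>
    hfx.of_prefix (by simpa using hu)
  -- The redirected transitions are those with the words that `x` represents from now on.
  have hred : ∀ u d, 1 ≤ u → u < sz → d < A → (nxt₃ u d = sz + 1 ∧ Fac T p (d :: W u) ∧
      d :: W u <+: x ∧ nxt u d = q) ∨
      (nxt₃ u d = nxt₁ u d ∧ (Fac T p (d :: W u) → d :: W u <+: x → nxt u d ≠ q)) := by
    intro u d hu1 hu2 hd
    have hc := hr u d hd
    have h3 : nxt₂ u d = nxt₁ u d := by rw [hcopy u d hd, if_neg (by omega)]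
    by_cases hcond : 1 ≤ u ∧ u < sz ∧ d = T p ∧ W u <+: W v ∧ stLen W v' ≤ (W u).length
    · obtain ⟨-, -, rfl, h4, h5⟩ := id hcond
      refine .inl ⟨hc.1 hcond, hfv u h4, ?_, ?_⟩
      · rw [hxc]; simpa using h4
      · rw [← S.old u _ hu1 hu2 hd (hfv u h4)]
        exact hall u hu1 hu2 h4 h5
    · refine .inr ⟨(hc.2 hcond).trans h3, fun hf hpre hqq => ?_⟩
      rw [hxc, List.cons_prefix_cons] at hpre
      obtain ⟨rfl, hpre⟩ := hpre
      have hlt : (W u).length < stLen W v' := by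
        by_contra hge
        exact hcond ⟨hu1, hu2, rfl, hpre, by omega⟩
      obtain ⟨hv0', huv⟩ := IsSAM.prefix_of_lt hp hpre hlt
      have hfv' := hfv v' (hp.2 hv0')
      have h6 := h.nxt_fac v' _ (by omega) hp.1 hd hfv'
      have h7 := h.nxt_fac u _ hu1 hu2 hd hf
      rw [hqq] at h7
      have h8 := h7.2.2.mono h6.2.2 (by simpa using huv) hfv'
      have h9 : W (nxt v' (T p)) <+: W q :=
        h6.2.2.mono hh (by rw [hxc]; simpa using hp.2 hv0') hx.2.1
      have h10 := h.inj _ _ h6.1 h6.2.1 hq1 hq2 (prefix_antisymm h9 h8)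
      exact hv' (by rw [S.old v' _ (by omega) hp.1 hd hfv', h10])
  have cases : ∀ u, u < sz + 2 → u < sz ∨ u = sz ∨ u = sz + 1 := fun u hu => by omega
  have hnotq : ∀ u, 1 ≤ u → u < sz → W u ≠ x := fun u hu1 hu he => hxns (he ▸ h.sat u hu1 hu)
  have hxR : x ≠ revPrefix T (p + 1) := fun he => not_fac_revPrefix_succ (he ▸ hx.2.1)
  -- The transitions of an old state.
  have hnxt : ∀ u d, 1 ≤ u → u < sz → d < A → Fac T (p + 1) (d :: W u) →
      1 ≤ nxt₃ u d ∧ nxt₃ u d < sz + 2 ∧ Hull T (p + 1) (d :: W u) (W' (nxt₃ u d)) := by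
    intro u d hu1 hu hd hf
    rcases hred u d hu1 hu hd with ⟨h3, h4, h5, h6⟩ | ⟨h3, h4⟩
    · rw [h3, hW'']
      refine ⟨by omega, by omega, h5, ?_, hx.saturated⟩
      refine OccLe.succ ?_ fun _ => hx.1
      have h7 := (h.nxt_fac u d hu1 hu hd h4).2.2
      rw [h6] at h7
      exact h7.2.1.trans (.of_prefix hxq)
    · rw [h3]
      by_cases hf' : Fac T p (d :: W u)
      · rw [S.old u d hu1 hu hd hf']
        obtain ⟨h5, h6, h7⟩ := h.nxt_fac u d hu1 hu hd hf'
        refine ⟨h5, by omega, ?_⟩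
        rw [hW _ h6]
        refine h7.succ fun hpre => ?_
        have h8 := S.prefix_ext hf' hpre
        have h9 := h7.mono hh h8 hx.2.1
        refine (hbelow _ (h.sat _ h5 h6) h9 fun he => ?_).trans hx.1
        exact h4 hf' h8 (h.inj _ _ h5 h6 hq1 hq2 he)
      · have hpre := (fac_succ.1 hf).resolve_left hf'
        rw [S.new u d hu1 hu hd hf' hpre, hW']
        exact ⟨by omega, by omega, hull_revPrefix_succ hpre hf'⟩
  have hnxt0 : ∀ u d, 1 ≤ u → u < sz → d < A → ¬ Fac T (p + 1) (d :: W u) → nxt₃ u d = 0 := by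
    intro u d hu1 hu hd hf
    rw [fac_succ, not_or] at hf
    rcases hred u d hu1 hu hd with ⟨-, h4, -⟩ | ⟨h3, -⟩
    · exact absurd h4 hf.1
    · rw [h3]
      exact S.none u d hu1 hu hd hf.1 hf.2
  have hrow3 : ∀ u d, d < A → (u = 0 ∨ sz ≤ u) → nxt₃ u d = nxt₂ u d := fun u d hd hu =>
    (hr u d hd).2 (by omega)
  have hclone : ∀ d < A, nxt₃ (sz + 1) d = nxt₃ q d := by
    intro d hd
    rw [hrow3 _ _ hd (by omega), hcopy _ _ hd, if_pos rfl]
    -- The row of `q` is not affected by the redirection, as `d :: W q` is longer than `x`. Hence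
    -- the copy taken beforehand is the final row of `q`.
    rcases hred q d hq1 hq2 hd with ⟨-, -, h5, -⟩ | ⟨h3, -⟩
    · have := h5.length_le
      simp at this
      omega
    · exact h3.symm
  -- `x` and `W q` have the same ends among the first `p` letters, and one more letter moves an end
  -- by one. So the clone may share the transitions of `q` even for the longer text.
  have hxfac : ∀ d, OccLe T (p + 1) (d :: x) (d :: W q) := fun d => hh.2.1.cons d
  refine ⟨by omega, by rw [hW 1 (by omega), h.W_one], ?_, ?_, ?_, by
    rw [hl 1 (by omega) (by omega), h.link_one], ?_, ?_, ?_, ?_, ?_, ?_⟩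
  · intro u u' hu1 hu2 hu1' hu2' he
    rcases cases u hu2 with hu | rfl | rfl <;> rcases cases u' hu2' with hu' | rfl | rfl
    · rw [hW u hu, hW u' hu'] at he
      exact h.inj u u' hu1 hu hu1' hu' he
    · rw [hW u hu, hW'] at he
      exact absurd (he ▸ List.prefix_rfl) (S.not_prefix hu1 hu)
    · rw [hW u hu, hW''] at he
      exact absurd he (hnotq u hu1 hu)
    · rw [hW u' hu', hW'] at he
      exact absurd (he ▸ List.prefix_rfl) (S.not_prefix hu1' hu')
    · rfl
    · rw [hW', hW''] at he
      exact absurd he.symm hxR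
    · rw [hW u' hu', hW''] at he
      exact absurd he.symm (hnotq u' hu1' hu')
    · rw [hW', hW''] at he
      exact absurd he hxR
    · rfl
  · intro u hu1 hu2
    rcases cases u hu2 with hu | rfl | rfl
    · rw [hW u hu]; exact (h.sat u hu1 hu).succ
    · rw [hW']; exact saturated_revPrefix T _
    · rw [hW'']; exact hx.saturated
  · intro w hw
    rcases (saturated_succ_iff hx).1 hw with hw | rfl | rfl
    · obtain ⟨u, hu1, hu2, rfl⟩ := h.surj w hw
      exact ⟨u, hu1, by omega, hW u hu2⟩
    · exact ⟨sz + 1, by omega, by omega, hW''⟩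
    · exact ⟨sz, by omega, by omega, hW'⟩
  · intro u hu1 hu2
    rcases cases u hu2 with hu | rfl | rfl
    · by_cases huq : u = q
      · rw [huq, hlq]; omega
      · rw [hl u hu huq]
        have := h.link_pos u hu1 hu
        omega
    · rw [hl']; omega
    · rw [hl'']; omega
  · intro u hu1 hu2
    rcases cases u hu2 with hu | rfl | rfl
    · by_cases huq : u = q
      · rw [huq, hlq, hW'', hW q hq2]
        exact ⟨hxq, hxql⟩
      · rw [hl u hu huq, hW u hu, hW _ (h.link_pos u hu1 hu).2]
        exact h.link_lt u hu1 hu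
    · rw [hl', hW', hW'']
      refine ⟨hx.1, ?_⟩
      simp; omega
    · rw [hl'', hW'', hW _ hlq1.2]
      exact ⟨hlqx, hlqxl⟩
  · intro u w hu1 hu2 hw hwu hne
    rcases cases u hu2 with hu | rfl | rfl
    · rw [hW u hu] at hwu hne
      rcases (saturated_succ_iff hx).1 hw with hw | rfl | rfl
      · by_cases huq : u = q
        · rw [huq, hlq, hW'']
          rw [huq] at hwu hne
          exact hbelow w hw hwu hne
        · rw [hl u hu huq, hW _ (h.link_pos u hu1 hu).2]
          exact h.link_max u w hu1 hu hw hwu hne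
      · by_cases huq : u = q
        · rw [huq, hlq, hW'']
        · rw [hl u hu huq, hW _ (h.link_pos u hu1 hu).2]
          -- A state whose word has the suffix `x` also has the suffix `W q`. If it is not `q`, its
          -- link still has the suffix `W q`, hence `x`.
          refine hxq.trans (h.link_max u _ hu1 hu (h.sat q hq1 hq2) ?_ fun he => huq ?_)
          · exact habove _ (h.sat u (by omega) hu) hwu
          · exact (h.inj _ _ hq1 hq2 (by omega) hu he).symm
      · exact absurd hwu (S.not_prefix (by omega) hu)
    · rw [hW'] at hwu hne
      rw [hl', hW'']
      rcases (saturated_succ_iff hx).1 hw with hw | rfl | rfl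
      · exact S.prefix_ext hw.1 hwu
      · exact List.prefix_rfl
      · exact absurd rfl hne
    · rw [hW''] at hwu hne
      rw [hl'', hW _ hlq1.2]
      rcases (saturated_succ_iff hx).1 hw with hw | rfl | rfl
      · refine h.link_max q w hq_two hq2 hw (hwu.trans hxq) fun he => ?_
        rw [he] at hwu
        have := hwu.length_le
        omega
      · exact absurd rfl hne
      · have := hwu.length_le
        simp at this
        omega
  · intro d hd
    rw [hrow3 0 d hd (.inl rfl), hcopy 0 d hd, if_neg (by omega), S.zero d hd]
  · intro u d hu1 hu2 hd hf
    rcases cases u hu2 with hu | rfl | rfl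
    · rw [hW u hu] at hf ⊢
      exact hnxt u d hu1 hu hd hf
    · rw [hW'] at hf
      have := hf.length_le
      simp at this
    · rw [hW''] at hf ⊢
      rw [hclone d hd]
      obtain ⟨h3, h4, h5⟩ := hnxt q d hq1 hq2 hd (hf.occLe (hxfac d))
      exact ⟨h3, h4, (by simpa using hxq : d :: x <+: d :: W q).trans h5.1,
        (hxfac d).trans h5.2.1, h5.2.2⟩
  · intro u d hu1 hu2 hd hf
    rcases cases u hu2 with hu | rfl | rfl
    · rw [hW u hu] at hf
      exact hnxt0 u d hu1 hu hd hf
    · rw [hrow3 _ _ hd (by omega), hcopy _ _ hd, if_neg (by omega), hrow d hd]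
    · rw [hW''] at hf
      rw [hclone d hd]
      exact hnxt0 q d hq1 hq2 hd fun hf' => hf (hf'.of_prefix (by simpa using hxq))

/-- The suffixes of the longer text have few saturated words besides those that come from states
below `v'`. -/
lemma numSat_le (S : Split T A p sz W link nxt nxt₁ v) {v' : ℕ} (hp : OnPath sz W (W v) v')
    (h : v ≠ 0 → ∀ u, 1 ≤ u → u < sz → Saturated T p (T p :: W u) → W u <+: W v →
      T p :: W u ≠ extWord W v (T p) → (W u).length < stLen W v') :
    numSat T (p + 1) (revPrefix T (p + 1)) ≤ depth T p W v' + 3 := by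
  classical
  set V : Finset (List ℕ) :=
    if v' = 0 then ∅ else ((W v').inits.toFinset).filter (Saturated T p) with hV
  have hcard : V.card = depth T p W v' := by
    rw [hV]
    unfold depth numSat
    split_ifs
    · rfl
    · congr
  -- The summand `3` accounts for the empty word, the longest repeated suffix and the whole text.
  -- Any other saturated suffix was saturated before, and so was its tail, which is the word of a
  -- state on the path from `v'`.
  have hsub : ((revPrefix T (p + 1)).inits.toFinset).filter (Saturated T (p + 1)) ⊆
      insert [] (insert (extWord W v (T p)) (insert (revPrefix T (p + 1))
        (V.image (T p :: ·)))) := by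
    intro w hw
    simp only [Finset.mem_filter, List.mem_toFinset, List.mem_inits] at hw
    simp only [Finset.mem_insert, Finset.mem_image]
    by_contra! hc
    obtain ⟨hc1, hc2, hc3, hc4⟩ := hc
    have hs : Saturated T p w :=
      ((saturated_succ_iff S.longest).1 hw.2).resolve_right (by tauto)
    have hwx := S.prefix_ext hs.1 hw.1
    cases w with
    | nil => exact hc1 rfl
    | cons d w =>
      have hv0 : v ≠ 0 := by
        rintro rfl
        simp [extWord] at hwx
      rw [extWord_pos hv0, List.cons_prefix_cons] at hwx
      obtain ⟨rfl, hwx⟩ := hwx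
      obtain ⟨u, hu1, hu2, rfl⟩ := S.sam.surj w hs.tail
      obtain ⟨hv0', huv⟩ := IsSAM.prefix_of_lt hp hwx (h hv0 u hu1 hu2 hs hwx hc2)
      refine hc4 (W u) ?_ rfl
      rw [hV, if_neg hv0']
      simp [huv, hs.tail]
  have h1 := Finset.card_le_card hsub
  have h2 := Finset.card_insert_le [] (insert (extWord W v (T p)) (insert (revPrefix T (p + 1))
        (V.image (T p :: ·))))
  have h3 := Finset.card_insert_le (extWord W v (T p)) (insert (revPrefix T (p + 1))
        (V.image (T p :: ·)))
  have h4 := Finset.card_insert_le (revPrefix T (p + 1)) (V.image (T p :: ·))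
  have h5 : (V.image (T p :: ·)).card ≤ V.card := Finset.card_image_le
  have h6 : numSat T (p + 1) (revPrefix T (p + 1)) =
    (((revPrefix T (p + 1)).inits.toFinset).filter (Saturated T (p + 1))).card := by
    unfold numSat; congr
  omega

end Split

end SAM

/-! ### The list of states, suffixes after their extensions -/

/-- The list `l` is stored from `h` on, `nx` leading from each entry to the following one. -/
def Linked (nx : ℕ → ℕ) : ℕ → List ℕ → Prop
  | _, [] => True
  | h, v :: l => h = v ∧ Linked nx (nx v) l

/-- The sum of `f` over the states in `l` whose words have the suffix `w`. -/
def sumOver (W : ℕ → List ℕ) (f : ℕ → ℕ) (w : List ℕ) (l : List ℕ) : ℕ :=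
  (l.map fun u => if w <+: W u then f u else 0).sum

/-- The number of occurrences of `w` in the first `p` letters, that of the empty word at the very
start not included. -/
def occCount (T : ℕ → ℕ) (p : ℕ) (w : List ℕ) : ℕ :=
  ((Finset.Icc 1 p).filter fun e => w <+: revPrefix T e).card

section Order

variable {nx nx' : ℕ → ℕ} {h q cl : ℕ} {l l₁ l₂ : List ℕ} {W W' : ℕ → List ℕ} {f f' : ℕ → ℕ}
  {w : List ℕ}

lemma Linked.congr (hl : Linked nx h l) (hnx : ∀ v ∈ l, nx' v = nx v) : Linked nx' h l := by
  induction l generalizing h with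
  | nil => trivial
  | cons v l ih =>
    refine ⟨hl.1, ?_⟩
    rw [hnx v (by simp)]
    exact ih hl.2 fun u hu => hnx u (by simp [hu])

lemma Linked.insert (hl : Linked nx h (l₁ ++ q :: l₂)) (hq : nx' q = cl) (hcl : nx' cl = nx q)
    (hnx : ∀ v, v ∈ l₁ ∨ v ∈ l₂ → nx' v = nx v) : Linked nx' h (l₁ ++ q :: cl :: l₂) := by
  induction l₁ generalizing h with
  | nil =>
    refine ⟨hl.1, hq, ?_⟩
    rw [hcl]
    exact hl.2.congr fun v hv => hnx v (.inr hv)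
  | cons v l₁ ih =>
    refine ⟨hl.1, ?_⟩
    rw [hnx v (by simp)]
    exact ih hl.2 fun u hu => hnx u (by simp; tauto)

lemma sumOver_cons (v : ℕ) :
    sumOver W f w (v :: l) = (if w <+: W v then f v else 0) + sumOver W f w l := by
  simp [sumOver]

lemma sumOver_append : sumOver W f w (l₁ ++ l₂) = sumOver W f w l₁ + sumOver W f w l₂ := by
  simp [sumOver]

lemma sumOver_congr (hW : ∀ v ∈ l, W' v = W v) (hf : ∀ v ∈ l, f' v = f v) :
    sumOver W' f' w l = sumOver W f w l := by
  unfold sumOver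
  congr 1
  exact List.map_congr_left fun v hv => by rw [hW v hv, hf v hv]

lemma occCount_succ (T : ℕ → ℕ) (p : ℕ) (w : List ℕ) :
    occCount T (p + 1) w = occCount T p w + if w <+: revPrefix T (p + 1) then 1 else 0 := by
  unfold occCount
  rw [← Finset.insert_Icc_right_eq_Icc_add_one (by omega), Finset.filter_insert]
  split_ifs with h
  · rw [Finset.card_insert_of_notMem (by simp)]
  · rfl

/-- A later word with the suffix `W cl` would by `h3` have the suffix `W q`, against the order. So a
state split off `q` may stand right behind `q`, and the states never need to be sorted by length. -/
lemma pairwise_insert (hp : (l₁ ++ q :: l₂).Pairwise fun a b => ¬ W a <+: W b)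
    (h1 : W cl <+: W q) (h2 : W cl ≠ W q)
    (h3 : ∀ b ∈ l₂, W cl <+: W b → W q <+: W b) :
    (l₁ ++ q :: cl :: l₂).Pairwise fun a b => ¬ W a <+: W b := by
  simp only [List.pairwise_append, List.pairwise_cons, List.mem_cons] at hp ⊢
  obtain ⟨p1, ⟨p2, p3⟩, p4⟩ := hp
  refine ⟨p1, ⟨?_, ?_, p3⟩, ?_⟩
  · rintro b (rfl | hb)
    · exact fun h => h2 (prefix_antisymm h1 h)
    · exact p2 b hb
  · exact fun b hb hc => p2 b hb (h3 b hb hc)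
  · rintro a ha b (rfl | rfl | hb)
    · exact p4 a ha _ (.inl rfl)
    · exact fun h => p4 a ha q (.inl rfl) (h.trans h1)
    · exact p4 a ha b (.inr hb)

end Order

/-! ### The construction of the automaton as a program -/

namespace WordRAM

/-- A list of commands, one after the other. -/
def block {m k : ℕ} : List (Cmd m k) → Cmd m k
  | [] => .skip
  | c :: l => .seq c (block l)

section

variable {m k B : ℕ} {P : Cmd m k} {l : List (Cmd m k)} {Q : State m k → ℕ → Prop}
  {s : State m k} {τ : ℕ}

lemma wp_block_cons (h : WP B P (WP B (block l) Q) s τ) : WP B (block (P :: l)) Q s τ := wp_seq h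

lemma wp_block_nil (h : Q s (τ + 1)) : WP B (block []) Q s τ := wp_skip h

lemma wp_generalize (h : ∀ s', s' = s → WP B P Q s' τ) : WP B P Q s τ := h s rfl

lemma wp_block_assign {i : Fin m} {e : Expr m k} (x : ℕ) (he : e.Fits B s) (hx : e.eval s = x)
    (h : WP B (block l) Q (s.setR i x) (τ + (e.cost + 1))) :
    WP B (block (.assign i e :: l)) Q s τ :=
  wp_block_cons (wp_assign he (by rwa [hx]))

lemma wp_block_store {b : Fin (k + 1)} {a e : Expr m k} (y x : ℕ) (ha : a.Fits B s)
    (he : e.Fits B s) (hy : a.eval s = y) (hx : e.eval s = x)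
    (h : WP B (block l) Q (s.setB b (Function.update (s.mem b) y x))
      (τ + (a.cost + e.cost + 1))) :
    WP B (block (.store b a e :: l)) Q s τ :=
  wp_block_cons (wp_store ha he (by rwa [hx, hy]))

end

end WordRAM

namespace FrequentSubstrings

open WordRAM

local notation "rL" => (0 : Fin 17)
local notation "rOff" => (1 : Fin 17)
local notation "rH" => (2 : Fin 17)
local notation "rDst" => (3 : Fin 17)
local notation "rP" => (4 : Fin 17)
local notation "rSz" => (5 : Fin 17)
local notation "rLast" => (6 : Fin 17)
local notation "rV" => (7 : Fin 17)
local notation "rC" => (8 : Fin 17)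
local notation "rQ" => (9 : Fin 17)
local notation "rCur" => (10 : Fin 17)
local notation "rHead" => (11 : Fin 17)
local notation "rJ" => (12 : Fin 17)
local notation "rCl" => (13 : Fin 17)
local notation "bIn" => (0 : Fin 9)
local notation "bNxt" => (1 : Fin 9)
local notation "bLen" => (2 : Fin 9)
local notation "bLink" => (3 : Fin 9)
local notation "bPos" => (4 : Fin 9)
local notation "bList" => (5 : Fin 9)
local notation "bUp" => (6 : Fin 9)
local notation "bDn" => (7 : Fin 9)
local notation "bRep" => (8 : Fin 9)
local notation "rI" => (14 : Fin 17)

/-- The content of a register. -/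
abbrev rg (i : Fin 17) : Expr 17 8 := .reg i

/-- A constant. -/
abbrev cn (c : ℕ) : Expr 17 8 := .const c

/-- Read the letter at the position `rOff + rP` of the text, in which each string is followed by
the separator `σ`. -/
def readLetter (σ : ℕ) : Cmd 17 8 :=
  .ite (.op .eq ((rg rOff + rg rP) % rg rL) (rg rL - cn 1))
    (.assign rC (cn σ))
    -- Three words precede the letters in the input, and the separators of the strings already
    -- completed, `pos / L` in number, are not stored there.
    (.assign rC (.load bIn (cn 3 + (rg rOff + rg rP) - (rg rOff + rg rP) / rg rL)))

/-- Fill the row `dst` of the transition table with the values of `e`, an expression in the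
column `rJ`. -/
def fillRow (A : ℕ) (dst : Fin 17) (e : Expr 17 8) : Cmd 17 8 :=
  .seq (.assign rJ (cn 0))
    (.loop (.op .lt (rg rJ) (cn A))
      (.seq (.store bNxt (rg dst * cn A + rg rJ) e) (.assign rJ (rg rJ + cn 1))))

/-- Climb from the state `rV` as long as the transition with the letter `rC` leads to `rQ`, and
redirect these transitions to the state in `val`. -/
def redirect (A : ℕ) (val : Fin 17) : Cmd 17 8 :=
  .loop (.op .eq (.load bNxt (rg rV * cn A + rg rC)) (rg rQ))
    (.seq (.store bNxt (rg rV * cn A + rg rC) (rg val))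
      (.assign rV (.load bLink (rg rV))))

/-- The letter at the position `pos` of the text, for strings of length `L - 1` that stand in
`inp` from the cell `3` on. -/
def textAt (σ L : ℕ) (inp : ℕ → ℕ) (pos : ℕ) : ℕ :=
  if pos % L = L - 1 then σ else inp (3 + pos - pos / L)

section

variable {B σ A : ℕ} {Q : State 17 8 → ℕ → Prop} {s : State 17 8} {τ : ℕ}

lemma wp_readLetter (h1 : 3 + (s.reg rOff + s.reg rP) < B) (h2 : s.reg rL < B) (h3 : σ < B)
    (h4 : textAt σ (s.reg rL) (s.mem bIn) (s.reg rOff + s.reg rP) < B)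
    (hQ : ∀ τ' ≤ τ + 30, Q (s.setR rC
      (textAt σ (s.reg rL) (s.mem bIn) (s.reg rOff + s.reg rP))) τ') :
    WP B (readLetter σ) Q s τ := by
  have hm : (s.reg rOff + s.reg rP) % s.reg rL < B := by
    have := Nat.mod_le (s.reg rOff + s.reg rP) (s.reg rL)
    omega
  have hd : (s.reg rOff + s.reg rP) / s.reg rL < B := by
    have := Nat.div_le_self (s.reg rOff + s.reg rP) (s.reg rL)
    omega
  unfold readLetter
  refine wp_ite ?_ (fun hv => ?_) (fun hv => ?_)
  · simp
    refine ⟨⟨⟨by omega, by omega, by omega⟩, by omega, by omega⟩, ⟨by omega, by omega⟩, ?_⟩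
    split_ifs <;> omega
  · have hv' : (s.reg rOff + s.reg rP) % s.reg rL = s.reg rL - 1 := by simpa using hv
    refine wp_assign (by simpa using h3) ?_
    simp only [textAt, if_pos hv'] at hQ
    exact hQ _ (by simp)
  · have hv' : (s.reg rOff + s.reg rP) % s.reg rL ≠ s.reg rL - 1 := by simpa using hv
    simp only [textAt, if_neg hv'] at h4 hQ
    have hs := lt_of_le_of_lt (Nat.sub_le (3 + (s.reg rOff + s.reg rP))
      ((s.reg rOff + s.reg rP) / s.reg rL)) h1
    refine wp_assign ?_ ?_
    · simp
      exact ⟨⟨⟨by omega, ⟨by omega, by omega, by omega⟩, by omega⟩, ⟨by omega, by omega⟩, hs⟩, h4⟩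
    · exact hQ _ (by simp)

/-- The value of `e` is required under every change inside the row: a clone copies another row of
the very bank that is being written. -/
lemma wp_fillRow {dst : Fin 17} {e : Expr 17 8} (g : ℕ → ℕ) {D : ℕ} (hdst : dst ≠ rJ)
    (hD : s.reg dst = D) (hB : D * A + A < B) (hDB : D < B)
    (he : ∀ j < A, ∀ M : ℕ → ℕ, (∀ x, x < D * A ∨ D * A + A ≤ x → M x = s.mem bNxt x) →
      e.Fits B ((s.setR rJ j).setB bNxt M) ∧ e.eval ((s.setR rJ j).setB bNxt M) = g j)
    (hQ : ∀ M τ', (∀ x, x < D * A ∨ D * A + A ≤ x → M x = s.mem bNxt x) →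
      (∀ j < A, M (D * A + j) = g j) → τ' ≤ τ + 10 + A * (e.cost + 20) →
      Q ((s.setR rJ A).setB bNxt M) τ') :
    WP B (fillRow A dst e) Q s τ := by
  unfold fillRow
  refine wp_seq (wp_assign (by simp; omega) ?_)
  refine wp_loop (τ + 10 + A * (e.cost + 20)) (fun s' τ' => ∃ j M, j ≤ A ∧
    s' = (s.setR rJ j).setB bNxt M ∧ (∀ x, x < D * A ∨ D * A + A ≤ x → M x = s.mem bNxt x) ∧
    (∀ i < j, M (D * A + i) = g i) ∧ τ' + (A - j) * (e.cost + 20) ≤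
      τ + 5 + A * (e.cost + 20)) ?_ ?_ ?_ ?_ ?_
  · rintro s' τ' ⟨j, M, -, -, -, -, h⟩
    have := Nat.zero_le ((A - j) * (e.cost + 20))
    omega
  · rintro s' τ' ⟨j, M, hj, rfl, -, -, -⟩
    simp
    refine ⟨by omega, by omega, ?_⟩
    split_ifs <;> omega
  · rintro s' τ' ⟨j, M, hj, rfl, hM, hg, ht⟩ hv
    have hj' : j < A := by simpa using hv
    obtain ⟨hf, hev⟩ := he j hj' M hM
    refine wp_seq (wp_store ?_ hf ?_)
    · simp [hdst, hD]
      omega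
    refine wp_assign (by simp; omega) ?_
    refine ⟨j + 1, Function.update M (D * A + j) (g j), hj', ?_, fun x hx => ?_,
      fun i hi => ?_, ?_⟩
    · rw [hev]
      simp [hdst, hD, State.setB_setR]
    · rw [Function.update_of_ne (by omega)]
      exact hM x hx
    · rcases Nat.lt_succ_iff_lt_or_eq.1 hi with hi | rfl
      · rw [Function.update_of_ne (by omega)]
        exact hg i hi
      · simp
    · obtain ⟨r, hr⟩ : ∃ r, A - j = r + 1 := ⟨A - j - 1, by omega⟩
      rw [hr, Nat.succ_mul] at ht
      rw [show A - (j + 1) = r by omega]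
      simp
      omega
  · rintro s' τ' ⟨j, M, hj, rfl, hM, hg, ht⟩ hv
    have hj' : A ≤ j := by simpa using hv
    obtain rfl : A = j := by omega
    refine hQ M _ hM hg ?_
    simp at ht ⊢
    omega
  · exact ⟨0, s.mem bNxt, by omega, (State.setB_self (s.setR rJ 0) bNxt).symm, fun _ _ => rfl,
      by simp,
      by simp⟩

lemma cell_inj {u d u' d' : ℕ} (hd : d < A) (hd' : d' < A) :
    u * A + d = u' * A + d' ↔ u = u' ∧ d = d' := by
  constructor
  · intro h
    have h1 : (u * A + d) / A = u := by
      rw [mul_comm, Nat.mul_add_div (by omega), Nat.div_eq_of_lt hd, add_zero]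
    have h2 : (u' * A + d') / A = u' := by
      rw [mul_comm, Nat.mul_add_div (by omega), Nat.div_eq_of_lt hd', add_zero]
    have : u = u' := by rw [← h1, ← h2, h]
    subst this
    exact ⟨rfl, by omega⟩
  · rintro ⟨rfl, rfl⟩; rfl

lemma cell_lt {u d n : ℕ} (hu : u < n) (hd : d < A) : u * A + d < n * A := by
  have := Nat.mul_le_mul_right A (Nat.succ_le_of_lt hu)
  rw [Nat.succ_mul] at this
  omega

/-- A round takes at most `30` steps and lowers the depth, so `30 * depth` is the potential. The
climb ends at the auxiliary state at the latest, whose transition differs from `key` by `h0`. -/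
lemma wp_redirect {val : Fin 17} {T : ℕ → ℕ} {p sz c key x : ℕ} {W : ℕ → List ℕ} {link : ℕ → ℕ}
    {nxt base : ℕ → ℕ → ℕ} {z : List ℕ} (hsam : IsSAM T A p sz W link nxt)
    (hval : val ≠ rV) (hx : s.reg val = x) (hc : s.reg rC = c) (hcA : c < A)
    (hkey : s.reg rQ = key) (hlink : ∀ u < sz, u ≠ 0 → s.mem bLink u = link u)
    (hbase : ∀ u d, d < A → s.mem bNxt (u * A + d) = base u d)
    (hv : OnPath sz W z (s.reg rV))
    (hall : ∀ u, 1 ≤ u → u < sz → W u <+: z → stLen W (s.reg rV) ≤ (W u).length →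
      base u c = key)
    (hr : Redirected A sz W z (s.reg rV) c x base base)
    (h0 : base 0 c ≠ key) (hB : sz * A < B) (hB' : sz < B) (hkB : key < B) (hxB : x < B)
    (hnB : ∀ u < sz, base u c < B)
    (hQ : ∀ v' M τ', OnPath sz W z v' →
      (∀ u, 1 ≤ u → u < sz → W u <+: z → stLen W v' ≤ (W u).length → base u c = key) →
      Redirected A sz W z v' c x base (fun u d => M (u * A + d)) → base v' c ≠ key →
      τ' + 30 * depth T p W v' ≤ τ + 30 * depth T p W (s.reg rV) + 10 →
      Q ((s.setR rV v').setB bNxt M) τ') :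
    WP B (redirect A val) Q s τ := by
  unfold redirect
  have hAB : A < B := by
    have := Nat.mul_le_mul_right A hsam.two_le
    omega
  refine wp_loop (τ + 30 * depth T p W (s.reg rV)) (fun s' τ' => ∃ v' M,
    s' = (s.setR rV v').setB bNxt M ∧ OnPath sz W z v' ∧
    (∀ u, 1 ≤ u → u < sz → W u <+: z → stLen W v' ≤ (W u).length → base u c = key) ∧
    Redirected A sz W z v' c x base (fun u d => M (u * A + d)) ∧
    τ' + 30 * depth T p W v' ≤ τ + 30 * depth T p W (s.reg rV)) ?_ ?_ ?_ ?_ ?_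
  · rintro s' τ' ⟨v', M, -, -, -, -, h⟩
    omega
  · rintro s' τ' ⟨v', M, rfl, hv', -, hr', -⟩
    have h1 := cell_lt hv'.1 hcA
    have h2 := hr'.self hcA
    have h3 := hnB v' hv'.1
    have h4 := hv'.1
    have h5 : v' * A + c < B := by omega
    simp [hc, hkey, h2]
    refine ⟨⟨⟨⟨?_, by omega, ?_⟩, by omega, h5⟩, h3⟩, hkB, ?_⟩
    · omega
    · omega
    · split_ifs <;> omega
  · rintro s' τ' ⟨v', M, rfl, hv', hall', hr', ht⟩ hne
    have h1 := cell_lt hv'.1 hcA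
    have h2 := hr'.self hcA
    have h3 := hnB v' hv'.1
    have h4 := hv'.1
    have h5 : base v' c = key := by simpa [hc, hkey, h2] using hne
    have hv0 : v' ≠ 0 := by rintro rfl; exact h0 h5
    have hlt := hsam.link_lt_size hv0 h4
    refine wp_seq (wp_store ?_ ?_ ?_)
    · simp [hc]
      omega
    · simp [hval, hx, hxB]
    refine wp_assign ?_ ?_
    · simp [hlink v' h4 hv0]
      omega
    refine ⟨link v', Function.update M (v' * A + c) x, ?_, ?_, ?_, ?_, ?_⟩
    · simp [hval, hx, hc, hlink v' h4 hv0, State.setB_setR]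
    · exact (hsam.climb hv' hv0).1
    · intro u hu1 hu2 hu3 hu4
      rcases ((hsam.climb hv' hv0).2 u hu1 hu2 hu3).1 hu4 with h | rfl
      · exact hall' u hu1 hu2 hu3 h
      · exact h5
    · refine hr'.step hsam hv' hv0 fun u d hd => ?_
      simp only [Function.update_apply, cell_inj hd hcA]
    · have := hsam.depth_link hv0 h4
      simp
      omega
  · rintro s' τ' ⟨v', M, rfl, hv', hall', hr', ht⟩ hne
    have h2 := hr'.self hcA
    have h5 : base v' c ≠ key := by simpa [hc, hkey, h2] using hne
    refine hQ v' M _ hv' hall' hr' h5 ?_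
    simp
    omega
  · refine ⟨s.reg rV, s.mem bNxt, by simp, hv, hall, ?_, le_rfl⟩
    intro u d hd
    simpa only [hbase u d hd] using hr u d hd

end

/-- Read the next letter and create the state of the longer text. -/
def prepare (σ : ℕ) : Cmd 17 8 := block [
  readLetter σ,
  .assign rCur (rg rSz),
  .assign rSz (rg rSz + cn 1),
  .assign rP (rg rP + cn 1),
  .store bLen (rg rCur) (rg rP + cn 1),
  .store bPos (rg rCur) (rg rP),
  .store bUp (rg rCur) (cn 1),
  .store bDn (rg rCur) (cn 0),
  .store bList (rg rCur) (rg rHead),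
  .assign rHead (rg rCur),
  fillRow (σ + 1) rCur (cn 0),
  .assign rV (rg rLast),
  .assign rQ (cn 0)]

/-- Split a state off the state `rQ`. -/
def splitOff (A : ℕ) : Cmd 17 8 := block [
  .assign rCl (rg rSz),
  .assign rSz (rg rSz + cn 1),
  .store bLen (rg rCl) (.load bLen (rg rV) + cn 1),
  .store bPos (rg rCl) (.load bPos (rg rQ)),
  .store bUp (rg rCl) (cn 0),
  .store bDn (rg rCl) (cn 0),
  .store bList (rg rCl) (.load bList (rg rQ)),
  .store bList (rg rQ) (rg rCl),
  .store bLink (rg rCl) (.load bLink (rg rQ)),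
  fillRow A rCl (.load bNxt (rg rQ * cn A + rg rJ)),
  redirect A rCl,
  .store bLink (rg rQ) (rg rCl),
  .store bLink (rg rCur) (rg rCl)]

/-- Append the next letter to the text of the automaton, and record the length of the longest
suffix that occurred before. -/
def extend (σ : ℕ) : Cmd 17 8 := block [
  prepare σ,
  redirect (σ + 1) rCur,
  .assign rQ (.load bNxt (rg rV * cn (σ + 1) + rg rC)),
  .ite (.op .eq (.load bLen (rg rQ)) (.load bLen (rg rV) + cn 1))
    (.store bLink (rg rCur) (rg rQ)) (splitOff (σ + 1)),
  .assign rLast (rg rCur),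
  .store bRep (rg rDst + rg rP) (.load bLen (.load bLink (rg rCur)) - cn 1)]

/-- What the construction of the automaton leaves alone. -/
structure Frame (s s' : State 17 8) : Prop where
  reg : ∀ i : Fin 17, i < 4 ∨ 14 ≤ i → s'.reg i = s.reg i
  inp : s'.mem bIn = s.mem bIn
  rep : s'.mem bRep = s.mem bRep
  out : s'.out = s.out

/-- The banks `bNxt`, …, `bDn` hold the suffix automaton of the first `p` letters of `T`. -/
structure BuildInv (T : ℕ → ℕ) (A p : ℕ) (s : State 17 8) (W : ℕ → List ℕ) (ord : List ℕ) :
    Prop where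
  sam : IsSAM T A p (s.reg rSz) W (s.mem bLink) (fun u d => s.mem bNxt (u * A + d))
  size : s.reg rSz ≤ 2 * p + 2
  last : 1 ≤ s.reg rLast ∧ s.reg rLast < s.reg rSz ∧ W (s.reg rLast) = revPrefix T p
  len : ∀ v < s.reg rSz, s.mem bLen v = stLen W v
  pos : ∀ v, 1 ≤ v → v < s.reg rSz →
    s.mem bPos v ≤ p ∧ W v <+: revPrefix T (s.mem bPos v)
  linked : Linked (s.mem bList) (s.reg rHead) ord
  head_lt : s.reg rHead < s.reg rSz
  list_lt : ∀ v, 1 ≤ v → v < s.reg rSz → s.mem bList v < s.reg rSz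
  mem_ord : ∀ v, v ∈ ord ↔ 1 ≤ v ∧ v < s.reg rSz
  pw : ord.Pairwise fun a b => ¬ W a <+: W b
  up : ∀ w, sumOver W (s.mem bUp) w ord = occCount T p w
  dn : ∀ v, 1 ≤ v → v < s.reg rSz → s.mem bDn v = 0

/-- The effect of `prepare`. -/
structure Prepared (A c : ℕ) (s s' : State 17 8) : Prop where
  frame : Frame s s'
  rP_eq : s'.reg rP = s.reg rP + 1
  rSz_eq : s'.reg rSz = s.reg rSz + 1
  rV_eq : s'.reg rV = s.reg rLast
  rC_eq : s'.reg rC = c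
  rQ_eq : s'.reg rQ = 0
  rCur_eq : s'.reg rCur = s.reg rSz
  rHead_eq : s'.reg rHead = s.reg rSz
  nxt : ∀ u d, d < A → s'.mem bNxt (u * A + d) =
    if u = s.reg rSz then 0 else s.mem bNxt (u * A + d)
  len : s'.mem bLen = Function.update (s.mem bLen) (s.reg rSz) (s.reg rP + 2)
  link : s'.mem bLink = s.mem bLink
  pos : s'.mem bPos = Function.update (s.mem bPos) (s.reg rSz) (s.reg rP + 1)
  list : s'.mem bList = Function.update (s.mem bList) (s.reg rSz) (s.reg rHead)
  up : s'.mem bUp = Function.update (s.mem bUp) (s.reg rSz) 1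
  dn : s'.mem bDn = Function.update (s.mem bDn) (s.reg rSz) 0

section

variable {B σ A : ℕ} {Q : State 17 8 → ℕ → Prop} {s : State 17 8} {τ : ℕ}

lemma wp_prepare (h1 : 3 + (s.reg rOff + s.reg rP) < B) (h2 : s.reg rL < B)
    (h4 : textAt σ (s.reg rL) (s.mem bIn) (s.reg rOff + s.reg rP) < σ + 1)
    (hB : (s.reg rSz + 2) * (σ + 1) < B) (hp : s.reg rP + 2 < B) (hh : s.reg rHead < B)
    (hl : s.reg rLast < B)
    (hQ : ∀ s' τ', Prepared (σ + 1)
      (textAt σ (s.reg rL) (s.mem bIn) (s.reg rOff + s.reg rP)) s s' →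
      τ' ≤ τ + 100 + (σ + 1) * 30 → Q s' τ') : WP B (prepare σ) Q s τ := by
  have e1 : (s.reg rSz + 2) * (σ + 1) = s.reg rSz * (σ + 1) + (σ + 1) + (σ + 1) := by ring
  have e2 : s.reg rSz + 2 ≤ (s.reg rSz + 2) * (σ + 1) := Nat.le_mul_of_pos_right _ (by omega)
  unfold prepare
  refine wp_block_cons (wp_readLetter h1 h2 (by omega) (by omega) fun τ₁ hτ₁ => ?_)
  set c := textAt σ (s.reg rL) (s.mem bIn) (s.reg rOff + s.reg rP)
  refine wp_block_assign (s.reg rSz) (by simp; omega) (by simp) ?_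
  refine wp_block_assign (s.reg rSz + 1) (by simp; omega) (by simp) ?_
  refine wp_block_assign (s.reg rP + 1) (by simp; omega) (by simp) ?_
  refine wp_block_store (s.reg rSz) (s.reg rP + 2) (by simp; omega) (by simp; omega) (by simp)
    (by simp) ?_
  refine wp_block_store (s.reg rSz) (s.reg rP + 1) (by simp; omega) (by simp; omega) (by simp)
    (by simp) ?_
  refine wp_block_store (s.reg rSz) 1 (by simp; omega) (by simp; omega) (by simp) (by simp) ?_
  refine wp_block_store (s.reg rSz) 0 (by simp; omega) (by simp; omega) (by simp) (by simp) ?_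
  refine wp_block_store (s.reg rSz) (s.reg rHead) (by simp; omega) (by simp; omega) (by simp)
    (by simp) ?_
  refine wp_block_assign (s.reg rSz) (by simp; omega) (by simp) ?_
  refine wp_block_cons (wp_fillRow (fun _ => 0) (D := s.reg rSz) (by decide) (by simp)
    (by omega) (by omega) ?_ ?_)
  · intro j hj M hM
    simp; omega
  intro M τ₂ hM hM' hτ₂
  refine wp_block_assign (s.reg rLast) (by simp; omega) (by simp) ?_
  refine wp_block_assign 0 (by simp; omega) (by simp) ?_
  refine wp_block_nil (hQ _ _ ?_ ?_)
  · constructor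
    · constructor
      · intro i hi
        have : i ≠ 4 ∧ i ≠ 5 ∧ i ≠ 7 ∧ i ≠ 8 ∧ i ≠ 9 ∧ i ≠ 10 ∧ i ≠ 11 ∧ i ≠ 12 := by
          revert i; decide
        simp [this]
      all_goals simp
    case nxt =>
      intro u d hd
      simp at hM ⊢
      split_ifs with hu
      · rw [hu]; exact hM' d hd
      · refine hM _ ?_
        rcases Nat.lt_or_gt_of_ne hu with hu | hu
        · exact .inl ((cell_lt hu hd).trans_le (by omega))
        · right
          have := Nat.mul_le_mul_right (σ + 1) (Nat.succ_le_of_lt hu)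
          rw [Nat.succ_mul] at this
          omega
    all_goals simp
  · simp at hτ₂ ⊢
    omega

end

/-! ### Correctness and amortized cost of appending a letter -/

/-- The state before the last link is set: `sz` is the new state, `v` the longest suffix of the
old text that had a transition with the new letter, `nxt` the old transition table. -/
structure Mid (T : ℕ → ℕ) (A p sz : ℕ) (W : ℕ → List ℕ) (link : ℕ → ℕ) (nxt : ℕ → ℕ → ℕ)
    (ord : List ℕ) (v : ℕ) (s : State 17 8) : Prop where
  split : Split T A p sz W link nxt (fun u d => s.mem bNxt (u * A + d)) v
  row : ∀ d < A, s.mem bNxt (sz * A + d) = 0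
  rP_eq : s.reg rP = p + 1
  rSz_eq : s.reg rSz = sz + 1
  rV_eq : s.reg rV = v
  rC_eq : s.reg rC = T p
  rQ_eq : s.reg rQ = nxt v (T p)
  rCur_eq : s.reg rCur = sz
  rHead_eq : s.reg rHead = sz
  size : sz ≤ 2 * p + 2
  link_eq : ∀ u < sz, s.mem bLink u = link u
  len : ∀ u < sz, s.mem bLen u = stLen W u
  len_new : s.mem bLen sz = p + 2
  pos : ∀ u, 1 ≤ u → u < sz → s.mem bPos u ≤ p ∧ W u <+: revPrefix T (s.mem bPos u)
  pos_new : s.mem bPos sz = p + 1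
  linked : Linked (s.mem bList) sz (sz :: ord)
  list_lt : ∀ u, 1 ≤ u → u ≤ sz → s.mem bList u < sz
  mem_ord : ∀ u, u ∈ ord ↔ 1 ≤ u ∧ u < sz
  pw : ord.Pairwise fun a b => ¬ W a <+: W b
  up : ∀ w, sumOver W (s.mem bUp) w ord = occCount T p w
  up_new : s.mem bUp sz = 1
  dn : ∀ u, 1 ≤ u → u ≤ sz → s.mem bDn u = 0

/-- The automaton of the longer text is complete, `sz` being the state of the whole text and `x`
the word of its link. -/
def Done (T : ℕ → ℕ) (A p sz : ℕ) (x : List ℕ) (s : State 17 8) : Prop :=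
  ∃ W ord, BuildInv T A (p + 1) (s.setR rLast sz) W ord ∧ s.reg rCur = sz ∧ s.reg rP = p + 1 ∧
    1 ≤ s.mem bLink sz ∧ s.mem bLink sz < s.reg rSz ∧ W (s.mem bLink sz) = x

section

variable {B σ A : ℕ} {Q : State 17 8 → ℕ → Prop} {s : State 17 8} {τ : ℕ} {T : ℕ → ℕ} {p sz v : ℕ}
  {W : ℕ → List ℕ} {link : ℕ → ℕ} {nxt nxt₁ : ℕ → ℕ → ℕ} {ord : List ℕ}

lemma _root_.Split.nxt_le (S : Split T A p sz W link nxt nxt₁ v) {u d : ℕ} (hu : u < sz)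
    (hd : d < A) : nxt₁ u d ≤ sz := by
  have h2 := S.sam.two_le
  by_cases h0 : u = 0
  · rw [h0, S.zero d hd]; omega
  by_cases hf : Fac T p (d :: W u)
  · rw [S.old u d (by omega) hu hd hf]
    exact (S.sam.nxt_fac u d (by omega) hu hd hf).2.1.le
  by_cases hp : d :: W u <+: revPrefix T (p + 1)
  · rw [S.new u d (by omega) hu hd hf hp]
  · rw [S.none u d (by omega) hu hd hf hp]; omega

namespace Mid

/-- The whole new text is too long to be a suffix of an old word, so its state may stand in front.
-/
lemma pw_front (h : Mid T A p sz W link nxt ord v s) {W' : ℕ → List ℕ}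
    (hW : ∀ u < sz, W' u = W u) (hW' : W' sz = revPrefix T (p + 1)) :
    (sz :: ord).Pairwise fun a b => ¬ W' a <+: W' b := by
  refine List.pairwise_cons.2 ⟨fun b hb => ?_, h.pw.imp_of_mem fun ha hb hab => ?_⟩
  · obtain ⟨h1, h2⟩ := (h.mem_ord b).1 hb
    rw [hW', hW b h2]
    exact h.split.not_prefix h1 h2
  · rwa [hW _ ((h.mem_ord _).1 ha).2, hW _ ((h.mem_ord _).1 hb).2]

/-- The only new end is `p + 1`; the words that end there are the suffixes of the new state's word,
and the counter of that state is `1`. -/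
lemma up_front (h : Mid T A p sz W link nxt ord v s) {W' : ℕ → List ℕ}
    (hW : ∀ u < sz, W' u = W u) (hW' : W' sz = revPrefix T (p + 1)) (w : List ℕ) :
    sumOver W' (s.mem bUp) w (sz :: ord) = occCount T (p + 1) w := by
  rw [sumOver_cons, occCount_succ, h.up_new, hW', ← h.up w, add_comm]
  congr 1
  exact sumOver_congr (fun u hu => hW u ((h.mem_ord u).1 hu).2) fun _ _ => rfl

lemma done (h : Mid T A p sz W link nxt ord v s)
    (hq : W (nxt v (T p)) = extWord W v (T p)) :
    Done T A p sz (extWord W v (T p))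
      (s.setB bLink (Function.update (s.mem bLink) sz (nxt v (T p)))) := by
  have h2 := h.split.sam.two_le
  obtain ⟨hq1, hq2⟩ := h.split.target
  have hsz := h.size
  set W' : ℕ → List ℕ := Function.update W sz (revPrefix T (p + 1)) with hW'
  have hWo : ∀ u < sz, W' u = W u := fun u hu => by
    rw [hW', Function.update_of_ne (by omega)]
  have hWn : W' sz = revPrefix T (p + 1) := by simp [hW']
  refine ⟨W', sz :: ord, ?_, by simp [h.rCur_eq], by simp [h.rP_eq], by simpa using hq1,
    by simp [h.rSz_eq]; omega, by simp [hWo _ hq2, hq]⟩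
  constructor
  case sam =>
    simp only [State.setR_reg, State.setB_reg, State.setR_mem, State.setB_mem]
    simp [h.rSz_eq]
    refine h.split.step hq hWo hWn (fun u hu => ?_) (by simp) h.row
    rw [Function.update_of_ne (by omega), h.link_eq u hu]
  case size => simp [h.rSz_eq]; omega
  case last => simp [h.rSz_eq, hWn]; omega
  case len =>
    simp [h.rSz_eq]
    intro u hu
    rcases Nat.lt_or_eq_of_le hu with hu | rfl
    · rw [h.len u hu, stLen, stLen, hWo u hu]
    · rw [h.len_new, stLen_pos (by omega), hWn]; simp
  case pos =>
    simp [h.rSz_eq]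
    intro u hu0 hu
    rcases Nat.lt_or_eq_of_le hu with hu | rfl
    · rw [hWo u hu]
      exact ⟨(h.pos u hu0 hu).1.trans (by omega), (h.pos u hu0 hu).2⟩
    · rw [h.pos_new, hWn]
      exact ⟨le_rfl, List.prefix_rfl⟩
  case linked => simpa [h.rHead_eq] using h.linked
  case head_lt => simp [h.rHead_eq, h.rSz_eq]
  case list_lt =>
    simp [h.rSz_eq]
    intro u h1 h2
    exact (h.list_lt u h1 (by omega)).le
  case mem_ord =>
    intro u
    simp [h.rSz_eq, h.mem_ord]
    omega
  case pw => exact h.pw_front hWo hWn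
  case up => simpa using h.up_front hWo hWn
  case dn =>
    simp [h.rSz_eq]
    intro u h1 h2
    exact h.dn u h1 (by omega)

lemma two_le_target (h : Mid T A p sz W link nxt ord v s)
    (hq : W (nxt v (T p)) ≠ extWord W v (T p)) : v ≠ 0 ∧ 2 ≤ nxt v (T p) := by
  have hA := h.split.letter
  obtain ⟨hq1, hq2⟩ := h.split.target
  have h1 : nxt v (T p) ≠ 1 := by
    intro h1
    have := h.split.hull.1
    rw [h1, h.split.sam.W_one, List.prefix_nil] at this
    rw [h1, h.split.sam.W_one, this] at hq
    exact hq rfl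
  refine ⟨?_, by omega⟩
  rintro rfl
  exact h1 (h.split.sam.nxt_zero _ hA)

end Mid

namespace Mid

set_option maxHeartbeats 400000 in
-- The clone gets the counter `0`, because each end is already counted at the state of the prefix
-- ending there. In the list it follows `q`: a saturated word with the suffix `x` also has the
-- suffix `W q`, the hull of `x`. The position of `q` serves the clone as well, since `x` is a
-- suffix of `W q`.
lemma done_split (h : Mid T A p sz W link nxt ord v s)
    (hq : W (nxt v (T p)) ≠ extWord W v (T p)) {v' : ℕ} {nxt₂ : ℕ → ℕ → ℕ} {s' : State 17 8}
    (hbase : ∀ u d, d < A → nxt₂ u d =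
      if u = sz + 1 then s.mem bNxt (nxt v (T p) * A + d) else s.mem bNxt (u * A + d))
    (hv' : OnPath sz W (W v) v')
    (hall₁ : ∀ u, 1 ≤ u → u < sz → W u <+: W v → stLen W v' ≤ (W u).length →
      s.mem bNxt (u * A + T p) = nxt v (T p))
    (hr' : Redirected A sz W (W v) v' (T p) (sz + 1) nxt₂ (fun u d => s'.mem bNxt (u * A + d)))
    (hne : nxt₂ v' (T p) ≠ nxt v (T p))
    (rSz' : s'.reg rSz = sz + 2) (rCur' : s'.reg rCur = sz) (rP' : s'.reg rP = p + 1)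
    (rHead' : s'.reg rHead = sz)
    (hlen : s'.mem bLen = Function.update (s.mem bLen) (sz + 1) (stLen W v + 1))
    (hpos : s'.mem bPos = Function.update (s.mem bPos) (sz + 1) (s.mem bPos (nxt v (T p))))
    (hup : s'.mem bUp = Function.update (s.mem bUp) (sz + 1) 0)
    (hdn : s'.mem bDn = Function.update (s.mem bDn) (sz + 1) 0)
    (hlist : s'.mem bList = Function.update (Function.update (s.mem bList) (sz + 1)
      (s.mem bList (nxt v (T p)))) (nxt v (T p)) (sz + 1))
    (hlink : s'.mem bLink = Function.update (Function.update (Function.update (s.mem bLink)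
      (sz + 1) (link (nxt v (T p)))) (nxt v (T p)) (sz + 1)) sz (sz + 1)) :
    Done T A p sz (extWord W v (T p)) s' := by
  have S := h.split
  have hA := S.letter
  have h2 := S.sam.two_le
  obtain ⟨hv0, hq2⟩ := h.two_le_target hq
  obtain ⟨-, hqs⟩ := S.target
  have hv's := hv'.1
  have hxl := S.length_ext_le
  set q := nxt v (T p) with hqdef
  have hposq := (h.pos q (by omega) hqs).1
  have hlistq := h.list_lt q (by omega) (by omega)
  set W₁ : ℕ → List ℕ := Function.update W sz (revPrefix T (p + 1)) with hW₁
  have hW₁o : ∀ u < sz, W₁ u = W u := fun u hu => by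
    rw [hW₁, Function.update_of_ne (by omega)]
  have hW₁n : W₁ sz = revPrefix T (p + 1) := by simp [hW₁]
  set W' : ℕ → List ℕ := Function.update W₁ (sz + 1) (extWord W v (T p)) with hW'
  have hW'o : ∀ u ≤ sz, W' u = W₁ u := fun u hu => by
    rw [hW', Function.update_of_ne (by omega)]
  have hWn : W' sz = revPrefix T (p + 1) := by rw [hW'o _ le_rfl, hW₁n]
  have hWc : W' (sz + 1) = extWord W v (T p) := by simp [hW']
  have hWo : ∀ u < sz, W' u = W u := fun u hu => by rw [hW'o u hu.le, hW₁o u hu]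
  obtain ⟨l₁, l₂, hord⟩ := List.append_of_mem ((h.mem_ord q).2 ⟨by omega, hqs⟩)
  have hpw₁ := h.pw_front hW₁o hW₁n
  have hmem := h.mem_ord
  rw [hord] at hpw₁ hmem
  have hpw₂ : ((sz :: l₁) ++ q :: l₂).Pairwise fun a b => ¬ W' a <+: W' b := by
    refine hpw₁.imp_of_mem fun {a b} ha hb hab => ?_
    have h3 : ∀ u, u ∈ sz :: (l₁ ++ q :: l₂) → u ≤ sz := by
      intro u hu
      rcases List.mem_cons.1 hu with rfl | hu
      · exact le_rfl
      · exact ((hmem u).1 hu).2.le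
    rwa [hW'o a (h3 a ha), hW'o b (h3 b hb)]
  have hnd : q ∉ l₁ ∧ q ∉ l₂ := by
    have := hpw₂
    simp only [List.cons_append, List.pairwise_cons, List.pairwise_append, List.mem_cons] at this
    obtain ⟨-, -, ⟨p2, -⟩, p4⟩ := this
    exact ⟨fun hc => p4 q hc q (.inl rfl) List.prefix_rfl, fun hc => p2 q hc List.prefix_rfl⟩
  have hmem₁ : ∀ u, u ∈ l₁ ∨ u ∈ l₂ → 1 ≤ u ∧ u < sz ∧ u ≠ q := by
    intro u hu
    have h3 := (hmem u).1 (by rcases hu with hu | hu <;> simp [hu])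
    refine ⟨h3.1, h3.2, fun he => ?_⟩
    rw [he] at hu
    exact hu.elim hnd.1 hnd.2
  have hpw : ((sz :: l₁) ++ q :: (sz + 1) :: l₂).Pairwise fun a b => ¬ W' a <+: W' b := by
    refine pairwise_insert hpw₂ ?_ ?_ ?_
    · rw [hWc, hWo q hqs]; exact S.hull.1
    · rw [hWc, hWo q hqs]; exact hq.symm
    · intro b hb
      obtain ⟨h3, h4, -⟩ := hmem₁ b (.inr hb)
      rw [hWc, hWo q hqs, hWo b h4]
      intro hc
      have h5 := S.sam.sat b h3 h4
      exact S.hull.mono h5.hull hc h5.1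
  have cases : ∀ u, u < sz + 2 → u < sz ∨ u = sz ∨ u = sz + 1 := fun u hu => by omega
  refine ⟨W', (sz :: l₁) ++ q :: (sz + 1) :: l₂, ?_, rCur', rP', by simp [hlink],
    by simp [hlink, rSz'], by simp [hlink, hWc]⟩
  constructor
  case sam =>
    simp [rSz', hlink]
    refine S.step_clone hq (nxt₂ := nxt₂) (v' := v') hWo hWn hWc ?_ ?_ ?_
      ?_ hbase hv' hall₁ hr' ?_ h.row
    · intro u hu huq
      rw [Function.update_of_ne (by omega), Function.update_of_ne huq,
        Function.update_of_ne (by omega), h.link_eq u hu]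
    · rw [Function.update_of_ne (by omega), Function.update_self]
    · rw [Function.update_self]
    · rw [Function.update_of_ne (by omega), Function.update_of_ne (by omega),
        Function.update_self]
    · rwa [hbase v' _ hA, if_neg (by omega)] at hne
  case size => simp [rSz']; have := h.size; omega
  case last => simp [rSz', hWn]; omega
  case len =>
    simp [rSz', hlen]
    intro u hu
    rcases cases u hu with hu | rfl | rfl
    · rw [Function.update_of_ne (by omega), h.len u hu, stLen, stLen, hWo u hu]
    · rw [Function.update_of_ne (by omega), h.len_new, stLen_pos (by omega), hWn]; simp
    · rw [Function.update_self, stLen_pos (v := sz + 1) (by omega), hWc, length_extWord]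
  case pos =>
    simp [rSz', hpos]
    intro u hu0 hu
    rcases cases u hu with hu | rfl | rfl
    · rw [Function.update_of_ne (by omega), hWo u hu]
      exact ⟨(h.pos u hu0 hu).1.trans (by omega), (h.pos u hu0 hu).2⟩
    · rw [Function.update_of_ne (by omega), h.pos_new, hWn]
      exact ⟨le_rfl, List.prefix_rfl⟩
    · rw [Function.update_self, hWc]
      exact ⟨by omega, S.hull.1.trans (h.pos q (by omega) hqs).2⟩
  case linked =>
    simp [rHead', hlist]
    have := h.linked
    rw [hord] at this
    refine Linked.insert (l₁ := sz :: l₁) this ?_ ?_ ?_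
    · rw [Function.update_self]
    · rw [Function.update_of_ne (by omega), Function.update_self]
    · intro u hu
      have h3 : 1 ≤ u ∧ u ≤ sz ∧ u ≠ q := by
        rcases hu with hu | hu
        · rcases List.mem_cons.1 hu with rfl | hu
          · omega
          · have := hmem₁ u (.inl hu); omega
        · have := hmem₁ u (.inr hu); omega
      rw [Function.update_of_ne h3.2.2, Function.update_of_ne (by omega)]
  case head_lt => simp [rHead', rSz']
  case list_lt =>
    simp [rSz', hlist]
    intro u h3 h4
    simp only [Function.update_apply]
    split_ifs with h5 h6
    · omega
    · omega
    · have := h.list_lt u h3 (by omega)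
      omega
  case mem_ord =>
    intro u
    have := hmem u
    simp [rSz'] at this ⊢
    constructor
    · rintro (rfl | hu | rfl | rfl | hu)
      · omega
      · have := hmem₁ u (.inl hu); omega
      · omega
      · omega
      · have := hmem₁ u (.inr hu); omega
    · rintro ⟨h3, h4⟩
      rcases cases u h4 with h5 | rfl | rfl
      · rcases this.2 ⟨h3, h5⟩ with h6 | h6 | h6
        · exact .inr (.inl h6)
        · exact .inr (.inr (.inl h6))
        · exact .inr (.inr (.inr (.inr h6)))
      · exact .inl rfl
      · exact .inr (.inr (.inr (.inl rfl)))
  case pw => exact hpw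
  case up =>
    intro w
    have h3 := h.up_front hW₁o hW₁n w
    rw [hord] at h3
    rw [← h3]
    have hf : ∀ u, u ∈ sz :: (l₁ ++ q :: l₂) →
        Function.update (s.mem bUp) (sz + 1) 0 u = s.mem bUp u ∧ W' u = W₁ u := by
      intro u hu
      have h4 : u ≤ sz := by
        rcases List.mem_cons.1 hu with rfl | hu
        · exact le_rfl
        · exact ((hmem u).1 hu).2.le
      exact ⟨Function.update_of_ne (by omega) _ _, hW'o u h4⟩
    rw [← sumOver_congr (fun u hu => (hf u hu).2) fun u hu => (hf u hu).1]
    simp [hup, sumOver_cons, sumOver_append]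
  case dn =>
    simp [rSz', hdn]
    intro u h3 h4
    simp only [Function.update_apply]
    split_ifs with h5
    · rfl
    · exact h.dn u h3 (by omega)

end Mid

/-- The climb from `v` to `v'` is paid by the loss of depth: up to three exceptions, the saturated
suffixes of the new text come from states on the path of `v'`. -/
lemma wp_splitOff (h : Mid T A p sz W link nxt ord v s)
    (hq : W (nxt v (T p)) ≠ extWord W v (T p)) (hB : (sz + 3) * A < B) (hpB : p + 2 < B)
    (hQ : ∀ s' τ', Frame s s' → Done T A p sz (extWord W v (T p)) s' →
      τ' + 30 * numSat T (p + 1) (revPrefix T (p + 1)) ≤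
        τ + 30 * depth T p W v + 200 + 30 * A → Q s' τ') :
    WP B (splitOff A) Q s τ := by
  have S := h.split
  have hA := S.letter
  have h2 := S.sam.two_le
  obtain ⟨hv0, hq2⟩ := h.two_le_target hq
  obtain ⟨-, hqs⟩ := S.target
  have hvs := S.path.1
  have e1 : (sz + 3) * A = sz * A + A + A + A := by ring
  have e2 : sz + 3 ≤ (sz + 3) * A := Nat.le_mul_of_pos_right _ (by omega)
  have hxl := S.length_ext_le
  have hlv : stLen W v ≤ p := by rw [← length_extWord (c := T p)]; exact hxl
  have rSz' := h.rSz_eq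
  have rV' := h.rV_eq
  have rC' := h.rC_eq
  have rQ' := h.rQ_eq
  have rCur' := h.rCur_eq
  set q := nxt v (T p) with hqdef
  have hlenv := h.len v hvs
  have hposq := (h.pos q (by omega) hqs).1
  have hlistq := h.list_lt q (by omega) (by omega)
  have hlinkq := h.link_eq q hqs
  have hlinkq' := S.sam.link_lt_size (by omega : q ≠ 0) hqs
  have hszq : ¬ sz + 1 = q := by omega
  have hszq' : ¬ q = sz + 1 := by omega
  have hszv : ¬ v = sz + 1 := by omega
  unfold splitOff
  refine wp_block_assign (sz + 1) (by simp [rSz']; omega) (by simp [rSz']) ?_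
  refine wp_block_assign (sz + 2) (by simp [rSz']; omega) (by simp [rSz']) ?_
  refine wp_block_store (sz + 1) (stLen W v + 1) (by simp; omega)
    (by simp [rV', hlenv]; omega) (by simp) (by simp [rV', hlenv]) ?_
  refine wp_block_store (sz + 1) (s.mem bPos q) (by simp; omega)
    (by simp [rQ']; omega) (by simp) (by simp [rQ']) ?_
  refine wp_block_store (sz + 1) 0 (by simp; omega) (by simp; omega) (by simp) (by simp) ?_
  refine wp_block_store (sz + 1) 0 (by simp; omega) (by simp; omega) (by simp) (by simp) ?_
  refine wp_block_store (sz + 1) (s.mem bList q) (by simp; omega) (by simp [rQ']; omega)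
    (by simp) (by simp [rQ']) ?_
  refine wp_block_store q (sz + 1) (by simp [rQ']; omega) (by simp; omega) (by simp [rQ'])
    (by simp) ?_
  refine wp_block_store (sz + 1) (link q) (by simp; omega)
    (by simp [rQ', hlinkq]; omega) (by simp) (by simp [rQ', hlinkq]) ?_
  have hcell : ∀ u d, d < A → u < sz + 1 → u * A + d < (sz + 1) * A := fun u d hd hu =>
    cell_lt hu hd
  have e3 : (sz + 1) * A = sz * A + A := by ring
  refine wp_block_cons (wp_fillRow (fun d => s.mem bNxt (q * A + d)) (D := sz + 1) (by decide)
    (by simp) (by omega) (by omega) ?_ ?_)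
  · intro j hj M hM
    have h3 := hcell q j hj (by omega)
    have h4 := hM (q * A + j) (.inl h3)
    have h5 := S.nxt_le hqs hj
    have h6 : q ≤ q * A := Nat.le_mul_of_pos_right _ (by omega)
    simp at h4
    simp [rQ', h4]
    omega
  intro M τ₁ hM hM' hτ₁
  simp at hM hτ₁
  have hbase : ∀ u d, d < A → M (u * A + d) =
      if u = sz + 1 then s.mem bNxt (q * A + d) else s.mem bNxt (u * A + d) := by
    intro u d hd
    split_ifs with hu
    · rw [hu]; exact hM' d hd
    · refine hM _ ?_
      rcases Nat.lt_or_gt_of_ne hu with hu | hu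
      · exact .inl (cell_lt hu hd)
      · right
        have := Nat.mul_le_mul_right A (Nat.succ_le_of_lt hu)
        rw [Nat.succ_mul] at this
        omega
  have hpath : OnPath sz W (W v) v := ⟨hvs, fun _ => List.prefix_rfl⟩
  have hnot : ∀ u, 1 ≤ u → u < sz → W u <+: W v → stLen W v ≤ (W u).length → False := by
    intro u _ _ h3 h4
    rw [stLen_pos hv0] at h4
    have := h3.length_le
    omega
  refine wp_block_cons (wp_redirect (p := p) (sz := sz) (c := T p) (key := q) (x := sz + 1)
    (z := W v) (W := W) (link := link) (base := fun u d => M (u * A + d)) S.sam (by decide)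
    (by simp) (by simp [rC']) hA (by simp [rQ']) ?_ (by simp) (by simpa [rV'] using hpath) ?_ ?_ ?_
    (by omega) (by omega) (by omega) (by omega) ?_ ?_)
  · intro u hu _
    simp [Function.update_of_ne (show u ≠ sz + 1 by omega), h.link_eq u hu]
  · intro u hu1 hu2 hu3 hu4
    simp [rV'] at hu4
    exact (hnot u hu1 hu2 hu3 hu4).elim
  · simpa [rV'] using redirected_refl rfl hv0
  · show M (0 * A + T p) ≠ q
    rw [hbase 0 _ hA, if_neg (by omega)]
    have := S.zero _ hA
    omega
  · intro u hu
    show M (u * A + T p) < B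
    rw [hbase u _ hA, if_neg (by omega)]
    have := S.nxt_le hu hA
    omega
  intro v' M' τ₂ hv' hall' hr' hne hτ₂
  simp [rV'] at hτ₂
  refine wp_block_store q (sz + 1) (by simp [rQ']; omega) (by simp; omega) (by simp [rQ'])
    (by simp) ?_
  refine wp_block_store sz (sz + 1) (by simp [rCur']; omega) (by simp; omega) (by simp [rCur'])
    (by simp) ?_
  have hv's := hv'.1
  have hall₁ : ∀ u, 1 ≤ u → u < sz → W u <+: W v → stLen W v' ≤ (W u).length →
      s.mem bNxt (u * A + T p) = q := by
    intro u h3 h4 h5 h6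
    have := hall' u h3 h4 h5 h6
    rwa [hbase u _ hA, if_neg (by omega)] at this
  refine wp_block_nil (hQ _ _ ?_ ?_ ?_)
  · constructor
    · intro i hi
      have : i ≠ 5 ∧ i ≠ 7 ∧ i ≠ 12 ∧ i ≠ 13 := by
        revert i; decide
      simp [this]
    all_goals simp
  · refine h.done_split hq (nxt₂ := fun u d => M (u * A + d)) hbase hv' hall₁ (by simpa using hr')
      hne ?_ ?_ ?_ ?_ ?_ ?_ ?_ ?_ ?_ ?_ <;> simp [rCur', h.rP_eq, h.rHead_eq] <;> rfl
  -- A state `u` passed by the climb has its transition into `q`. If `T p :: W u` is saturated, it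
  -- equals `W q`, which is at least as long as the longest repeated suffix; then `W u = W v`, the
  -- excluded case.
  · have h7 := S.numSat_le hv' fun _ u hu1 hu2 hs hpre hne' => by
      by_contra hge
      have h8 := hall₁ u hu1 hu2 hpre (by omega)
      have h9 := S.old u _ hu1 hu2 hA hs.1
      have h10 := (S.sam.nxt_fac u _ hu1 hu2 hA hs.1).2.2
      rw [← h9, h8] at h10
      have h11 := hs.hull.unique h10
      have h12 := S.hull.1.length_le
      rw [← h11, length_extWord, stLen_pos hv0] at h12
      have h13 := hpre.length_le
      simp at h12
      refine hne' ?_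
      rw [extWord_pos hv0, hpre.eq_of_length (by omega)]
    simp
    omega

end

/-! ### The automaton of a whole text -/

/-- Build the suffix automaton of the `rH` letters from the position `rOff` on. For each nonempty
prefix of this text, record in `bRep`, from the cell `rDst + 1` on, the length of its longest
suffix that occurs before its end. -/
def build (σ : ℕ) : Cmd 17 8 := block [
  .store bLen (cn 0) (cn 0),
  .store bLen (cn 1) (cn 1),
  .store bLink (cn 1) (cn 0),
  .store bPos (cn 1) (cn 0),
  .store bUp (cn 1) (cn 0),
  .store bDn (cn 1) (cn 0),
  .store bList (cn 1) (cn 0),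
  .assign rV (cn 0),
  fillRow (σ + 1) rV (cn 1),
  .assign rV (cn 1),
  fillRow (σ + 1) rV (cn 0),
  .assign rSz (cn 2),
  .assign rLast (cn 1),
  .assign rHead (cn 1),
  .assign rP (cn 0),
  .loop (.op .lt (rg rP) (rg rH)) (extend σ)]

section

variable {B σ A : ℕ} {Q : State 17 8 → ℕ → Prop} {s s' s'' : State 17 8} {τ : ℕ} {T : ℕ → ℕ}
  {p sz v : ℕ} {W : ℕ → List ℕ} {link : ℕ → ℕ} {nxt nxt₁ : ℕ → ℕ → ℕ} {ord : List ℕ}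

lemma Frame.trans (h : Frame s s') (h' : Frame s' s'') : Frame s s'' :=
  ⟨fun i hi => (h'.reg i hi).trans (h.reg i hi), h'.inp.trans h.inp, h'.rep.trans h.rep,
    h'.out.trans h.out⟩

lemma BuildInv.congr (h : BuildInv T A p s W ord) (h5 : s'.reg rSz = s.reg rSz)
    (h6 : s'.reg rLast = s.reg rLast) (h11 : s'.reg rHead = s.reg rHead)
    (hm : ∀ b : Fin 9, 1 ≤ b → b ≤ 7 → s'.mem b = s.mem b) : BuildInv T A p s' W ord := by
  have m1 := hm bNxt (by decide) (by decide)
  have m2 := hm bLen (by decide) (by decide)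
  have m3 := hm bLink (by decide) (by decide)
  have m4 := hm bPos (by decide) (by decide)
  have m5 := hm bList (by decide) (by decide)
  have m6 := hm bUp (by decide) (by decide)
  have m7 := hm bDn (by decide) (by decide)
  constructor
  · rw [h5, m3, m1]; exact h.sam
  · rw [h5]; exact h.size
  · rw [h5, h6]; exact h.last
  · rw [h5, m2]; exact h.len
  · rw [h5, m4]; exact h.pos
  · rw [h11, m5]; exact h.linked
  · rw [h5, h11]; exact h.head_lt
  · rw [h5, m5]; exact h.list_lt
  · rw [h5]; exact h.mem_ord
  · exact h.pw
  · rw [m6]; exact h.up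
  · rw [h5, m7]; exact h.dn

/-- Rows from `sz` on are unconstrained, so the row of the next state can be cleared in advance. -/
lemma _root_.IsSAM.congr_nxt {nxt' : ℕ → ℕ → ℕ} (h : IsSAM T A p sz W link nxt)
    (hn : ∀ u d, u < sz → d < A → nxt' u d = nxt u d) : IsSAM T A p sz W link nxt' where
  two_le := h.two_le
  W_one := h.W_one
  inj := h.inj
  sat := h.sat
  surj := h.surj
  link_one := h.link_one
  link_pos := h.link_pos
  link_lt := h.link_lt
  link_max := h.link_max
  nxt_zero c hc := by rw [hn 0 c (by have := h.two_le; omega) hc]; exact h.nxt_zero c hc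
  nxt_fac v c h1 h2 hc hf := by rw [hn v c h2 hc]; exact h.nxt_fac v c h1 h2 hc hf
  nxt_not v c h1 h2 hc hf := by rw [hn v c h2 hc]; exact h.nxt_not v c h1 h2 hc hf

/-- The potential is `30` times the number of saturated suffixes of the text. The recorded length is
that of the link of the new state, whose word is the longest repeated suffix; lengths are stored
increased by one, hence the subtraction in the program. -/
lemma wp_extend (h : BuildInv T (σ + 1) p s W ord) (hp : s.reg rP = p)
    (hT : textAt σ (s.reg rL) (s.mem bIn) (s.reg rOff + p) = T p) (hA : T p < σ + 1)
    (hB : (2 * p + 5) * (σ + 1) < B) (h1 : 3 + (s.reg rOff + p) < B) (h2 : s.reg rL < B)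
    (h3 : s.reg rDst + p + 1 < B)
    (hQ : ∀ s' τ' W' ord' x, BuildInv T (σ + 1) (p + 1) s' W' ord' → s'.reg rP = p + 1 →
      IsLongest T p x →
      Frame (s.setB bRep (Function.update (s.mem bRep) (s.reg rDst + p + 1) x.length)) s' →
      τ' + 30 * numSat T (p + 1) (revPrefix T (p + 1)) ≤
        τ + 30 * numSat T p (revPrefix T p) + (600 + 60 * (σ + 1)) → Q s' τ') :
    WP B (extend σ) Q s τ := by
  obtain ⟨sz, hsz⟩ : ∃ sz, s.reg rSz = sz := ⟨_, rfl⟩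
  obtain ⟨last, hlast⟩ : ∃ last, s.reg rLast = last := ⟨_, rfl⟩
  have hsize := h.size
  have hla := h.last
  have hhead := h.head_lt
  have hsam := h.sam
  rw [hsz] at hsize hla hhead hsam
  rw [hlast] at hla
  obtain ⟨hl1, hl2, hl3⟩ := hla
  have hsz2 := hsam.two_le
  have e0 : (sz + 3) * (σ + 1) ≤ (2 * p + 5) * (σ + 1) := Nat.mul_le_mul_right _ (by omega)
  have e1 : (sz + 3) * (σ + 1) = sz * (σ + 1) + (σ + 1) + (σ + 1) + (σ + 1) := by ring
  have e1' : (sz + 2) * (σ + 1) = sz * (σ + 1) + (σ + 1) + (σ + 1) := by ring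
  have e2 : 2 * p + 5 ≤ (2 * p + 5) * (σ + 1) := Nat.le_mul_of_pos_right _ (by omega)
  unfold extend
  refine wp_block_cons (wp_prepare (by omega) h2 (by rw [hp, hT]; exact hA) (by rw [hsz]; omega)
    (by omega) (by omega) (by omega) fun s₁ τ₁ hP hτ₁ => ?_)
  rw [hp, hT] at hP
  set base : ℕ → ℕ → ℕ := fun u d => s₁.mem bNxt (u * (σ + 1) + d) with hbase
  have hbase' : ∀ u d, u < sz → d < σ + 1 → base u d = s.mem bNxt (u * (σ + 1) + d) := by
    intro u d hu hd
    rw [hbase]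
    simp only
    rw [hP.nxt u d hd, if_neg (by omega)]
  have hsam₁ : IsSAM T (σ + 1) p sz W (s.mem bLink) base := hsam.congr_nxt hbase'
  have rSz₁ := hP.rSz_eq
  have rV₁ := hP.rV_eq
  have rC₁ := hP.rC_eq
  have rCur₁ := hP.rCur_eq
  have rHead₁ := hP.rHead_eq
  have rP₁ := hP.rP_eq
  have rDst₁ := hP.frame.reg rDst (by decide)
  have len₁ := hP.len
  rw [hsz] at rSz₁ rCur₁ rHead₁
  rw [hlast] at rV₁
  rw [hp] at rP₁
  rw [hsz, hp] at len₁
  have hdep : depth T p W last = numSat T p (revPrefix T p) := by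
    rw [depth, if_neg (by omega), hl3]
  refine wp_block_cons (wp_redirect (p := p) (sz := sz) (c := T p) (key := 0) (x := sz)
    (z := revPrefix T p) (W := W) (link := s.mem bLink) (base := base) hsam₁ (by decide)
    rCur₁ rC₁ hA hP.rQ_eq (fun u _ _ => by rw [hP.link]) (fun _ _ _ => rfl)
    (by rw [rV₁]; exact ⟨hl2, fun _ => by rw [hl3]⟩) ?_ ?_ ?_
    (by omega) (by omega) (by omega) (by omega) ?_ ?_)
  · intro u _ _ h5 h6
    rw [rV₁, stLen_pos (by omega), hl3] at h6
    have := h5.length_le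
    omega
  · rw [rV₁]
    exact redirected_refl hl3.symm (by omega)
  · rw [hsam₁.nxt_zero _ hA]; omega
  · intro u hu
    by_cases h0 : u = 0
    · rw [h0, hsam₁.nxt_zero _ hA]; omega
    by_cases hf : Fac T p (T p :: W u)
    · have := (hsam₁.nxt_fac u _ (by omega) hu hA hf).2.1
      omega
    · rw [hsam₁.nxt_not u _ (by omega) hu hA hf]; omega
  intro v M τ₂ hv hall hr hne hτ₂
  rw [rV₁, hdep] at hτ₂
  have hS := hsam₁.split hA hv hall hr hne
  have hvs := hv.1
  have hself : M (v * (σ + 1) + T p) = base v (T p) := hr.self hA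
  obtain ⟨hq1, hq2⟩ := hS.target
  set q := base v (T p) with hqdef
  have hcell := cell_lt hvs hA
  refine wp_block_assign q ?_ ?_ ?_
  · simp [rC₁, hself]
    have : v ≤ v * (σ + 1) := Nat.le_mul_of_pos_right _ (by omega)
    omega
  · simp [rC₁, hself]
  obtain ⟨s₂, hs₂⟩ : ∃ s₂, s₂ = ((s₁.setR rV v).setB bNxt M).setR rQ q := ⟨_, rfl⟩
  rw [← hs₂]
  have hF₂ : Frame s₁ s₂ := by
    constructor
    · intro i hi
      have : i ≠ 7 ∧ i ≠ 9 := by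
        revert i; decide
      simp [hs₂, this]
    all_goals simp [hs₂]
  have hM : Mid T (σ + 1) p sz W (s.mem bLink) base ord v s₂ := by
    have hu : ∀ f : ℕ → ℕ, ∀ x, ∀ u < sz, Function.update f (s.reg rSz) x u = f u :=
      fun f x u hu => Function.update_of_ne (by omega) _ _
    constructor
    case split => simpa [hs₂] using hS
    case row =>
      intro d hd
      simp [hs₂]
      have h4 := (hr sz d hd).2 (by omega)
      simp only [hbase] at h4
      rw [h4, hP.nxt sz d hd, if_pos hsz.symm]
    case size => omega
    case link_eq => simp [hs₂, hP.link]
    case len =>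
      intro u h4
      simp [hs₂, hP.len, hu _ _ u h4]
      exact h.len u (by omega)
    case len_new => simp [hs₂, len₁]
    case pos =>
      intro u h3 h4
      simp [hs₂, hP.pos, hu _ _ u h4]
      exact h.pos u h3 (by omega)
    case pos_new => simp [hs₂, hP.pos, hsz, hp]
    case linked =>
      simp [hs₂, hP.list, hsz]
      refine ⟨rfl, ?_⟩
      rw [Function.update_self]
      refine h.linked.congr fun u hu => Function.update_of_ne ?_ _ _
      have := (h.mem_ord u).1 hu
      omega
    case list_lt =>
      intro u h3 h4
      rcases Nat.lt_or_eq_of_le h4 with h4 | rfl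
      · simp [hs₂, hP.list, hu _ _ u h4]
        have := h.list_lt u h3 (by omega)
        omega
      · simp [hs₂, hP.list, hsz]
        omega
    case mem_ord => rw [← hsz]; exact h.mem_ord
    case pw => exact h.pw
    case up =>
      intro w
      rw [← h.up w]
      refine sumOver_congr (fun _ _ => rfl) fun u h4 => ?_
      have := (h.mem_ord u).1 h4
      simp [hs₂, hP.up, hu _ _ u (by omega)]
    case up_new => simp [hs₂, hP.up, hsz]
    case dn =>
      intro u h3 h4
      rcases Nat.lt_or_eq_of_le h4 with h4 | rfl
      · simp [hs₂, hP.dn, hu _ _ u h4]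
        exact h.dn u h3 (by omega)
      · simp [hs₂, hP.dn, hsz]
    all_goals simp [hs₂, rP₁, rSz₁, rC₁, rCur₁, rHead₁]
    rfl
  have hlq : stLen W q = (W q).length + 1 := stLen_pos (by omega)
  have hlv : stLen W v ≤ p := by rw [← length_extWord (c := T p)]; exact hS.length_ext_le
  have hlq' : (W q).length ≤ p := (hsam₁.sat q hq1 hq2).1.length_le
  -- One word being a suffix of the other, the comparison of stored lengths decides whether a clone
  -- is needed.
  have hcond : W q = extWord W v (T p) ↔ stLen W q = stLen W v + 1 := by
    have h6 := length_extWord (W := W) (v := v) (c := T p)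
    constructor
    · intro h5; rw [hlq, h5, h6]
    · intro h5
      have h7 : (extWord W v (T p)).length = (W q).length := by omega
      exact (hS.hull.1.eq_of_length h7).symm
  have rQ₂ : s₂.reg rQ = q := hM.rQ_eq
  have len₂q : s₂.mem bLen q = stLen W q := hM.len q hq2
  have len₂v : s₂.mem bLen v = stLen W v := hM.len v hvs
  have hD : ∀ s₃ τ₃, Frame s₂ s₃ → Done T (σ + 1) p sz (extWord W v (T p)) s₃ →
      τ₃ + 30 * numSat T (p + 1) (revPrefix T (p + 1)) ≤
        τ + 30 * numSat T p (revPrefix T p) + (500 + 60 * (σ + 1)) →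
      WP B (block [.assign rLast (rg rCur),
        .store bRep (rg rDst + rg rP) (.load bLen (.load bLink (rg rCur)) - cn 1)]) Q s₃ τ₃ := by
    rintro s₃ τ₃ hF ⟨W', ord', hinv, h5, h6, h7, h8, h9⟩ hτ₃
    have hlen := hinv.len (s₃.mem bLink sz) (by simpa using h8)
    simp at hlen
    rw [stLen_pos (by omega), h9] at hlen
    have hxl := hS.length_ext_le
    have hsize' := hinv.size
    simp at hsize'
    have hd : s₃.reg rDst = s.reg rDst := by
      rw [hF.reg rDst (by decide), hF₂.reg rDst (by decide), rDst₁]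
    refine wp_block_assign sz (by simp [h5]; omega) (by simp [h5]) ?_
    refine wp_block_store (s.reg rDst + p + 1) (extWord W v (T p)).length
      (by simp [h6, hd]; omega) (by simp [h5, hlen]; omega) (by simp [h6, hd]; omega)
      (by simp [h5, hlen]) ?_
    refine wp_block_nil (hQ _ _ W' ord' _ (hinv.congr rfl rfl rfl fun b h1 h2 => ?_)
      (by simp [h6]) hS.longest ?_ ?_)
    · have : b ≠ 8 := by
        revert b; decide
      simp [this]
    · have hF' := (hP.frame.trans hF₂).trans hF
      constructor
      · intro i hi
        have : i ≠ 6 := by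
          revert i; decide
        simp [this, hF'.reg i hi]
      · simp [hF'.inp]
      · simp [hF'.rep]
      · simp [hF'.out]
    · simp
      omega
  refine wp_block_cons (wp_ite ?_ (fun hc => ?_) fun hc => ?_)
  · simp [rQ₂, hM.rV_eq, len₂q, len₂v]
    refine ⟨?_, ?_, ?_⟩
    · omega
    · omega
    · split_ifs <;> omega
  · have h5 : W q = extWord W v (T p) := hcond.2 (by
      simpa [rQ₂, hM.rV_eq, len₂q, len₂v] using hc)
    refine wp_store (by simp [hM.rCur_eq]; omega) (by simp [rQ₂]; omega) ?_
    simp only [Expr.eval, hM.rCur_eq, rQ₂]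
    refine hD _ _ ⟨fun i hi => by simp, by simp, by simp, by simp⟩ (hM.done h5) ?_
    have h6 := hS.numSat_le (v' := v) ⟨hvs, fun _ => List.prefix_rfl⟩ fun hv0 u _ _ _ h9 _ => ?_
    · simp at hτ₂ ⊢
      omega
    · have := h9.length_le
      rw [stLen_pos hv0]; omega
  · have h5 : W q ≠ extWord W v (T p) := fun h5 => by
      have := hcond.1 h5
      simp [rQ₂, hM.rV_eq, len₂q, len₂v] at hc
      exact hc this
    refine wp_splitOff hM h5 (by omega) (by omega) fun s₃ τ₃ hF hDone hτ₃ => hD _ _ hF hDone ?_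
    simp at hτ₂ hτ₃
    omega

end

section

variable {B σ A : ℕ} {Q : State 17 8 → ℕ → Prop} {s : State 17 8} {τ : ℕ} {T : ℕ → ℕ}

lemma buildInv_init (h1 : s.mem bLink 1 = 0) (h2 : ∀ c < A, s.mem bNxt c = 1)
    (h3 : ∀ c < A, s.mem bNxt (A + c) = 0) (h4 : s.reg rSz = 2) (h5 : s.reg rLast = 1)
    (h6 : s.reg rHead = 1) (h7 : s.mem bLen 0 = 0) (h8 : s.mem bLen 1 = 1)
    (h9 : s.mem bPos 1 = 0) (h10 : s.mem bUp 1 = 0) (h11 : s.mem bDn 1 = 0)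
    (h12 : s.mem bList 1 = 0) : BuildInv T A 0 s (fun _ => []) [1] := by
  have cases : ∀ v, 1 ≤ v → v < 2 → v = 1 := fun v _ _ => by omega
  constructor
  · rw [h4]
    exact isSAM_init h1 (by simpa using h2) (by simpa using h3)
  · omega
  · rw [h4, h5]; exact ⟨le_rfl, by omega, rfl⟩
  · rw [h4]
    intro v hv
    interval_cases v
    · simpa using h7
    · simpa [stLen] using h8
  · rw [h4]
    intro v hv hv'
    rw [cases v hv hv', h9]
    exact ⟨le_rfl, List.prefix_rfl⟩
  · exact ⟨h6, trivial⟩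
  · omega
  · rw [h4]
    intro v hv hv'
    rw [cases v hv hv', h12]; omega
  · rw [h4]
    intro v
    simp
    omega
  · simp
  · intro w
    simp [sumOver, h10, occCount]
  · rw [h4]
    intro v hv hv'
    rw [cases v hv hv', h11]

/-- The potential starts with at most one saturated suffix and is never negative, so the total cost
is linear in `h`. Nothing is assumed about the old contents of the banks of the automaton, and in
`bRep` only the cells `d + 1, …, d + h` change; so the runs for different strings can share the
banks. -/
lemma wp_build {h d : ℕ} (hh : s.reg rH = h) (hd : s.reg rDst = d)
    (hT : ∀ k < h, textAt σ (s.reg rL) (s.mem bIn) (s.reg rOff + k) = T k ∧ T k < σ + 1)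
    (hB : (2 * h + 5) * (σ + 1) < B) (h1 : 3 + (s.reg rOff + h) < B) (h2 : s.reg rL < B)
    (h3 : d + h + 1 < B)
    (hQ : ∀ s' τ' W ord F, BuildInv T (σ + 1) h s' W ord → Frame (s.setB bRep F) s' →
      (∀ x, x ≤ d ∨ d + h < x → F x = s.mem bRep x) →
      (∀ k < h, ∃ x, IsLongest T k x ∧ F (d + k + 1) = x.length) →
      τ' ≤ τ + (h + 1) * (700 + 60 * (σ + 1)) → Q s' τ') :
    WP B (build σ) Q s τ := by
  have e1 : (2 * h + 5) * (σ + 1) = h * (σ + 1) + h * (σ + 1) + 5 * (σ + 1) := by ring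
  have e2 : (h + 1) * (700 + 60 * (σ + 1)) =
      h * (610 + 60 * (σ + 1)) + 90 * h + 700 + 60 * (σ + 1) := by ring
  unfold build
  refine wp_block_store 0 0 (by simp; omega) (by simp; omega) (by simp) (by simp) ?_
  refine wp_block_store 1 1 (by simp; omega) (by simp; omega) (by simp) (by simp) ?_
  refine wp_block_store 1 0 (by simp; omega) (by simp; omega) (by simp) (by simp) ?_
  refine wp_block_store 1 0 (by simp; omega) (by simp; omega) (by simp) (by simp) ?_
  refine wp_block_store 1 0 (by simp; omega) (by simp; omega) (by simp) (by simp) ?_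
  refine wp_block_store 1 0 (by simp; omega) (by simp; omega) (by simp) (by simp) ?_
  refine wp_block_store 1 0 (by simp; omega) (by simp; omega) (by simp) (by simp) ?_
  refine wp_block_assign 0 (by simp; omega) (by simp) ?_
  refine wp_block_cons (wp_fillRow (fun _ => 1) (D := 0) (by decide) (by simp) (by omega)
    (by omega) (fun j hj M hM => by simp; omega) fun M₁ τ₁ hM₁ hM₁' hτ₁ => ?_)
  refine wp_block_assign 1 (by simp; omega) (by simp) ?_
  refine wp_block_cons (wp_fillRow (fun _ => 0) (D := 1) (by decide) (by simp) (by omega)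
    (by omega) (fun j hj M hM => by simp; omega) fun M₂ τ₂ hM₂ hM₂' hτ₂ => ?_)
  refine wp_block_assign 2 (by simp; omega) (by simp) ?_
  refine wp_block_assign 1 (by simp; omega) (by simp) ?_
  refine wp_block_assign 1 (by simp; omega) (by simp) ?_
  refine wp_block_assign 0 (by simp; omega) (by simp) ?_
  simp at hM₂
  refine wp_generalize fun s₀ hs₀ => ?_
  have hF₀ : Frame s s₀ := by
    constructor
    · intro i hi
      have : i ≠ 4 ∧ i ≠ 5 ∧ i ≠ 6 ∧ i ≠ 7 ∧ i ≠ 11 ∧ i ≠ 12 := by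
        revert i; decide
      simp [hs₀, this]
    all_goals simp [hs₀]
  have hinv₀ : BuildInv T (σ + 1) 0 s₀ (fun _ => []) [1] := by
    refine buildInv_init ?_ (fun c hc => ?_) (fun c hc => ?_) ?_ ?_ ?_ ?_ ?_ ?_ ?_ ?_ ?_
    · simp [hs₀]
    · simp [hs₀]
      rw [hM₂ c (by omega)]
      simpa using hM₁' c hc
    · simp [hs₀]
      simpa using hM₂' c hc
    all_goals simp [hs₀]
  have rP₀ : s₀.reg rP = 0 := by simp [hs₀]
  have hnum : numSat T 0 (revPrefix T 0) ≤ 1 := by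
    classical
    unfold numSat
    refine (Finset.card_filter_le _ _).trans ?_
    simp [revPrefix]
  simp at hτ₁ hτ₂ ⊢
  refine wp_block_cons ?_
  refine wp_loop (τ + 180 + 60 * (σ + 1) + h * (610 + 60 * (σ + 1)))
    (fun s' τ' => ∃ p W ord F, p ≤ h ∧ s'.reg rP = p ∧ BuildInv T (σ + 1) p s' W ord ∧
      Frame (s.setB bRep F) s' ∧ (∀ x, x ≤ d ∨ d + h < x → F x = s.mem bRep x) ∧
      (∀ k < p, ∃ x, IsLongest T k x ∧ F (d + k + 1) = x.length) ∧
      τ' + (h - p) * (610 + 60 * (σ + 1)) + 30 * numSat T p (revPrefix T p) ≤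
        τ + 180 + 60 * (σ + 1) + h * (610 + 60 * (σ + 1))) ?_ ?_ ?_ ?_ ?_
  · rintro s' τ' ⟨p, W, ord, F, -, -, -, -, -, -, h5⟩
    omega
  · rintro s' τ' ⟨p, W, ord, F, h4, h5, -, h6, -, -, -⟩
    have h7 := h6.reg rH (by decide)
    simp at h7
    simp [h5, h7, hh]
    refine ⟨by omega, by omega, ?_⟩
    split_ifs <;> omega
  · rintro s' τ' ⟨p, W, ord, F, h4, h5, hinv, h6, hF, hF', hτ'⟩ hv
    have g0 := h6.reg rL (by decide)
    have g1 := h6.reg rOff (by decide)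
    have g2 := h6.reg rH (by decide)
    have g3 := h6.reg rDst (by decide)
    have g4 := h6.inp
    have g5 := h6.rep
    simp at g0 g1 g2 g3 g4 g5
    have hp : p < h := by simpa [h5, g2, hh] using hv
    have e3 : (2 * p + 5) * (σ + 1) ≤ (2 * h + 5) * (σ + 1) :=
      Nat.mul_le_mul_right _ (by omega)
    refine wp_extend hinv h5 (by rw [g0, g4, g1]; exact (hT p hp).1) (hT p hp).2 (by omega)
      (by omega) (by omega) (by omega) fun s'' τ'' W' ord' x hinv' h5' hx hF'' hτ'' => ?_
    rw [g3, g5, hd] at hF''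
    refine ⟨p + 1, W', ord', Function.update F (d + p + 1) x.length, hp, h5', hinv', ?_,
      fun y hy => ?_, fun k hk => ?_, ?_⟩
    · constructor
      · intro i hi
        rw [hF''.reg i hi]
        simpa using h6.reg i hi
      · rw [hF''.inp]
        simpa using h6.inp
      · rw [hF''.rep]
        simp
      · rw [hF''.out]
        simpa using h6.out
    · rw [Function.update_of_ne (by omega)]
      exact hF y hy
    · rcases Nat.lt_succ_iff_lt_or_eq.1 hk with hk | rfl
      · obtain ⟨y, hy, hy'⟩ := hF' k hk
        exact ⟨y, hy, by rw [Function.update_of_ne (by omega), hy']⟩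
      · exact ⟨x, hx, by simp⟩
    · obtain ⟨r, hr⟩ : ∃ r, h - p = r + 1 := ⟨h - p - 1, by omega⟩
      rw [hr, Nat.succ_mul] at hτ'
      rw [show h - (p + 1) = r by omega]
      simp at hτ''
      omega
  · rintro s' τ' ⟨p, W, ord, F, h4, h5, hinv, h6, hF, hF', hτ'⟩ hv
    have g2 := h6.reg rH (by decide)
    simp at g2
    have hp : p = h := by
      have : h ≤ p := by simpa [h5, g2, hh] using hv
      omega
    subst hp
    refine wp_block_nil (hQ _ _ W ord F hinv h6 hF hF' ?_)
    simp at hτ' ⊢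
    omega
  · refine ⟨0, _, _, s.mem bRep, by omega, rP₀, hinv₀, by simpa using hF₀, fun _ _ => rfl,
      by omega, ?_⟩
    simp
    omega

end

/-! ### Locating and counting the repeated suffixes -/

/-- For each nonempty prefix of the text, find the state of its longest suffix that occurs before
in the same string, and count it. -/
def walk (σ : ℕ) : Cmd 17 8 := block [
  .assign rP (cn 0),
  .assign rV (cn 1),
  .loop (.op .lt (rg rP) (rg rH)) (block [
    readLetter σ,
    .assign rP (rg rP + cn 1),
    .assign rQ (.load bRep (rg rP)),
    .loop (.op .lt (rg rQ) (.load bLen (rg rV))) (.assign rV (.load bLink (rg rV))),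
    .assign rV (.load bNxt (rg rV * cn (σ + 1) + rg rC)),
    .store bDn (rg rV) (.load bDn (rg rV) + cn 1)])]

/-- What `walk` leaves alone. -/
structure WalkFrame (s s' : State 17 8) : Prop where
  reg : ∀ i : Fin 17, i ≠ rP → i ≠ rV → i ≠ rC → i ≠ rQ → s'.reg i = s.reg i
  mem : ∀ b : Fin 9, b ≠ bDn → s'.mem b = s.mem b
  out : s'.out = s.out

lemma sumOver_update {W : ℕ → List ℕ} {f : ℕ → ℕ} {w : List ℕ} {l : List ℕ} {u x : ℕ}
    (hl : l.Nodup) (hu : u ∈ l) :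
    sumOver W (Function.update f u (f u + x)) w l =
      sumOver W f w l + if w <+: W u then x else 0 := by
  induction l with
  | nil => simp at hu
  | cons v l ih =>
    rw [List.nodup_cons] at hl
    rw [sumOver_cons, sumOver_cons]
    by_cases hv : v = u
    · subst hv
      rw [Function.update_self, sumOver_congr (fun _ _ => rfl) fun y hy =>
        Function.update_of_ne (by rintro rfl; exact hl.1 hy) _ _]
      split_ifs <;> omega
    · rw [Function.update_of_ne hv, ih hl.2 (by simpa [Ne.symm hv] using hu)]
      omega

/-- The number of indices up to `p` at which the word `w` is a suffix of the given one. -/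
def suffixCount (xs : ℕ → List ℕ) (p : ℕ) (w : List ℕ) : ℕ :=
  ((Finset.Icc 1 p).filter fun e => w <+: xs e).card

lemma suffixCount_succ (xs : ℕ → List ℕ) (p : ℕ) (w : List ℕ) :
    suffixCount xs (p + 1) w = suffixCount xs p w + if w <+: xs (p + 1) then 1 else 0 := by
  unfold suffixCount
  rw [← Finset.insert_Icc_right_eq_Icc_add_one (by omega), Finset.filter_insert]
  split_ifs with h
  · rw [Finset.card_insert_of_notMem (by simp)]
  · rfl

section

variable {B σ A : ℕ} {Q : State 17 8 → ℕ → Prop} {s : State 17 8} {τ : ℕ} {T : ℕ → ℕ}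
  {W : ℕ → List ℕ} {ord : List ℕ}

lemma BuildInv.nodup {p : ℕ} (h : BuildInv T A p s W ord) : ord.Nodup :=
  h.pw.imp fun {a b} hab he => hab (by rw [he])

/-- The descent of `walk`, from the state of `z` to the state of its suffix `y`. -/
lemma wp_descend {N sz f : ℕ} {link : ℕ → ℕ} {nxt : ℕ → ℕ → ℕ} {z : List ℕ}
    (hsam : IsSAM T A N sz W link nxt) (hlen : ∀ u < sz, s.mem bLen u = stLen W u)
    (hlink : s.mem bLink = link) (hf : s.reg rQ = f)
    (hv : OnPath sz W z (s.reg rV)) (hfv : f ≤ stLen W (s.reg rV))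
    (hy : f ≠ 0 → ∃ y, y <+: z ∧ y.length + 1 = f ∧ Saturated T N y)
    (hB : sz < B) (hN : N + 1 < B) (hfB : f < B)
    (hQ : ∀ v τ', OnPath sz W z v → stLen W v = f →
      τ' + 10 * f ≤ τ + 10 * stLen W (s.reg rV) + 10 → Q (s.setR rV v) τ') :
    WP B (.loop (.op .lt (rg rQ) (.load bLen (rg rV))) (.assign rV (.load bLink (rg rV))))
      Q s τ := by
  have hst : ∀ v < sz, stLen W v ≤ N + 1 := by
    intro v hv
    by_cases h0 : v = 0
    · rw [h0]; simp
    · rw [stLen_pos h0]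
      have := (hsam.sat v (by omega) hv).1.length_le
      omega
  refine wp_loop (τ + 10 * stLen W (s.reg rV)) (fun s' τ' => ∃ v, s' = s.setR rV v ∧
    OnPath sz W z v ∧ f ≤ stLen W v ∧ τ' + 10 * stLen W v ≤ τ + 10 * stLen W (s.reg rV))
    ?_ ?_ ?_ ?_ ?_
  · rintro s' τ' ⟨v, -, -, -, h⟩
    omega
  · rintro s' τ' ⟨v, rfl, hv', -, -⟩
    have h1 := hv'.1
    have h2 := hst v h1
    simp [hf, hlen v h1]
    refine ⟨hfB, by omega, ?_⟩
    split_ifs <;> omega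
  · rintro s' τ' ⟨v, rfl, hv', hfv', hτ'⟩ hc
    have h1 := hv'.1
    have hlt : f < stLen W v := by simpa [hf, hlen v h1] using hc
    have hv0 : v ≠ 0 := by rintro rfl; simp at hlt
    have h2 := hsam.link_lt_size hv0 h1
    have h3 := hsam.stLen_link_le hv0 h1
    rw [stLen_pos hv0] at hτ' hlt
    refine wp_assign (by simp [hlink]; omega) ?_
    refine ⟨link v, by simp [hlink], (hsam.climb hv' hv0).1, ?_, ?_⟩
    · by_cases h0 : f = 0
      · omega
      · obtain ⟨y, hy1, hy2, hy3⟩ := hy h0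
        have hyv : y <+: W v := List.prefix_of_prefix_length_le hy1 (hv'.2 hv0) (by omega)
        have hv1 : v ≠ 1 := by
          rintro rfl
          rw [hsam.W_one] at hlt
          simp at hlt
          omega
        have h4 := hsam.link_max v y (by omega) h1 hy3 hyv (by rintro rfl; omega)
        have h5 := h4.length_le
        have h6 := hsam.link_pos v (by omega) h1
        rw [stLen_pos (by omega)]
        omega
    · simp
      omega
  · rintro s' τ' ⟨v, rfl, hv', hfv', hτ'⟩ hc
    have h1 := hv'.1
    have hle : stLen W v ≤ f := by simpa [hf, hlen v h1] using hc
    refine hQ v _ hv' (by omega) ?_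
    simp
    omega
  · exact ⟨s.reg rV, by simp, hv, hfv, le_rfl⟩

/-- If `xs (e + 1) = T e :: y`, then `y` is a saturated suffix of `xs e`: descending links reaches
its state, and one transition leads to `xs (e + 1)`. The state is recognized by its length, as
`stLen` there equals the length of `xs (e + 1)`. The shift by one also covers an empty `xs (e + 1)`:
the descent then ends in the auxiliary state, whose transitions lead to the empty word. Since a
letter lengthens the word by at most one, `stLen` is a potential for the descents. -/
lemma wp_walk {N : ℕ} (xs : ℕ → List ℕ) (h : BuildInv T (σ + 1) N s W ord)
    (hh : s.reg rH = N) (ho : s.reg rOff = 0)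
    (hT : ∀ k < N, textAt σ (s.reg rL) (s.mem bIn) k = T k ∧ T k < σ + 1)
    (hxs0 : xs 0 = []) (hF : ∀ e, 1 ≤ e → e ≤ N → s.mem bRep e = (xs e).length)
    (hxs : ∀ e ≤ N, Saturated T N (xs e) ∧ xs e <+: revPrefix T e)
    (hstep : ∀ e < N, xs (e + 1) = [] ∨ ∃ y, xs (e + 1) = T e :: y ∧ y <+: xs e)
    (hB : (2 * N + 5) * (σ + 1) < B) (h1 : 3 + N < B) (h2 : s.reg rL < B)
    (hQ : ∀ s' τ', WalkFrame s s' →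
      (∀ w, sumOver W (s'.mem bDn) w ord = suffixCount xs N w) →
      τ' ≤ τ + (N + 1) * 200 → Q s' τ') :
    WP B (walk σ) Q s τ := by
  obtain ⟨sz, hsz⟩ : ∃ sz, s.reg rSz = sz := ⟨_, rfl⟩
  have hsam := h.sam
  have hsize := h.size
  have hlen := h.len
  have hdn := h.dn
  have hmem := h.mem_ord
  rw [hsz] at hsam hsize hlen hdn hmem
  have h2s := hsam.two_le
  have e0 : (sz + 3) * (σ + 1) ≤ (2 * N + 5) * (σ + 1) := Nat.mul_le_mul_right _ (by omega)
  have e1 : (sz + 3) * (σ + 1) = sz * (σ + 1) + (σ + 1) + (σ + 1) + (σ + 1) := by ring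
  have e2 : 2 * N + 5 ≤ (2 * N + 5) * (σ + 1) := Nat.le_mul_of_pos_right _ (by omega)
  unfold walk
  refine wp_block_assign 0 (by simp; omega) (by simp) ?_
  refine wp_block_assign 1 (by simp; omega) (by simp) ?_
  refine wp_block_cons ?_
  refine wp_loop (τ + 100 + N * 100) (fun s' τ' => ∃ p v, p ≤ N ∧ s'.reg rP = p ∧
    s'.reg rV = v ∧ 1 ≤ v ∧ v < sz ∧ W v = xs p ∧ WalkFrame s s' ∧
    (∀ u, 1 ≤ u → u < sz → s'.mem bDn u ≤ p) ∧
    (∀ w, sumOver W (s'.mem bDn) w ord = suffixCount xs p w) ∧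
    τ' + (N - p) * 100 + 10 * stLen W v ≤ τ + 100 + N * 100) ?_ ?_ ?_ ?_ ?_
  · rintro s' τ' ⟨p, v, -, -, -, -, -, -, -, -, -, h5⟩
    omega
  · rintro s' τ' ⟨p, v, h4, h5, -, -, -, -, h6, -, -, -⟩
    have h7 := h6.reg rH (by decide) (by decide) (by decide) (by decide)
    simp [h5, h7, hh]
    refine ⟨by omega, by omega, ?_⟩
    split_ifs <;> omega
  · rintro s' τ' ⟨p, v, h4, h5, h6, h7, h8, h9, hW, hD, hsum, hτ'⟩ hc
    have g0 := hW.reg rL (by decide) (by decide) (by decide) (by decide)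
    have g1 := hW.reg rOff (by decide) (by decide) (by decide) (by decide)
    have g2 := hW.reg rH (by decide) (by decide) (by decide) (by decide)
    have m0 := hW.mem bIn (by decide)
    have m1 := hW.mem bNxt (by decide)
    have m2 := hW.mem bLen (by decide)
    have m3 := hW.mem bLink (by decide)
    have m8 := hW.mem bRep (by decide)
    have hp : p < N := by simpa [h5, g2, hh] using hc
    obtain ⟨hT1, hT2⟩ := hT p hp
    have hx := hxs (p + 1) (by omega)
    have hxl := hx.2.length_le
    simp only [length_revPrefix] at hxl
    have hrep : s'.mem bRep (p + 1) = (xs (p + 1)).length := by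
      rw [m8]; exact hF _ (by omega) (by omega)
    have hc' : textAt σ (s'.reg rL) (s'.mem bIn) (s'.reg rOff + s'.reg rP) = T p := by
      rw [g0, m0, g1, ho, h5, zero_add, hT1]
    refine wp_block_cons (wp_readLetter (by omega) (by omega) (by omega) (by omega)
      fun τ₁ hτ₁ => ?_)
    rw [hc']
    refine wp_block_assign (p + 1) (by simp [h5]; omega) (by simp [h5]) ?_
    refine wp_block_assign (xs (p + 1)).length (by simp [hrep]; omega) (by simp [hrep]) ?_
    have hstv : stLen W v = (xs p).length + 1 := by rw [stLen_pos (by omega), h9]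
    refine wp_block_cons (wp_descend (f := (xs (p + 1)).length) (z := xs p) (N := N) hsam
      (fun u hu => by simpa [m2] using hlen u hu) (by simp [m3]) (by simp)
      (by simp [h6]; exact ⟨h8, fun _ => by rw [h9]⟩) ?_ (fun hf => ?_) (by omega) (by omega)
      (by omega) fun v' τ₂ hv' hst hτ₂ => ?_)
    · simp [h6, hstv]
      rcases hstep p hp with hs | ⟨y, hs, hy⟩
      · simp [hs]
      · have := hy.length_le
        rw [hs]; simp; omega
    · rcases hstep p hp with hs | ⟨y, hs, hy⟩
      · simp [hs] at hf
      · refine ⟨y, hy, by simp [hs], ?_⟩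
        have := hx.1
        rw [hs] at this
        exact this.tail
    have hv's := hv'.1
    have hcell := cell_lt hv's hT2
    obtain ⟨q, hq⟩ : ∃ q, s.mem bNxt (v' * (σ + 1) + T p) = q := ⟨_, rfl⟩
    have hqW : 1 ≤ q ∧ q < sz ∧ W q = xs (p + 1) := by
      rw [← hq]
      by_cases h0 : v' = 0
      · have := hsam.nxt_zero _ hT2
        rw [h0, this]
        rw [h0] at hst
        exact ⟨le_rfl, by omega, by rw [hsam.W_one, List.eq_nil_of_length_eq_zero hst.symm]⟩
      · rw [stLen_pos h0] at hst
        rcases hstep p hp with hs | ⟨y, hs, hy⟩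
        · simp [hs] at hst
        · rw [hs] at hst
          simp at hst
          have hyW : W v' = y := (List.prefix_of_prefix_length_le (hv'.2 h0) hy hst.le).eq_of_length
            hst
          have hxs' := hx.1
          rw [hs, ← hyW] at hxs'
          obtain ⟨h10, h11, h12⟩ := hsam.nxt_fac v' _ (by omega) hv's hT2 hxs'.1
          refine ⟨h10, h11, ?_⟩
          rw [hs, ← hyW]
          exact h12.unique hxs'.hull
    obtain ⟨hq1, hq2, hqx⟩ := hqW
    have hDq := hD q hq1 hq2
    refine wp_block_assign q ?_ (by simp [m1, hq]) ?_
    · simp [m1, hq]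
      have : v' ≤ v' * (σ + 1) := Nat.le_mul_of_pos_right _ (by omega)
      omega
    refine wp_block_store q (s'.mem bDn q + 1) (by simp; omega) (by simp; omega) (by simp)
      (by simp) ?_
    refine wp_block_nil ⟨p + 1, q, hp, by simp, by simp, hq1, hq2, hqx, ?_, ?_, ?_, ?_⟩
    · refine ⟨fun i i1 i2 i3 i4 => ?_, fun b hb => ?_, by simpa using hW.out⟩
      · simp [i1, i2, i3, i4, hW.reg i]
      · simp [hb, hW.mem b]
    · intro u hu1 hu2
      have := hD u hu1 hu2
      simp [Function.update_apply]
      split_ifs <;> omega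
    · intro w
      simp
      rw [sumOver_update h.nodup ((hmem q).2 ⟨hq1, hq2⟩), hsum, suffixCount_succ, hqx]
    · obtain ⟨r, hr⟩ : ∃ r, N - p = r + 1 := ⟨N - p - 1, by omega⟩
      rw [hr, Nat.succ_mul] at hτ'
      rw [show N - (p + 1) = r by omega, stLen_pos (by omega), hqx]
      simp [h6] at hτ₂ hτ₁ ⊢
      omega
  · rintro s' τ' ⟨p, v, h4, h5, h6, h7, h8, h9, hW, hD, hsum, hτ'⟩ hc
    have g2 := hW.reg rH (by decide) (by decide) (by decide) (by decide)
    have hp : p = N := by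
      have : N ≤ p := by simpa [h5, g2, hh] using hc
      omega
    subst hp
    refine wp_block_nil (hQ _ _ hW hsum ?_)
    simp at hτ' ⊢
    omega
  · refine ⟨0, 1, by omega, by simp, by simp, le_rfl, by omega, by rw [hsam.W_one, hxs0], ?_, ?_,
      ?_, ?_⟩
    · exact ⟨fun i i1 i2 i3 i4 => by simp [i1, i2], fun b hb => by simp, by simp⟩
    · intro u hu1 hu2
      simp [hdn u hu1 hu2]
    · intro w
      simp [suffixCount]
      have : ∀ l : List ℕ, (∀ u ∈ l, s.mem bDn u = 0) → sumOver W (s.mem bDn) w l = 0 := by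
        intro l hl
        unfold sumOver
        rw [List.sum_eq_zero]
        intro x hx
        obtain ⟨u, hu, rfl⟩ := List.mem_map.1 hx
        simp [hl u hu]
      exact this ord fun u hu => hdn u ((hmem u).1 hu).1 ((hmem u).1 hu).2
    · rw [stLen_pos (by omega), hsam.W_one]
      simp
      omega

end

/-! ### Accumulating the counts and writing the references -/

/-- Report the words of the state `rV` that stay inside one string. -/
def emitRefs : Cmd 17 8 := block [
  .assign rJ (.load bLen (.load bLink (rg rV))),
  .loop (.op .mul (.op .lt (rg rJ) (.load bLen (rg rV)))
      (.op .lt (rg rJ) (.load bPos (rg rV) % rg rL + cn 1)))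
    (block [
      .emit (.load bPos (rg rV) / rg rL),
      .emit (.load bPos (rg rV) % rg rL - rg rJ),
      .emit (rg rJ),
      .assign rJ (rg rJ + cn 1)])]

/-- Go through the states, each before its link, accumulate the counts and report the words of the
states that occur in enough strings. -/
def report : Cmd 17 8 := block [
  .assign rV (rg rHead),
  .loop (rg rV - cn 1) (block [
    .ite (.op .lt (.load bUp (rg rV)) (.load bIn (cn 2) + .load bDn (rg rV))) .skip emitRefs,
    .store bUp (.load bLink (rg rV)) (.load bUp (.load bLink (rg rV)) + .load bUp (rg rV)),
    .store bDn (.load bLink (rg rV)) (.load bDn (.load bLink (rg rV)) + .load bDn (rg rV)),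
    .assign rV (.load bList (rg rV))])]

/-- The words that denote a list of references. -/
def refWords (l : List (ℕ × ℕ × ℕ)) : List ℕ := l.flatMap fun x => [x.1, x.2.1, x.2.2]

/-- The references of lengths from `lo` to `hi - 1` that end at the position `e` of the text. -/
def refsAt (L e lo hi : ℕ) : List (ℕ × ℕ × ℕ) :=
  (List.range' lo (hi - lo)).map fun r => (e / L, e % L - r, r)

/-- The references to the words of the state `v` that stay inside one string. -/
def stateRefs (L : ℕ) (W : ℕ → List ℕ) (link pos : ℕ → ℕ) (v : ℕ) : List (ℕ × ℕ × ℕ) :=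
  refsAt L (pos v) (stLen W (link v)) (min (stLen W v) (pos v % L + 1))

open Classical in
/-- The references to the words of the states other than `1` that satisfy `sel`. -/
noncomputable def allRefs (L : ℕ) (W : ℕ → List ℕ) (link pos : ℕ → ℕ) (sel : ℕ → Prop)
    (ord : List ℕ) : List (ℕ × ℕ × ℕ) :=
  ord.flatMap fun v => if v ≠ 1 ∧ sel v then stateRefs L W link pos v else []

lemma refWords_append (l l' : List (ℕ × ℕ × ℕ)) :
    refWords (l ++ l') = refWords l ++ refWords l' := by simp [refWords]

section

variable {B σ A : ℕ} {Q : State 17 8 → ℕ → Prop} {s : State 17 8} {τ : ℕ} {T : ℕ → ℕ}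
  {W : ℕ → List ℕ} {ord : List ℕ}

/-- As stored lengths are increased by one, that of the link is the smallest length in the class,
and that of the state is one more than the largest. The product of the two comparisons in the loop
test is their conjunction. -/
lemma wp_emitRefs {v L lo hi e : ℕ} (hv : s.reg rV = v) (hL : s.reg rL = L)
    (hlo : s.mem bLen (s.mem bLink v) = lo) (hhi : s.mem bLen v = hi) (he : s.mem bPos v = e)
    (hvB : v < B) (hlB : s.mem bLink v < B) (hloB : lo < B) (hhiB : hi < B) (heB : e + 1 < B)
    (hLB : L < B)
    (hQ : ∀ s' τ', (∀ i, i ≠ rJ → s'.reg i = s.reg i) → s'.mem = s.mem →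
      s'.out = s.out ++ refWords (refsAt L e lo (min hi (e % L + 1))) →
      τ' ≤ τ + 40 + 60 * (refsAt L e lo (min hi (e % L + 1))).length → Q s' τ') :
    WP B emitRefs Q s τ := by
  have hmod : e % L ≤ e := Nat.mod_le _ _
  have hdiv : e / L ≤ e := Nat.div_le_self _ _
  unfold emitRefs
  refine wp_block_assign lo (by simp [hv, hlo]; omega) (by simp [hv, hlo]) ?_
  refine wp_block_cons ?_
  have hlen : (refsAt L e lo (min hi (e % L + 1))).length = min hi (e % L + 1) - lo := by
    simp [refsAt]
  rw [hlen] at hQ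
  -- If no length qualifies, `j` stays at `lo`, possibly above the upper end of the range; hence the
  -- `max`.
  refine wp_loop (τ + 20 + 60 * (min hi (e % L + 1) - lo)) (fun s' τ' => ∃ j, lo ≤ j ∧
    j ≤ max lo (min hi (e % L + 1)) ∧ s'.reg rJ = j ∧
    (∀ i, i ≠ rJ → s'.reg i = s.reg i) ∧ s'.mem = s.mem ∧
    s'.out = s.out ++ refWords (refsAt L e lo j) ∧
    τ' + 60 * (min hi (e % L + 1) - j) ≤ τ + 20 + 60 * (min hi (e % L + 1) - lo)) ?_ ?_ ?_ ?_ ?_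
  · rintro s' τ' ⟨j, -, -, -, -, -, -, h⟩
    omega
  · rintro s' τ' ⟨j, h1, h2, h3, h4, h5, h6, h7⟩
    have g0 := h4 rL (by decide)
    have g7 := h4 rV (by decide)
    simp [h3, h5, g0, g7, hv, hL, hhi, he]
    refine ⟨⟨?_, ⟨hvB, hhiB⟩, ?_⟩, ⟨?_, ⟨⟨⟨hvB, by omega⟩, hLB, by omega⟩, by omega, by omega⟩, ?_⟩,
      ?_⟩
    · omega
    · split_ifs <;> omega
    · omega
    · split_ifs <;> omega
    · split_ifs <;> omega
  · rintro s' τ' ⟨j, h1, h2, h3, h4, h5, h6, h7⟩ hc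
    have g0 := h4 rL (by decide)
    have g7 := h4 rV (by decide)
    have hj : j < hi ∧ j < e % L + 1 := by
      simp [h3, h5, g0, g7, hv, hL, hhi, he] at hc
      omega
    refine wp_block_cons (wp_emit ?_ ?_)
    · simp [h5, g0, g7, hv, hL, he]; omega
    refine wp_block_cons (wp_emit ?_ ?_)
    · simp [h3, h5, g0, g7, hv, hL, he]; omega
    refine wp_block_cons (wp_emit ?_ ?_)
    · simp [h3]; omega
    refine wp_block_assign (j + 1) (by simp [h3]; omega) (by simp [h3]) ?_
    refine wp_block_nil ⟨j + 1, by omega, by omega, by simp, fun i hi => by simp [hi, h4], h5, ?_,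
      ?_⟩
    · have hr : refsAt L e lo (j + 1) = refsAt L e lo j ++ [(e / L, e % L - j, j)] := by
        unfold refsAt
        rw [show j + 1 - lo = (j - lo) + 1 by omega, List.range'_1_concat, List.map_append]
        simp [show lo + (j - lo) = j by omega]
      rw [hr, refWords_append, ← List.append_assoc, ← h6]
      simp [refWords, h3, h5, g0, g7, hv, hL, he]
    · simp
      omega
  · rintro s' τ' ⟨j, h1, h2, h3, h4, h5, h6, h7⟩ hc
    have g0 := h4 rL (by decide)
    have g7 := h4 rV (by decide)
    have hj : j < hi → e % L + 1 ≤ j := by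
      simp [h3, h5, g0, g7, hv, hL, hhi, he] at hc
      omega
    refine wp_block_nil (hQ _ _ h4 h5 ?_ ?_)
    · rw [h6]
      unfold refsAt
      rw [show j - lo = min hi (e % L + 1) - lo by omega]
    · simp
      omega
  · exact ⟨lo, le_rfl, by omega, by simp, fun i hi => by simp [hi], by simp,
      by simp [refsAt, refWords], by simp⟩

lemma le_sumOver {f : ℕ → ℕ} {w : List ℕ} {l : List ℕ} {u : ℕ} (hu : u ∈ l) (hw : w <+: W u) :
    f u ≤ sumOver W f w l := by
  induction l with
  | nil => simp at hu
  | cons v l ih =>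
    rw [sumOver_cons]
    rcases List.mem_cons.1 hu with rfl | hu
    · rw [if_pos hw]; omega
    · have := ih hu; omega

/-- Moving the value of the first state to its link preserves the sums. -/
lemma sumOver_push {f : ℕ → ℕ} {v lv : ℕ} {l : List ℕ} (hl : l.Nodup) (hlv : lv ∈ l)
    {w : List ℕ} (hw : w <+: W v ↔ w <+: W lv) :
    sumOver W (Function.update f lv (f lv + f v)) w l = sumOver W f w (v :: l) := by
  rw [sumOver_update hl hlv, sumOver_cons]
  simp only [hw]
  omega

lemma sumOver_head {f : ℕ → ℕ} {v : ℕ} {l : List ℕ} (h : ∀ b ∈ l, ¬ W v <+: W b) :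
    sumOver W f (W v) (v :: l) = f v := by
  rw [sumOver_cons, if_pos List.prefix_rfl]
  have : sumOver W f (W v) l = 0 := by
    unfold sumOver
    rw [List.sum_eq_zero]
    intro x hx
    obtain ⟨u, hu, rfl⟩ := List.mem_map.1 hx
    rw [if_neg (h u hu)]
  omega

lemma allRefs_append (L : ℕ) (link pos : ℕ → ℕ) (sel : ℕ → Prop) (l l' : List ℕ) :
    allRefs L W link pos sel (l ++ l') = allRefs L W link pos sel l ++
      allRefs L W link pos sel l' := by
  simp [allRefs]

/-- When a state becomes the first of the remaining list, it has received the counts of all its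
extensions: no later word has it as a suffix, so its cell holds the full sum (`sumOver_head`).
Passing this value to the link keeps the sums of the later states (`sumOver_push`), because a later
saturated word is a suffix of `W v` exactly if it is one of `W (link v)`. The truncated difference
in the loop test vanishes at the state `1`, the empty word. -/
lemma wp_report {N L t : ℕ} {D : ℕ → ℕ} (h : BuildInv T A N (s.setB bDn D) W ord)
    (hL : s.reg rL = L) (ht : s.mem bIn 2 = t) {dn : ℕ → ℕ} (hdn : s.mem bDn = dn)
    {up : ℕ → ℕ} (hup : s.mem bUp = up) {cu cd : ℕ → ℕ}
    (hu : ∀ v ∈ ord, sumOver W up (W v) ord = cu v)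
    (hd : ∀ v ∈ ord, sumOver W dn (W v) ord = cd v)
    (hcu : ∀ v ∈ ord, cu v ≤ N) (hcd : ∀ v ∈ ord, cd v ≤ N)
    (hNB : 2 * N + 2 + t < B) (hLB : L < B)
    (hQ : ∀ s' τ', s'.out = s.out ++ refWords (allRefs L W (s.mem bLink) (s.mem bPos)
        (fun v => t + cd v ≤ cu v) ord) →
      τ' ≤ τ + 150 * (ord.length + 1) + 60 * (allRefs L W (s.mem bLink) (s.mem bPos)
        (fun v => t + cd v ≤ cu v) ord).length → Q s' τ') :
    WP B report Q s τ := by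
  obtain ⟨sz, hsz⟩ : ∃ sz, s.reg rSz = sz := ⟨_, rfl⟩
  obtain ⟨link, hlink⟩ : ∃ link, s.mem bLink = link := ⟨_, rfl⟩
  obtain ⟨pos, hpos⟩ : ∃ pos, s.mem bPos = pos := ⟨_, rfl⟩
  have hsam : IsSAM T A N (s.reg rSz) W (s.mem bLink) fun u d => s.mem bNxt (u * A + d) := by
    simpa using h.sam
  have hsize : s.reg rSz ≤ 2 * N + 2 := by simpa using h.size
  have hlen : ∀ v < s.reg rSz, s.mem bLen v = stLen W v := by simpa using h.len
  have hmem : ∀ v, v ∈ ord ↔ 1 ≤ v ∧ v < s.reg rSz := by simpa using h.mem_ord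
  have hposN : ∀ v, 1 ≤ v → v < s.reg rSz →
      s.mem bPos v ≤ N ∧ W v <+: revPrefix T (s.mem bPos v) := by simpa using h.pos
  have hhead : s.reg rHead < s.reg rSz := by simpa using h.head_lt
  have hnd := h.nodup
  have hlist : ∀ v, 1 ≤ v → v < s.reg rSz → s.mem bList v < s.reg rSz := by simpa using h.list_lt
  have hlinked : Linked (s.mem bList) (s.reg rHead) ord := by simpa using h.linked
  have hpw := h.pw
  rw [hsz] at hsam hsize hlen hmem hposN hhead hlist
  rw [hlink] at hsam hQ
  rw [hpos] at hposN hQ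
  have h2s := hsam.two_le
  set R := allRefs L W link pos (fun v => t + cd v ≤ cu v) with hR
  have hst : ∀ v < sz, stLen W v ≤ N + 1 := by
    intro v hv
    by_cases h0 : v = 0
    · rw [h0]; simp
    · rw [stLen_pos h0]
      have := (hsam.sat v (by omega) hv).1.length_le
      omega
  unfold report
  refine wp_block_assign (s.reg rHead) (by simp; omega) (by simp) ?_
  refine wp_block_cons ?_
  refine wp_loop (τ + 100 + 150 * ord.length + 60 * (R ord).length) (fun s' τ' =>
    ∃ dne rem, ord = dne ++ rem ∧ 1 ∈ rem ∧ Linked (s.mem bList) (s'.reg rV) rem ∧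
    (∀ i, i ≠ rJ → i ≠ rV → s'.reg i = s.reg i) ∧
    (∀ b : Fin 9, b ≠ bUp → b ≠ bDn → s'.mem b = s.mem b) ∧
    (∀ u ∈ rem, sumOver W (s'.mem bUp) (W u) rem = cu u) ∧
    (∀ u ∈ rem, sumOver W (s'.mem bDn) (W u) rem = cd u) ∧
    s'.out = s.out ++ refWords (R dne) ∧
    τ' + 150 * rem.length ≤ τ + 100 + 150 * ord.length + 60 * (R dne).length) ?_ ?_ ?_ ?_ ?_
  · rintro s' τ' ⟨dne, rem, h1, -, -, -, -, -, -, -, h9⟩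
    have : R ord = R dne ++ R rem := by rw [h1, hR, allRefs_append]
    rw [this, List.length_append]
    omega
  · rintro s' τ' ⟨dne, rem, h1, h2, h3, -⟩
    cases rem with
    | nil => simp at h2
    | cons v rem =>
      have := (hmem v).1 (by rw [h1]; simp)
      rw [Linked] at h3
      simp [h3.1]
      omega
  · rintro s' τ' ⟨dne, rem, h1, h2, h3, h4, h5, h6, h7, h8, h9⟩ hc
    cases rem with
    | nil => simp at h2
    | cons v rem =>
      obtain ⟨hv, h3⟩ := h3
      have hvo : v ∈ ord := by rw [h1]; simp
      have hvm := (hmem v).1 hvo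
      have hv1 : v ≠ 1 := by
        rintro rfl
        simp [hv] at hc
      have m0 := h5 bIn (by decide) (by decide)
      have m2 := h5 bLen (by decide) (by decide)
      have m3 := h5 bLink (by decide) (by decide)
      have m4 := h5 bPos (by decide) (by decide)
      have m5 := h5 bList (by decide) (by decide)
      have hl := hsam.link_pos v (by omega) hvm.2
      have hl' := hsam.link_lt v (by omega) hvm.2
      rw [h1] at hpw hnd
      rw [List.pairwise_append, List.pairwise_cons] at hpw
      obtain ⟨-, ⟨hpw1, -⟩, hpw2⟩ := hpw
      have hndr : rem.Nodup := (List.nodup_cons.1 (List.nodup_append.1 hnd).2.1).2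
      have hlr : link v ∈ rem := by
        have h10 := (hmem (link v)).2 hl
        rw [h1] at h10
        rcases List.mem_append.1 h10 with h10 | h10
        · exact absurd hl'.1 (hpw2 _ h10 v (by simp))
        · rcases List.mem_cons.1 h10 with h10 | h10
          · rw [h10] at hl'; omega
          · exact h10
      have hlo : link v ∈ ord := (hmem (link v)).2 hl
      have hiff : ∀ u ∈ rem, W u <+: W v ↔ W u <+: W (link v) := by
        intro u hu
        have huo := (hmem u).1 (by rw [h1]; simp [hu])
        refine ⟨fun h10 => hsam.link_max v _ (by omega) hvm.2 (hsam.sat u huo.1 huo.2) h10 ?_,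
          fun h10 => h10.trans hl'.1⟩
        intro h11
        exact hpw1 u hu (by rw [h11])
      have hup' : s'.mem bUp v = cu v := by
        rw [← h6 v (by simp), sumOver_head hpw1]
      have hdn' : s'.mem bDn v = cd v := by
        rw [← h7 v (by simp), sumOver_head hpw1]
      have hnu : ∀ u ∈ rem, sumOver W (Function.update (s'.mem bUp) (link v)
          (s'.mem bUp (link v) + s'.mem bUp v)) (W u) rem = cu u := fun u hu => by
        rw [sumOver_push hndr hlr (hiff u hu), h6 u (by simp [hu])]
      have hnd' : ∀ u ∈ rem, sumOver W (Function.update (s'.mem bDn) (link v)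
          (s'.mem bDn (link v) + s'.mem bDn v)) (W u) rem = cd u := fun u hu => by
        rw [sumOver_push hndr hlr (hiff u hu), h7 u (by simp [hu])]
      -- The new value is a summand of a sum that is preserved and at most `N`, so it fits into a
      -- word.
      have hub : s'.mem bUp (link v) + s'.mem bUp v ≤ N := by
        have := le_sumOver (f := Function.update (s'.mem bUp) (link v)
          (s'.mem bUp (link v) + s'.mem bUp v)) hlr (List.prefix_rfl (l := W (link v)))
        rw [hnu _ hlr, Function.update_self] at this
        exact this.trans (hcu _ hlo)
      have hdb : s'.mem bDn (link v) + s'.mem bDn v ≤ N := by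
        have := le_sumOver (f := Function.update (s'.mem bDn) (link v)
          (s'.mem bDn (link v) + s'.mem bDn v)) hlr (List.prefix_rfl (l := W (link v)))
        rw [hnd' _ hlr, Function.update_self] at this
        exact this.trans (hcd _ hlo)
      have hcuv := hcu v hvo
      have hcdv := hcd v hvo
      have hRd : R (dne ++ [v]) = R dne ++ (if t + cd v ≤ cu v then
          stateRefs L W link pos v else []) := by
        rw [hR, allRefs_append]
        congr 1
        simp [allRefs, hv1]
      have hrest : ∀ s₁ τ₁, (∀ i, i ≠ rJ → s₁.reg i = s'.reg i) → s₁.mem = s'.mem →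
          s₁.out = s.out ++ refWords (R (dne ++ [v])) →
          τ₁ + 150 * rem.length + 50 ≤ τ + 100 + 150 * ord.length + 60 * (R (dne ++ [v])).length →
          WP B (block [
            .store bUp (.load bLink (rg rV)) (.load bUp (.load bLink (rg rV)) + .load bUp (rg rV)),
            .store bDn (.load bLink (rg rV)) (.load bDn (.load bLink (rg rV)) + .load bDn (rg rV)),
            .assign rV (.load bList (rg rV))]) (fun s' τ' =>
    ∃ dne rem, ord = dne ++ rem ∧ 1 ∈ rem ∧ Linked (s.mem bList) (s'.reg rV) rem ∧
    (∀ i, i ≠ rJ → i ≠ rV → s'.reg i = s.reg i) ∧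
    (∀ b : Fin 9, b ≠ bUp → b ≠ bDn → s'.mem b = s.mem b) ∧
    (∀ u ∈ rem, sumOver W (s'.mem bUp) (W u) rem = cu u) ∧
    (∀ u ∈ rem, sumOver W (s'.mem bDn) (W u) rem = cd u) ∧
    s'.out = s.out ++ refWords (R dne) ∧
    τ' + 150 * rem.length ≤ τ + 100 + 150 * ord.length + 60 * (R dne).length) s₁ τ₁ := by
        intro s₁ τ₁ k1 k2 k3 k4
        have kv : s₁.reg rV = v := by rw [k1 rV (by decide), hv]
        have hlv := hlist v (by omega) hvm.2
        refine wp_block_store (link v) (s'.mem bUp (link v) + s'.mem bUp v)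
          (by simp [kv, k2, m3, hlink]; omega) (by simp [kv, k2, m3, hlink]; omega)
          (by simp [kv, k2, m3, hlink]) (by simp [kv, k2, m3, hlink]) ?_
        refine wp_block_store (link v) (s'.mem bDn (link v) + s'.mem bDn v)
          (by simp [kv, k2, m3, hlink]; omega) (by simp [kv, k2, m3, hlink]; omega)
          (by simp [kv, k2, m3, hlink]) (by simp [kv, k2, m3, hlink]) ?_
        refine wp_block_assign (s.mem bList v) (by simp [kv, k2, m5]; omega)
          (by simp [kv, k2, m5]) ?_
        refine wp_block_nil ⟨dne ++ [v], rem, by simp [h1], ?_, by simpa using h3, ?_, ?_, ?_, ?_,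
          by simpa using k3, ?_⟩
        · simpa [Ne.symm hv1] using h2
        · intro i i1 i2
          simp [i2, k1 i i1, h4 i i1 i2]
        · intro b b1 b2
          simp [b1, b2, k2, h5 b b1 b2]
        · intro u hu
          simpa [k2] using hnu u hu
        · intro u hu
          simpa [k2] using hnd' u hu
        · simp
          omega
      refine wp_block_cons (wp_ite ?_ (fun hc' => ?_) fun hc' => ?_)
      · simp [hv, m0, ht, hup', hdn']
        refine ⟨by omega, ⟨by omega, by omega, by omega⟩, ?_⟩
        split_ifs <;> omega
      · have hlt : cu v < t + cd v := by simpa [hv, m0, ht, hup', hdn'] using hc'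
        rw [if_neg (by omega)] at hRd
        refine wp_skip (hrest _ _ (fun _ _ => rfl) rfl (by rw [hRd, List.append_nil]; exact h8) ?_)
        rw [hRd]
        simp at h9 ⊢
        omega
      · have hle : t + cd v ≤ cu v := by simpa [hv, m0, ht, hup', hdn'] using hc'
        rw [if_pos hle] at hRd
        have hlenv := hlen v hvm.2
        have hlenl := hlen (link v) hl.2
        have h10 := hst v hvm.2
        have h11 := hst (link v) hl.2
        have h12 := (hposN v (by omega) hvm.2).1
        refine wp_emitRefs (v := v) (L := L) (lo := stLen W (link v)) (hi := stLen W v)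
          (e := pos v) hv (by rw [h4 rL (by decide) (by decide), hL]) (by rw [m2, m3, hlink, hlenl])
          (by rw [m2, hlenv]) (by rw [m4, hpos]) (by omega) (by rw [m3, hlink]; omega) (by omega)
          (by omega) (by omega) hLB fun s₁ τ₁ k1 k2 k3 k4 => ?_
        refine hrest s₁ τ₁ k1 k2 ?_ ?_
        · rw [k3, h8, hRd, refWords_append, List.append_assoc]
          rfl
        · rw [hRd, List.length_append]
          simp at h9 k4
          unfold stateRefs
          omega
  · rintro s' τ' ⟨dne, rem, h1, h2, h3, h4, h5, h6, h7, h8, h9⟩ hc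
    cases rem with
    | nil => simp at h2
    | cons v rem =>
      obtain ⟨hv, h3⟩ := h3
      have hvm := (hmem v).1 (by rw [h1]; simp)
      have hv1 : v = 1 := by
        simp [hv] at hc
        omega
      -- The empty word is a suffix of every word, so nothing stands behind it in the order.
      have hrem : rem = [] := by
        rw [h1] at hpw
        rw [List.pairwise_append, List.pairwise_cons] at hpw
        cases rem with
        | nil => rfl
        | cons b rem =>
          refine absurd ?_ (hpw.2.1.1 b (by simp))
          rw [hv1, hsam.W_one]
          exact List.nil_prefix
      have hRo : R ord = R dne := by
        rw [h1, hrem, hv1, hR, allRefs_append]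
        simp [allRefs]
      refine wp_block_nil (hQ _ _ (by rw [hRo]; exact h8) ?_)
      rw [hRo]
      simp at h9 ⊢
      omega
  · refine ⟨[], ord, rfl, (hmem 1).2 ⟨le_rfl, by omega⟩, by simpa using hlinked,
      fun i i1 i2 => by simp [i2], fun b b1 b2 => by simp, by simpa [hup] using hu,
      by simpa [hdn] using hd, by simp [hR, allRefs, refWords], ?_⟩
    simp
    omega

end

/-! ### Concatenated strings -/

/-- The text `T` starts with the `n` strings `s i` of length `ℓ`, each followed by the letter
`σ`. -/
structure IsText {σ n : ℕ} (ℓ : ℕ) (s : Fin n → List (Fin σ)) (T : ℕ → ℕ) : Prop where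
  length_eq : ∀ i, (s i).length = ℓ
  letter : ∀ (i : Fin n) (j : ℕ) (hj : j < (s i).length), T (i * (ℓ + 1) + j) = ((s i)[j] : ℕ)
  sep : ∀ i < n, T (i * (ℓ + 1) + ℓ) = σ

/-- A word, written backwards and with numbers as letters. -/
def code {σ : ℕ} (w : List (Fin σ)) : List ℕ := (w.map Fin.val).reverse

/-- The longest repeated suffixes within the single strings. -/
structure Repeats (T : ℕ → ℕ) (n ℓ : ℕ) (xs : ℕ → List ℕ) : Prop where
  start : ∀ i ≤ n, xs (i * (ℓ + 1)) = []
  longest : ∀ i < n, ∀ k < ℓ, IsLongest (fun j => T (i * (ℓ + 1) + j)) k (xs (i * (ℓ + 1) + k + 1))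

lemma revPrefix_add (T : ℕ → ℕ) (a k : ℕ) :
    revPrefix T (a + k) = revPrefix (fun j => T (a + j)) k ++ revPrefix T a := by
  induction k with
  | zero => rfl
  | succ k ih => rw [← Nat.add_assoc, revPrefix, ih]; rfl

lemma revPrefix_local_prefix (T : ℕ → ℕ) (a k : ℕ) :
    revPrefix (fun j => T (a + j)) k <+: revPrefix T (a + k) := by
  rw [revPrefix_add]; exact List.prefix_append _ _

section code

variable {σ : ℕ} {w u : List (Fin σ)}

lemma code_injective : Function.Injective (code (σ := σ)) :=
  List.reverse_injective.comp (List.map_injective_iff.2 Fin.val_injective)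

@[simp] lemma length_code : (code w).length = w.length := by simp [code]

@[simp] lemma code_eq_nil : code w = [] ↔ w = [] := by simp [code]

lemma lt_of_mem_code {a : ℕ} (h : a ∈ code w) : a < σ := by
  simp only [code, List.mem_reverse, List.mem_map] at h
  obtain ⟨b, -, rfl⟩ := h
  exact b.2

lemma code_prefix_code : code w <+: code u ↔ w <:+ u := by
  rw [code, code, List.reverse_prefix]
  constructor
  · rintro ⟨l, h⟩
    obtain ⟨a, b, rfl, -, h'⟩ := List.map_eq_append_iff.1 h.symm
    exact ⟨a, by rw [List.map_injective_iff.2 Fin.val_injective h']⟩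
  · rintro ⟨l, rfl⟩
    simp

end code

section

variable {σ n ℓ : ℕ} {s : Fin n → List (Fin σ)} {T : ℕ → ℕ} {xs : ℕ → List ℕ}

lemma exists_index {L e : ℕ} (hL : 0 < L) (he : e < n * L) :
    ∃ i < n, ∃ j < L, e = i * L + j :=
  ⟨e / L, Nat.div_lt_of_lt_mul (by rwa [Nat.mul_comm]), e % L, Nat.mod_lt _ hL,
    by rw [Nat.mul_comm]; exact (Nat.div_add_mod e L).symm⟩

lemma index_lt {L i j : ℕ} (hi : i < n) (hj : j < L) : i * L + j < n * L := by
  have : (i + 1) * L ≤ n * L := Nat.mul_le_mul_right L hi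
  rw [Nat.add_mul] at this
  omega

lemma index_div {L i j : ℕ} (hj : j < L) : (i * L + j) / L = i := by
  rw [Nat.mul_comm, Nat.mul_add_div (by omega), Nat.div_eq_of_lt hj, Nat.add_zero]

lemma index_mod {L i j : ℕ} (hj : j < L) : (i * L + j) % L = j := by
  rw [Nat.mul_comm, Nat.mul_add_mod, Nat.mod_eq_of_lt hj]

namespace IsText

variable (hT : IsText ℓ s T)
include hT

lemma lt_letter {i j : ℕ} (hi : i < n) (hj : j < ℓ) : T (i * (ℓ + 1) + j) < σ := by
  have := hT.letter ⟨i, hi⟩ j (by rwa [hT.length_eq])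
  simp only at this
  rw [this]
  exact Fin.is_lt _

lemma lt_succ {e : ℕ} (he : e < n * (ℓ + 1)) : T e < σ + 1 := by
  obtain ⟨i, hi, j, hj, rfl⟩ := exists_index (by omega) he
  rcases Nat.lt_or_eq_of_le (Nat.le_of_lt_succ hj) with hj | rfl
  · have := hT.lt_letter hi hj; omega
  · rw [hT.sep i hi]; omega

lemma revPrefix_eq (i : Fin n) {j : ℕ} (hj : j ≤ ℓ) :
    revPrefix (fun j => T (i * (ℓ + 1) + j)) j = code ((s i).take j) := by
  induction j with
  | zero => simp [revPrefix, code]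
  | succ j ih =>
    have h : j < (s i).length := by rw [hT.length_eq]; omega
    rw [revPrefix, ih (by omega), hT.letter i j h, List.take_succ_eq_append_getElem h, code,
      code, List.map_append, List.reverse_append]
    rfl

lemma lt_of_mem_local {i j a : ℕ} (hi : i < n) (hj : j ≤ ℓ)
    (ha : a ∈ revPrefix (fun j => T (i * (ℓ + 1) + j)) j) : a < σ := by
  rw [hT.revPrefix_eq ⟨i, hi⟩ hj] at ha
  exact lt_of_mem_code ha

/-- Words without the letter `σ` do not reach beyond the start of a string. -/
lemma prefix_local {w : List ℕ} (hw : ∀ a ∈ w, a < σ) {i j : ℕ} (hi : i ≤ n)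
    (h : w <+: revPrefix T (i * (ℓ + 1) + j)) :
    w <+: revPrefix (fun j => T (i * (ℓ + 1) + j)) j := by
  have h' := h
  rw [revPrefix_add] at h'
  rcases prefix_total h' (List.prefix_append _ _) with h1 | h1
  · exact h1
  by_cases hl : (revPrefix (fun j => T (i * (ℓ + 1) + j)) j).length < w.length
  -- A longer word would contain the letter before the string: a separator, or no letter at all in
  -- front of the first string.
  · obtain ⟨a, ha⟩ := exists_append_singleton_prefix h1 hl
    have h2 := (ha.trans h')
    rw [List.prefix_append_right_inj] at h2
    have ha' : a < σ := hw a (ha.subset (by simp))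
    cases i with
    | zero => simp [revPrefix] at h2
    | succ i =>
      rw [show (i + 1) * (ℓ + 1) = i * (ℓ + 1) + ℓ + 1 by ring, revPrefix,
        hT.sep i (by omega)] at h2
      simp at h2
      omega
  · rw [h1.eq_of_length (le_antisymm h1.length_le (by omega))]

lemma prefix_iff {w : List ℕ} (hw : ∀ a ∈ w, a < σ) {i j : ℕ} (hi : i ≤ n) :
    w <+: revPrefix T (i * (ℓ + 1) + j) ↔
      w <+: revPrefix (fun j => T (i * (ℓ + 1) + j)) j :=
  ⟨hT.prefix_local hw hi, fun h => h.trans (revPrefix_local_prefix _ _ _)⟩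

lemma fac_iff (i : Fin n) (w : List (Fin σ)) :
    Fac (fun j => T (i * (ℓ + 1) + j)) ℓ (code w) ↔ w <:+: s i := by
  constructor
  · rintro ⟨j, hj, h⟩
    rw [hT.revPrefix_eq i hj, code_prefix_code] at h
    exact h.isInfix.trans (List.take_prefix _ _).isInfix
  · rintro ⟨a, b, h⟩
    have hl := congrArg List.length h
    simp only [List.length_append, hT.length_eq] at hl
    refine ⟨a.length + w.length, by omega, ?_⟩
    rw [hT.revPrefix_eq i (by omega), code_prefix_code, ← h,
      List.take_left' (by simp)]
    exact List.suffix_append _ _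

/-- A word without separators that ends at `e` begins after the last separator, and only `e % (ℓ +
1)` letters follow that. -/
lemma length_le_mod {w : List ℕ} (hw : ∀ a ∈ w, a < σ) {e : ℕ} (he : e ≤ n * (ℓ + 1))
    (h : w <+: revPrefix T e) : w.length ≤ e % (ℓ + 1) := by
  rcases Nat.lt_or_eq_of_le he with he | rfl
  · obtain ⟨i, hi, j, hj, rfl⟩ := exists_index (by omega) he
    have := (hT.prefix_local hw hi.le h).length_le
    rw [index_mod hj]
    simpa using this
  · have := (hT.prefix_local (i := n) (j := 0) hw le_rfl h).length_le
    simp at this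
    simp [this]

lemma code_substring (i : Fin n) {b c : ℕ} (hb : b ≤ ℓ) (hc : c ≤ b) :
    code (SubstringRef.substring s (i, b - c, c)) =
      (revPrefix T (i * (ℓ + 1) + b)).take c := by
  rw [revPrefix_add, List.take_append_of_le_length (by simpa using hc), hT.revPrefix_eq i hb]
  have hl : ((s i).take b).length = b := by simp [hT.length_eq, hb]
  rw [code, code, List.take_reverse, List.length_map, hl, ← List.map_drop, List.drop_take]
  simp [SubstringRef.substring, Nat.sub_sub_self hc]

end IsText

namespace Repeats

variable (hT : IsText ℓ s T) (hx : Repeats T n ℓ xs)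
include hT hx

omit hT in
lemma prefix_revPrefix {e : ℕ} (he : e ≤ n * (ℓ + 1)) : xs e <+: revPrefix T e := by
  rcases Nat.lt_or_eq_of_le he with he | rfl
  · obtain ⟨i, hi, j, hj, rfl⟩ := exists_index (by omega) he
    cases j with
    | zero => simp [hx.start i hi.le]
    | succ j =>
      exact (hx.longest i hi j (by omega)).1.trans (revPrefix_local_prefix _ _ _)
  · simp [hx.start n le_rfl]

omit hT in
-- If `c :: y` ends at two places of a string, then `y` ends at the two places before them, so it is
-- a suffix of the longest repeated suffix there.
lemma step {e : ℕ} (he : e < n * (ℓ + 1)) :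
    xs (e + 1) = [] ∨ ∃ y, xs (e + 1) = T e :: y ∧ y <+: xs e := by
  obtain ⟨i, hi, j, hj, rfl⟩ := exists_index (by omega) he
  rcases Nat.lt_or_eq_of_le (Nat.le_of_lt_succ hj) with hj | rfl
  · have h := hx.longest i hi j hj
    rcases hxe : xs (i * (ℓ + 1) + j + 1) with - | ⟨c, y⟩
    · exact .inl rfl
    rw [hxe] at h
    refine .inr ⟨y, ?_⟩
    obtain ⟨e', he', hc, hy⟩ := cons_prefix_revPrefix.1 h.1
    obtain rfl : j = e' := by omega
    obtain ⟨e₁, he₁, h1⟩ := h.2.1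
    obtain ⟨e₂, rfl, -, h2⟩ := cons_prefix_revPrefix.1 h1
    refine ⟨by rw [hc], ?_⟩
    cases j with
    | zero => omega
    | succ j => exact (hx.longest i hi j (by omega)).2.2 _ hy ⟨e₂, by omega, h2⟩
  · left
    have := hx.start (i + 1) hi
    rwa [show (i + 1) * (j + 1) = i * (j + 1) + j + 1 by ring] at this

/-- A letter that extends `xs e` everywhere in the text extends it at `e` and at an earlier end in
the same string. A repeated suffix is shorter than the string read so far, so the extended word
contains no separator, and it would be a longer repeated suffix. Hence every `xs e` is the word of a
state of the automaton. -/
lemma saturated {e : ℕ} (he : e ≤ n * (ℓ + 1)) : Saturated T (n * (ℓ + 1)) (xs e) := by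
  rcases Nat.lt_or_eq_of_le he with he' | rfl
  · obtain ⟨i, hi, j, hj, rfl⟩ := exists_index (by omega) he'
    cases j with
    | zero => simpa [hx.start i hi.le] using saturated_nil T _
    | succ j =>
      have h := hx.longest i hi j (by omega)
      rw [← Nat.add_assoc] at he he' ⊢
      set x := xs (i * (ℓ + 1) + j + 1)
      refine ⟨⟨_, he, hx.prefix_revPrefix he⟩, fun a ha => ?_⟩
      have h1 := ha _ he (hx.prefix_revPrefix he)
      rw [Nat.add_assoc, revPrefix_add] at h1
      have hl := h.2.1.length_le
      have h2 : x ++ [a] <+: revPrefix (fun k => T (i * (ℓ + 1) + k)) (j + 1) :=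
        List.prefix_of_prefix_length_le h1 (List.prefix_append _ _) (by simpa using hl)
      have hlt : ∀ b ∈ x ++ [a], b < σ := fun b hb =>
        hT.lt_of_mem_local hi (by omega) (h2.subset hb)
      obtain ⟨e', he₁, h3⟩ := h.2.1
      have h4 := ha (i * (ℓ + 1) + e') (by omega) (h3.trans (revPrefix_local_prefix _ _ _))
      have h5 := (h.2.2 _ h2 ⟨e', he₁, hT.prefix_local hlt hi.le h4⟩).length_le
      simp at h5
  · simpa [hx.start n le_rfl] using saturated_nil T _

/-- The occurrences of a word that are not the first one in their string are those that end with
a longest repeated suffix. -/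
lemma occCount_eq {w : List (Fin σ)} (hw : w ≠ []) :
    occCount T (n * (ℓ + 1)) (code w) = suffixCount xs (n * (ℓ + 1)) (code w) +
      (Finset.univ.filter fun i => w <:+: s i).card := by
  classical
  have hlt : ∀ a ∈ code w, a < σ := fun a => lt_of_mem_code
  set N := n * (ℓ + 1) with hN
  -- An occurrence that is not a suffix of `xs e` has no predecessor in its string, by maximality of
  -- `xs e`. Multiples of `ℓ + 1` are not ends of nonempty words without separators.
  have hchar : ∀ e, (e ∈ (Finset.Icc 1 N).filter fun e => code w <+: revPrefix T e ∧
      ¬ code w <+: xs e) → ∃ (i : Fin n) (j : ℕ), j < ℓ ∧ e = i * (ℓ + 1) + (j + 1) ∧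
      code w <+: revPrefix (fun k => T (i * (ℓ + 1) + k)) (j + 1) ∧
      ¬ Fac (fun k => T (i * (ℓ + 1) + k)) j (code w) := by
    intro e he
    simp only [Finset.mem_filter, Finset.mem_Icc] at he
    obtain ⟨⟨h1, h2⟩, h3, h4⟩ := he
    have h5 := hT.length_le_mod hlt h2 h3
    have h6 : 0 < w.length := List.length_pos_iff.2 hw
    have h7 : e < N := lt_of_le_of_ne h2 fun h => by
      rw [h, hN, Nat.mul_mod_left, length_code] at h5
      omega
    obtain ⟨i, hi, j, hj, rfl⟩ := exists_index (by omega) h7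
    rw [index_mod hj, length_code] at h5
    obtain ⟨j, rfl⟩ : ∃ j', j = j' + 1 := ⟨j - 1, by omega⟩
    have h8 := hT.prefix_local hlt hi.le h3
    exact ⟨⟨i, hi⟩, j, by omega, rfl, h8, fun hf =>
      h4 ((hx.longest i hi j (by omega)).2.2 _ h8 hf)⟩
  have hsplit : occCount T N (code w) = suffixCount xs N (code w) +
      ((Finset.Icc 1 N).filter fun e => code w <+: revPrefix T e ∧ ¬ code w <+: xs e).card := by
    unfold occCount suffixCount
    rw [← Finset.card_union_of_disjoint]
    · congr 1
      ext e
      simp only [Finset.mem_filter, Finset.mem_union, Finset.mem_Icc]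
      constructor
      · rintro ⟨h1, h2⟩
        by_cases h3 : code w <+: xs e
        · exact .inl ⟨h1, h3⟩
        · exact .inr ⟨h1, h2, h3⟩
      · rintro (⟨h1, h2⟩ | ⟨h1, h2, -⟩)
        · exact ⟨h1, h2.trans (hx.prefix_revPrefix h1.2)⟩
        · exact ⟨h1, h2⟩
    · rw [Finset.disjoint_left]
      intro e h1 h2
      simp only [Finset.mem_filter] at h1 h2
      exact h2.2.2 h1.2
  rw [hsplit]
  congr 1
  have hdiv : ∀ e, (e ∈ (Finset.Icc 1 N).filter fun e => code w <+: revPrefix T e ∧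
      ¬ code w <+: xs e) → e / (ℓ + 1) < n := fun e he => by
    obtain ⟨i, j, hj, rfl, -⟩ := hchar e he
    rw [index_div (by omega)]
    exact i.2
  refine Finset.card_bij (fun e he => ⟨e / (ℓ + 1), hdiv e he⟩) ?_ ?_ ?_
  · intro e he
    obtain ⟨i, j, hj, rfl, h1, -⟩ := hchar e he
    simp only [index_div (show j + 1 < ℓ + 1 by omega), Finset.mem_filter, Finset.mem_univ,
      true_and]
    exact (hT.fac_iff i w).1 ⟨j + 1, by omega, h1⟩
  · intro e he e' he' h
    obtain ⟨i, j, hj, rfl, h1, h2⟩ := hchar e he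
    obtain ⟨i', j', hj', rfl, h1', h2'⟩ := hchar e' he'
    simp only [index_div (show j + 1 < ℓ + 1 by omega),
      index_div (show j' + 1 < ℓ + 1 by omega), Fin.eta] at h
    subst h
    rcases lt_trichotomy j j' with h3 | rfl | h3
    · exact absurd ⟨j + 1, by omega, h1⟩ h2'
    · rfl
    · exact absurd ⟨j' + 1, by omega, h1'⟩ h2
  · intro i hi
    simp only [Finset.mem_filter, Finset.mem_univ, true_and] at hi
    have hex := (hT.fac_iff i w).2 hi
    -- For surjectivity, a string comes from the end of the first occurrence in it.
    obtain ⟨j, ⟨hj, h1⟩, hmin⟩ : ∃ j, (j ≤ ℓ ∧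
        code w <+: revPrefix (fun k => T (i * (ℓ + 1) + k)) j) ∧
        ∀ j' < j, ¬ (j' ≤ ℓ ∧ code w <+: revPrefix (fun k => T (i * (ℓ + 1) + k)) j') :=
      ⟨Nat.find hex, Nat.find_spec hex, fun _ => Nat.find_min hex⟩
    have hj0 : j ≠ 0 := by
      rintro rfl
      simp [revPrefix, hw] at h1
    obtain ⟨j, rfl⟩ : ∃ j', j = j' + 1 := ⟨j - 1, by omega⟩
    refine ⟨i * (ℓ + 1) + (j + 1), ?_, ?_⟩
    · have hb := index_lt i.2 (show j + 1 < ℓ + 1 by omega)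
      simp only [Finset.mem_filter, Finset.mem_Icc]
      refine ⟨⟨by omega, by omega⟩, (hT.prefix_iff hlt i.2.le).2 h1, fun h2 => ?_⟩
      obtain ⟨j', hj', h3⟩ := (hx.longest i i.2 j (by omega)).2.1.of_prefix h2
      exact hmin j' (by omega) ⟨by omega, h3⟩
    · simp [index_div (show j + 1 < ℓ + 1 by omega)]

end Repeats

end

/-! ### The report -/

lemma occCount_eq_of_hull {T : ℕ → ℕ} {p : ℕ} {w u : List ℕ} (h : Hull T p w u) :
    occCount T p w = occCount T p u := by
  unfold occCount
  congr 1
  refine Finset.filter_congr fun e he => ?_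
  exact ⟨h.2.1 e (Finset.mem_Icc.1 he).2, h.1.trans⟩

/-- A saturated word with the suffix `w` also has the hull of `w` as a suffix, by `Hull.mono`. So
the count of repeats, too, is the same for all words of a class. -/
lemma suffixCount_eq_of_hull {T : ℕ → ℕ} {p : ℕ} {w u : List ℕ} {xs : ℕ → List ℕ}
    (h : Hull T p w u) (hs : ∀ e ≤ p, Saturated T p (xs e)) :
    suffixCount xs p w = suffixCount xs p u := by
  unfold suffixCount
  congr 1
  refine Finset.filter_congr fun e he => ?_
  have hsat := hs e (Finset.mem_Icc.1 he).2
  exact ⟨fun hw => h.mono hsat.hull hw hsat.1, h.1.trans⟩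

section SAM

variable {T : ℕ → ℕ} {A p sz v r : ℕ} {W : ℕ → List ℕ} {link : ℕ → ℕ} {nxt : ℕ → ℕ → ℕ}

/-- The hull is a saturated suffix of `W v`; a proper one would be a suffix of `W (link v)` and thus
too short. -/
lemma hull_take (h : IsSAM T A p sz W link nxt) (hv : 2 ≤ v) (hv' : v < sz)
    (hr : (W (link v)).length < r) (hr' : r ≤ (W v).length) :
    Hull T p ((W v).take r) (W v) := by
  have hsat := h.sat v (by omega) hv'
  have hp := List.take_prefix r (W v)
  obtain ⟨u, hu⟩ := exists_hull (hsat.1.of_prefix hp)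
  have huv := hu.mono hsat.hull hp hsat.1
  by_cases he : u = W v
  · rwa [he] at hu
  · have h1 := (h.link_max v u hv hv' hu.2.2 huv he).length_le
    have h2 := hu.1.length_le
    simp at h2
    omega

/-- A suffix of the saturated word `W (link v)` has its hull inside that word, which is shorter than
`W v`. Together with `hull_take` this describes the class of `v` by an interval of lengths. -/
lemma length_link_lt (h : IsSAM T A p sz W link nxt) (hv : 2 ≤ v) (hv' : v < sz) {w : List ℕ}
    (hw : Hull T p w (W v)) : (W (link v)).length < w.length := by
  by_contra hc
  have hl := h.link_lt v hv hv'
  have hp := h.link_pos v hv hv'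
  have hsat := h.sat _ hp.1 hp.2
  have h1 : w <+: W (link v) := List.prefix_of_prefix_length_le hw.1 hl.1 (by omega)
  have := (hw.mono hsat.hull h1 hsat.1).length_le
  omega

end SAM

/-- Turn a triple of numbers into a reference to a substring. -/
def toRef {n : ℕ} (hn : 0 < n) (x : ℕ × ℕ × ℕ) : SubstringRef n :=
  (⟨x.1 % n, Nat.mod_lt _ hn⟩, x.2.1, x.2.2)

section

variable {σ n ℓ A sz : ℕ} {s : Fin n → List (Fin σ)} {T : ℕ → ℕ} {xs : ℕ → List ℕ}
  {W : ℕ → List ℕ} {link pos : ℕ → ℕ} {nxt : ℕ → ℕ → ℕ} {ord : List ℕ}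

lemma mem_allRefs {L : ℕ} {sel : ℕ → Prop} {x : ℕ × ℕ × ℕ} (hsam : IsSAM T A (n * L) sz W link nxt)
    (hmem : ∀ v, v ∈ ord ↔ 1 ≤ v ∧ v < sz) :
    x ∈ allRefs L W link pos sel ord ↔ ∃ v r, 2 ≤ v ∧ v < sz ∧ sel v ∧
      (W (link v)).length < r ∧ r ≤ (W v).length ∧ r ≤ pos v % L ∧
      x = (pos v / L, pos v % L - r, r) := by
  simp only [allRefs, List.mem_flatMap, stateRefs, refsAt]
  have key : ∀ v, 2 ≤ v → v < sz → ∀ r, (r ∈ List.range' (stLen W (link v))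
      (min (stLen W v) (pos v % L + 1) - stLen W (link v)) ↔
      (W (link v)).length < r ∧ r ≤ (W v).length ∧ r ≤ pos v % L) := by
    intro v hv hv' r
    have := hsam.link_pos v hv hv'
    rw [List.mem_range'_1, stLen_pos (by omega), stLen_pos (by omega)]
    omega
  constructor
  · rintro ⟨v, hv, hx⟩
    split_ifs at hx with hc
    · have hv2 := (hmem v).1 hv
      obtain ⟨r, hr, rfl⟩ := List.mem_map.1 hx
      obtain ⟨h1, h2, h3⟩ := (key v (by omega) hv2.2 r).1 hr
      exact ⟨v, r, by omega, hv2.2, hc.2, h1, h2, h3, rfl⟩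
    · simp at hx
  · rintro ⟨v, r, hv, hv', hs, h1, h2, h3, rfl⟩
    refine ⟨v, (hmem v).2 ⟨by omega, hv'⟩, ?_⟩
    rw [if_pos ⟨by omega, hs⟩]
    exact List.mem_map.2 ⟨r, (key v hv hv' r).2 ⟨h1, h2, h3⟩, rfl⟩

/-- The end `N` of the text has remainder `0` and is excluded by `0 < r`. Hence the quotient is the
index of a string, and the reduction modulo `n` in `toRef` changes nothing. -/
lemma code_toRef (hT : IsText ℓ s T) (hn : 0 < n) {e r : ℕ} (he : e ≤ n * (ℓ + 1)) (hr : 0 < r)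
    (hr' : r ≤ e % (ℓ + 1)) :
    e / (ℓ + 1) < n ∧
    code ((toRef hn (e / (ℓ + 1), e % (ℓ + 1) - r, r)).substring s) = (revPrefix T e).take r := by
  have he' : e < n * (ℓ + 1) := lt_of_le_of_ne he fun h => by
    rw [h, Nat.mul_mod_left] at hr'
    omega
  have hi : e / (ℓ + 1) < n := Nat.div_lt_of_lt_mul (by rwa [Nat.mul_comm])
  have hm := Nat.mod_lt e (show 0 < ℓ + 1 by omega)
  refine ⟨hi, ?_⟩
  have h := hT.code_substring ⟨_, hi⟩ (show e % (ℓ + 1) ≤ ℓ by omega) hr'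
  have hd : e / (ℓ + 1) * (ℓ + 1) + e % (ℓ + 1) = e := by
    rw [Nat.mul_comm]; exact Nat.div_add_mod e _
  rw [hd] at h
  rw [← h, toRef]
  simp only [Nat.mod_eq_of_lt hi]

/-- The references to the words of the states of the automaton that occur in enough strings form
a report. -/
lemma isFrequentReport (hT : IsText ℓ s T) (hx : Repeats T n ℓ xs) (hn : 0 < n)
    (hsam : IsSAM T A (n * (ℓ + 1)) sz W link nxt)
    (hpos : ∀ v, 1 ≤ v → v < sz → pos v ≤ n * (ℓ + 1) ∧ W v <+: revPrefix T (pos v))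
    (hmem : ∀ v, v ∈ ord ↔ 1 ≤ v ∧ v < sz) (hpw : ord.Pairwise fun a b => ¬ W a <+: W b) (q : ℝ) :
    IsFrequentReport s q ((allRefs (ℓ + 1) W link pos (fun v => ⌈q * (n : ℝ)⌉₊ +
      suffixCount xs (n * (ℓ + 1)) (W v) ≤ occCount T (n * (ℓ + 1)) (W v)) ord).map
      (toRef hn)) := by
  set N := n * (ℓ + 1) with hN
  set sel : ℕ → Prop := fun v => ⌈q * (n : ℝ)⌉₊ + suffixCount xs N (W v) ≤ occCount T N (W v)
  have hcode : ∀ v r, 2 ≤ v → v < sz → (W (link v)).length < r → r ≤ (W v).length →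
      r ≤ pos v % (ℓ + 1) → pos v / (ℓ + 1) < n ∧
      code ((toRef hn (pos v / (ℓ + 1), pos v % (ℓ + 1) - r, r)).substring s) =
        (W v).take r := by
    intro v r hv hv' h1 h2 h3
    obtain ⟨hp, hp'⟩ := hpos v (by omega) hv'
    obtain ⟨h4, h5⟩ := code_toRef hT hn hp (by omega) h3
    refine ⟨h4, h5.trans ?_⟩
    obtain ⟨z, hz⟩ := hp'
    rw [← hz, List.take_append_of_le_length h2]
  -- Both counts are constant on the class of `v`, so the test at the state decides for each of its
  -- words. `Nat.ceil_le` translates between the natural and the real threshold.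
  have hcount : ∀ v (w : List (Fin σ)), w ≠ [] → Hull T N (code w) (W v) →
      (sel v ↔ q * (n : ℝ) ≤ ((Finset.univ.filter fun i => w <:+: s i).card : ℝ)) := by
    intro v w hw hh
    change ⌈q * (n : ℝ)⌉₊ + suffixCount xs N (W v) ≤ occCount T N (W v) ↔ _
    rw [← occCount_eq_of_hull hh,
      ← suffixCount_eq_of_hull (xs := xs) hh fun e he => hx.saturated hT he,
      ← Nat.ceil_le]
    have := hx.occCount_eq hT hw
    rw [← hN] at this
    omega
  refine ⟨?_, ?_, fun w => ⟨fun hw => ?_, fun hw => ?_⟩⟩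
  · intro x hx'
    obtain ⟨y, hy, rfl⟩ := List.mem_map.1 hx'
    obtain ⟨v, r, hv, hv', -, h1, h2, h3, rfl⟩ := (mem_allRefs hsam hmem).1 hy
    have := Nat.mod_lt (pos v) (show 0 < ℓ + 1 by omega)
    rw [hT.length_eq]
    simp only [toRef]
    omega
  -- The hull of a reported word determines its state, and within a state the length determines the
  -- word.
  · refine List.Nodup.of_map code ?_
    rw [List.map_map, List.map_map, allRefs, List.map_flatMap, List.nodup_flatMap]
    have hmap : ∀ v, 2 ≤ v → v < sz → ∀ w, w ∈ (stateRefs (ℓ + 1) W link pos v).map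
        ((code ∘ SubstringRef.substring s) ∘ toRef hn) → Hull T N w (W v) := by
      intro v hv hv' w hw
      obtain ⟨x, hx', rfl⟩ := List.mem_map.1 hw
      obtain ⟨r, hr, rfl⟩ := List.mem_map.1 hx'
      have := hsam.link_pos v hv hv'
      rw [List.mem_range'_1, stLen_pos (by omega), stLen_pos (by omega)] at hr
      simp only [Function.comp_apply]
      rw [(hcode v r hv hv' (by omega) (by omega) (by omega)).2]
      exact hull_take hsam hv hv' (by omega) (by omega)
    constructor
    · intro v hv
      have hv' := (hmem v).1 hv
      split_ifs with hc
      · rw [stateRefs, refsAt, List.map_map]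
        refine List.Nodup.map_on (fun r hr r' hr' he => ?_) (List.nodup_range' ..)
        have := hsam.link_pos v (by omega) hv'.2
        rw [List.mem_range'_1, stLen_pos (by omega), stLen_pos (by omega)] at hr hr'
        simp only [Function.comp_apply] at he
        rw [(hcode v r (by omega) hv'.2 (by omega) (by omega) (by omega)).2,
          (hcode v r' (by omega) hv'.2 (by omega) (by omega) (by omega)).2] at he
        have := congrArg List.length he
        simp only [List.length_take] at this
        omega
      · simp
    · refine hpw.imp_of_mem fun {a b} ha hb hab => ?_
      have ha' := (hmem a).1 ha
      have hb' := (hmem b).1 hb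
      simp only [Function.onFun]
      split_ifs with h1 h2 h2
      · intro w hwa hwb
        have := (hmap a (by omega) ha'.2 w hwa).unique (hmap b (by omega) hb'.2 w hwb)
        exact hab (by rw [this])
      all_goals simp
  · rw [List.map_map] at hw
    obtain ⟨x, hx', rfl⟩ := List.mem_map.1 hw
    obtain ⟨v, r, hv, hv', hs, h1, h2, h3, rfl⟩ := (mem_allRefs hsam hmem).1 hx'
    obtain ⟨-, h5⟩ := hcode v r hv hv' h1 h2 h3
    set x := toRef hn (pos v / (ℓ + 1), pos v % (ℓ + 1) - r, r) with hxdef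
    have hne : x.substring s ≠ [] := by
      rw [← code_eq_nil.ne, h5, ← List.length_pos_iff, List.length_take]
      omega
    refine ⟨hne, ⟨x.1, ?_⟩, (hcount v _ hne ?_).1 hs⟩
    · exact (List.take_prefix _ _).isInfix.trans (List.drop_suffix _ _).isInfix
    · rw [h5]
      exact hull_take hsam hv hv' h1 h2
  -- A frequent word belongs to the state of its hull. Whichever end is stored there, the word ends
  -- there too and, having no separator, stays inside one string; so its length passes the test.
  · obtain ⟨hne, ⟨i, hi⟩, hq⟩ := hw
    obtain ⟨j, hj, hji⟩ := (hT.fac_iff i w).2 hi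
    have hlt : ∀ a ∈ code w, a < σ := fun a => lt_of_mem_code
    have hfac : Fac T N (code w) := by
      refine ⟨i * (ℓ + 1) + j, ?_, (hT.prefix_iff hlt i.2.le).2 hji⟩
      exact (index_lt i.2 (by omega)).le
    obtain ⟨u, hu⟩ := exists_hull hfac
    obtain ⟨v, hv1, hv', rfl⟩ := hsam.surj u hu.2.2
    have hv : 2 ≤ v := by
      by_contra hc
      obtain rfl : v = 1 := by omega
      have := hu.1
      rw [hsam.W_one] at this
      simp [hne] at this
    have hp := hpos v hv1 hv'
    have h1 := length_link_lt hsam hv hv' hu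
    have h2 := hu.1.length_le
    have h3 := hT.length_le_mod hlt hp.1 (hu.1.trans hp.2)
    refine List.mem_map.2 ⟨_, List.mem_map.2 ⟨_, (mem_allRefs hsam hmem).2
      ⟨v, _, hv, hv', (hcount v w hne hu).2 hq, h1, h2, h3, rfl⟩, rfl⟩, ?_⟩
    apply code_injective
    rw [(hcode v _ hv hv' h1 h2 h3).2]
    exact (List.prefix_iff_eq_take.1 hu.1).symm

lemma reportWords_toRef (hT : IsText ℓ s T) (hn : 0 < n) {sel : ℕ → Prop}
    (hsam : IsSAM T A (n * (ℓ + 1)) sz W link nxt)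
    (hpos : ∀ v, 1 ≤ v → v < sz → pos v ≤ n * (ℓ + 1) ∧ W v <+: revPrefix T (pos v))
    (hmem : ∀ v, v ∈ ord ↔ 1 ≤ v ∧ v < sz) :
    reportWords ((allRefs (ℓ + 1) W link pos sel ord).map (toRef hn)) =
      refWords (allRefs (ℓ + 1) W link pos sel ord) := by
  rw [reportWords, refWords, List.flatMap_map]
  refine List.flatMap_congr fun x hx => ?_
  obtain ⟨v, r, hv, hv', hs, h1, h2, h3, rfl⟩ := (mem_allRefs hsam hmem).1 hx
  have := (code_toRef hT hn (hpos v (by omega) hv').1 (by omega) h3).1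
  simp [toRef, Nat.mod_eq_of_lt this]

/-! ### The input -/

lemma flatten_getElem? {α : Type*} {ℓ : ℕ} {l : List (List α)} (hl : ∀ x ∈ l, x.length = ℓ)
    {i j : ℕ} (hj : j < ℓ) : l.flatten[i * ℓ + j]? = l[i]?.bind (·[j]?) := by
  induction l generalizing i with
  | nil => simp
  | cons x l ih =>
    have hx := hl x (by simp)
    rw [List.flatten_cons]
    cases i with
    | zero =>
      rw [Nat.zero_mul, Nat.zero_add, List.getElem?_append_left (by omega)]
      simp
    | succ i =>
      rw [List.getElem?_append_right (by rw [hx, Nat.add_mul]; omega), hx,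
        show (i + 1) * ℓ + j - ℓ = i * ℓ + j by rw [Nat.add_mul]; omega,
        ih fun y hy => hl y (by simp [hy])]
      simp

lemma inputWords_eq (s : Fin n → List (Fin σ)) (q : ℝ) :
    inputWords ℓ s q = n :: ℓ :: ⌈q * (n : ℝ)⌉₊ :: (List.ofFn s).flatten.map Fin.val := by
  simp [inputWords, List.map_eq_flatMap]

lemma isText_inputWords (hs : ∀ i, (s i).length = ℓ) (q : ℝ) :
    IsText ℓ s (textAt σ (ℓ + 1) fun a => (inputWords ℓ s q).getD a 0) := by
  refine ⟨hs, fun i j hj => ?_, fun i hi => ?_⟩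
  · have hj' := hj
    rw [hs] at hj'
    unfold textAt
    rw [index_mod (by omega), index_div (by omega), if_neg (by omega),
      show 3 + (i * (ℓ + 1) + j) - i = i * ℓ + j + 3 by rw [Nat.mul_add]; omega]
    have h := flatten_getElem? (l := List.ofFn s) (ℓ := ℓ) (i := i) (j := j)
      (by simpa [List.forall_mem_ofFn_iff] using hs) hj'
    simp only [inputWords_eq, List.getD_eq_getElem?_getD, List.getElem?_cons_succ,
      List.getElem?_map, h]
    simp [hj]
  · unfold textAt
    rw [index_mod (by omega), if_pos (by omega)]

lemma length_inputWords (hs : ∀ i, (s i).length = ℓ) (q : ℝ) :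
    (inputWords ℓ s q).length = 3 + n * ℓ := by
  have : (List.ofFn s).map List.length = List.replicate n ℓ := by
    rw [List.eq_replicate_iff]
    simp [hs]
  rw [inputWords_eq]
  simp only [List.length_cons, List.length_map, List.length_flatten, this, List.sum_replicate,
    smul_eq_mul]
  omega

end

/-! ### The program -/

/-- Record the longest repeated suffixes within the single strings. -/
def repeats (σ : ℕ) : Cmd 17 8 :=
  .loop (.op .lt (rg rI) (.load bIn (cn 0))) (block [
    .assign rOff (rg rI * rg rL),
    .assign rDst (rg rI * rg rL),
    build σ,
    .assign rI (rg rI + cn 1)])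

/-- Report the frequent substrings. -/
def program (σ : ℕ) : Cmd 17 8 := block [
  .assign rL (.load bIn (cn 1) + cn 1),
  .assign rH (.load bIn (cn 1)),
  repeats σ,
  .assign rOff (cn 0),
  .assign rH (.load bIn (cn 0) * rg rL),
  .assign rDst (rg rH),
  build σ,
  walk σ,
  report]

section

variable {B σ n ℓ : ℕ} {Q : State 17 8 → ℕ → Prop} {s : State 17 8} {τ : ℕ} {T inp : ℕ → ℕ}

/-- Each string has its own range of cells in `bRep`. The cells at multiples of `ℓ + 1` are never
written and keep the value `0`, the length of `xs` at the start of a string. -/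
lemma wp_repeats (hL : s.reg rL = ℓ + 1) (hH : s.reg rH = ℓ) (hI : s.reg rI = 0)
    (hin : s.mem bIn = inp) (hn : inp 0 = n) (hT : T = textAt σ (ℓ + 1) inp)
    (hTl : ∀ k < n * (ℓ + 1), T k < σ + 1) (hrep : ∀ x, s.mem bRep x = 0)
    (hB : (2 * ℓ + 5) * (σ + 1) < B) (h1 : 3 + n * (ℓ + 1) < B) (hnB : n < B) (hLB : ℓ + 1 < B)
    (hQ : ∀ s' τ', s'.reg rL = ℓ + 1 → s'.mem bIn = inp → s'.out = s.out →
      (∀ e, e % (ℓ + 1) = 0 → s'.mem bRep e = 0) →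
      (∀ i < n, ∀ k < ℓ, ∃ x, IsLongest (fun j => T (i * (ℓ + 1) + j)) k x ∧
        s'.mem bRep (i * (ℓ + 1) + k + 1) = x.length) →
      τ' ≤ τ + 10 + n * ((ℓ + 1) * (700 + 60 * (σ + 1)) + 50) → Q s' τ') :
    WP B (repeats σ) Q s τ := by
  obtain ⟨c, hc⟩ : ∃ c, (ℓ + 1) * (700 + 60 * (σ + 1)) = c := ⟨_, rfl⟩
  rw [hc] at hQ
  unfold repeats
  refine wp_loop (τ + n * (c + 50)) (fun s' τ' => ∃ i d, i ≤ n ∧ i + d = n ∧ s'.reg rI = i ∧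
    s'.reg rL = ℓ + 1 ∧ s'.reg rH = ℓ ∧ s'.mem bIn = inp ∧ s'.out = s.out ∧
    (∀ e, e % (ℓ + 1) = 0 → s'.mem bRep e = 0) ∧
    (∀ i' < i, ∀ k < ℓ, ∃ x, IsLongest (fun j => T (i' * (ℓ + 1) + j)) k x ∧
        s'.mem bRep (i' * (ℓ + 1) + k + 1) = x.length) ∧
    τ' + d * (c + 50) ≤ τ + n * (c + 50)) ?_ ?_ ?_ ?_ ?_
  · rintro s' τ' ⟨i, d, -, -, -, -, -, -, -, -, -, h⟩
    omega
  · rintro s' τ' ⟨i, d, h0, hd, hi, g1, g2, g3, -⟩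
    simp [hi, g3, hn]
    refine ⟨by omega, ⟨by omega, hnB⟩, ?_⟩
    split_ifs <;> omega
  · rintro s' τ' ⟨i, d, h0, hd, hi, g1, g2, g3, g4, g5, g6, g7⟩ hc'
    have hin' : i < n := by simpa [hi, g3, hn] using hc'
    have hil : i * (ℓ + 1) + ℓ < n * (ℓ + 1) := index_lt hin' (by omega)
    refine wp_block_assign (i * (ℓ + 1)) (by simp [hi, g1]; omega) (by simp [hi, g1]) ?_
    refine wp_block_assign (i * (ℓ + 1)) (by simp [hi, g1]; omega) (by simp [hi, g1]) ?_
    refine wp_block_cons (wp_build (T := fun j => T (i * (ℓ + 1) + j)) (h := ℓ)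
      (d := i * (ℓ + 1)) (by simp [g2]) (by simp) ?_ hB (by simp; omega) (by simp [g1]; omega)
      (by omega) ?_)
    · intro k hk
      simp [g1, g3, ← hT]
      have := hTl (i * (ℓ + 1) + k) (by omega)
      omega
    intro s₁ τ₁ W ord F hb hfr hF hrep' hτ
    have r0 : s₁.reg rL = ℓ + 1 := by rw [hfr.reg rL (by decide)]; simp [g1]
    have r2 : s₁.reg rH = ℓ := by rw [hfr.reg rH (by decide)]; simp [g2]
    have r14 : s₁.reg rI = i := by rw [hfr.reg rI (by decide)]; simp [hi]
    have m0 : s₁.mem bIn = inp := by rw [hfr.inp]; simp [g3]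
    have m8 : s₁.mem bRep = F := by rw [hfr.rep]; simp
    have o : s₁.out = s.out := by rw [hfr.out]; simp [g4]
    refine wp_block_assign (i + 1) (by simp [r14]; omega) (by simp [r14]) ?_
    refine wp_block_nil ⟨i + 1, d - 1, by omega, by omega, by simp, by simp [r0], by simp [r2],
      by simp [m0], by simp [o], ?_, ?_, ?_⟩
    · intro e he
      simp only [State.setR_mem, m8]
      rw [hF e ?_]
      · simpa using g5 e he
      · by_contra hlt
        push Not at hlt
        obtain ⟨j, rfl⟩ : ∃ j, e = i * (ℓ + 1) + j := ⟨e - i * (ℓ + 1), by omega⟩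
        rw [index_mod (by omega)] at he
        omega
    · intro i' hi' k hk
      simp only [State.setR_mem, m8]
      rcases Nat.lt_or_eq_of_le (Nat.le_of_lt_succ hi') with hi' | rfl
      · obtain ⟨x, hx, hx'⟩ := g6 i' hi' k hk
        refine ⟨x, hx, ?_⟩
        have : i' * (ℓ + 1) + ℓ < i * (ℓ + 1) := index_lt hi' (by omega)
        rw [hF _ (.inl (by omega)), ← hx']
        simp
      · exact hrep' k hk
    · obtain ⟨d, rfl⟩ : ∃ d', d = d' + 1 := ⟨d - 1, by omega⟩
      rw [Nat.add_mul] at g7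
      rw [hc] at hτ
      simp at hτ ⊢
      omega
  · rintro s' τ' ⟨i, d, h0, hd, hi, g1, g2, g3, g4, g5, g6, g7⟩ hc'
    have hin' : n ≤ i := by simpa [hi, g3, hn] using hc'
    obtain rfl : i = n := by omega
    refine hQ _ _ g1 g3 g4 g5 g6 ?_
    simp
    omega
  · exact ⟨0, n, by omega, by omega, hI, hL, hH, hin, rfl, fun e _ => hrep e, by simp, le_rfl⟩

/-- Only lengths are stored, but a suffix of a given prefix of the text is determined by its length.
-/
lemma exists_repeats {F : ℕ → ℕ} (h0 : ∀ e, e % (ℓ + 1) = 0 → F e = 0)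
    (hF : ∀ i < n, ∀ k < ℓ, ∃ x, IsLongest (fun j => T (i * (ℓ + 1) + j)) k x ∧
        F (i * (ℓ + 1) + k + 1) = x.length) :
    ∃ xs, Repeats T n ℓ xs ∧ ∀ e ≤ n * (ℓ + 1), F e = (xs e).length := by
  have key : ∀ i < n, ∀ k < ℓ, IsLongest (fun j => T (i * (ℓ + 1) + j)) k
      ((revPrefix T (i * (ℓ + 1) + k + 1)).take (F (i * (ℓ + 1) + k + 1))) := by
    intro i hi k hk
    obtain ⟨x, hx, hx'⟩ := hF i hi k hk
    obtain ⟨z, hz⟩ := hx.1.trans (revPrefix_local_prefix T (i * (ℓ + 1)) (k + 1))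
    rw [Nat.add_assoc, ← hz, ← Nat.add_assoc, hx', List.take_left]
    exact hx
  refine ⟨fun e => (revPrefix T e).take (F e), ⟨fun i _ => ?_, key⟩, fun e he => ?_⟩
  · simp [h0 (i * (ℓ + 1)) (Nat.mul_mod_left _ _)]
  · have hle : F e ≤ e := by
      rcases Nat.lt_or_eq_of_le he with he | rfl
      · obtain ⟨i, hi, j, hj, rfl⟩ := exists_index (by omega) he
        cases j with
        | zero => simp [h0 (i * (ℓ + 1)) (Nat.mul_mod_left _ _)]
        | succ j =>
          obtain ⟨x, hx, hx'⟩ := hF i hi j (by omega)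
          have := hx.2.1.length_le
          rw [← Nat.add_assoc, hx']
          omega
      · simp [h0 (n * (ℓ + 1)) (Nat.mul_mod_left _ _)]
    simp [hle]

end

/-- From a state that holds the input, the program reports the frequent substrings. -/
lemma wp_program {B σ n ℓ : ℕ} {s : Fin n → List (Fin σ)} (hn : 0 < n)
    (hs : ∀ i, (s i).length = ℓ) (q : ℝ) (ht : ⌈q * (n : ℝ)⌉₊ ≤ n)
    (hB : (2 * (n * (ℓ + 1)) + 5) * (σ + 1) < B) (hB' : 3 * (n * (ℓ + 1)) + 5 < B) :
    WP B (program σ) (fun s' τ' => ∃ R : List (SubstringRef n), IsFrequentReport s q R ∧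
      s'.out = reportWords R ∧
      τ' ≤ (n * (ℓ + 1) + 1) * (3000 + 200 * (σ + 1)) + 60 * R.length)
      (init 17 8 (inputWords ℓ s q)) 0 := by
  obtain ⟨inp, hinp⟩ : ∃ inp : ℕ → ℕ, inp = fun a => (inputWords ℓ s q).getD a 0 := ⟨_, rfl⟩
  obtain ⟨T, hTdef⟩ : ∃ T, T = textAt σ (ℓ + 1) inp := ⟨_, rfl⟩
  have hT : IsText ℓ s T := by
    rw [hTdef, hinp]
    exact isText_inputWords hs q
  have hin : (init 17 8 (inputWords ℓ s q)).mem bIn = inp := by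
    rw [hinp]; simp [init]
  have hmem : ∀ b : Fin 9, b ≠ 0 → ∀ a, (init 17 8 (inputWords ℓ s q)).mem b a = 0 := by
    intro b hb a
    simp [init, hb]
  have hreg : ∀ i, (init 17 8 (inputWords ℓ s q)).reg i = 0 := fun _ => rfl
  have hout : (init 17 8 (inputWords ℓ s q)).out = [] := rfl
  have i0 : inp 0 = n := by rw [hinp]; simp [inputWords_eq]
  have i1 : inp 1 = ℓ := by rw [hinp]; simp [inputWords_eq]
  have i2 : inp 2 = ⌈q * (n : ℝ)⌉₊ := by rw [hinp]; simp [inputWords_eq]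
  generalize init 17 8 (inputWords ℓ s q) = s₀ at *
  have hTl : ∀ k < n * (ℓ + 1), T k < σ + 1 := fun k hk => hT.lt_succ hk
  have hℓN : ℓ + 1 ≤ n * (ℓ + 1) := Nat.le_mul_of_pos_left _ hn
  have hnN : n ≤ n * (ℓ + 1) := Nat.le_mul_of_pos_right _ (by omega)
  obtain ⟨N, hN⟩ : ∃ N, n * (ℓ + 1) = N := ⟨_, rfl⟩
  unfold program
  refine wp_block_assign (ℓ + 1) (by simp [hin, i1]; omega) (by simp [hin, i1]) ?_
  refine wp_block_assign ℓ (by simp [hin, i1]; omega) (by simp [hin, i1]) ?_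
  refine wp_block_cons (wp_repeats (n := n) (ℓ := ℓ) (inp := inp) (T := T) (by simp) (by simp)
    (by simp [hreg]) (by simp [hin]) i0 hTdef hTl (fun x => by simp [hmem]) ?_ (by omega)
    (by omega) (by omega) ?_)
  · exact lt_of_le_of_lt (Nat.mul_le_mul_right _ (by omega)) hB
  intro s₁ τ₁ r0 m0 o h0 hF hτ₁
  obtain ⟨xs, hx, hxF⟩ := exists_repeats h0 hF
  refine wp_block_assign 0 (by simp; omega) (by simp) ?_
  refine wp_block_assign N (by simp [m0, i0, r0, hN]; omega) (by simp [m0, i0, r0, hN]) ?_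
  refine wp_block_assign N (by simp; omega) (by simp) ?_
  -- With the destination `N` this run records its own lengths above the cell `N`, so those of the
  -- single strings survive.
  refine wp_block_cons (wp_build (T := T) (h := N) (d := N) (by simp) (by simp) ?_
    (by rw [← hN]; exact hB) (by simp; omega) (by simp [r0]; omega) (by omega) ?_)
  · intro k hk
    simp [r0, m0, ← hTdef]
    have := hTl k (by omega)
    omega
  intro s₂ τ₂ W ord F hb hfr hFs _ hτ₂
  have r0' : s₂.reg rL = ℓ + 1 := by rw [hfr.reg rL (by decide)]; simp [r0]
  have r1' : s₂.reg rOff = 0 := by rw [hfr.reg rOff (by decide)]; simp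
  have r2' : s₂.reg rH = N := by rw [hfr.reg rH (by decide)]; simp
  have m0' : s₂.mem bIn = inp := by rw [hfr.inp]; simp [m0]
  have m8' : s₂.mem bRep = F := by rw [hfr.rep]; simp
  have o' : s₂.out = [] := by rw [hfr.out]; simp [o, hout]
  refine wp_block_cons (wp_walk (N := N) xs hb r2' r1' ?_ (by simpa using hx.start 0 (by omega))
    ?_ ?_ ?_ (by rw [← hN]; exact hB) (by omega) (by omega) ?_)
  · intro k hk
    rw [r0', m0', ← hTdef]
    exact ⟨rfl, hTl k (by omega)⟩
  · intro e _ he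
    rw [m8', hFs e (.inl he), ← hxF e (by omega)]
    simp
  · intro e he
    rw [← hN] at he ⊢
    exact ⟨hx.saturated hT he, hx.prefix_revPrefix he⟩
  · intro e he
    exact hx.step (by omega)
  intro s₃ τ₃ hwf hdn hτ₃
  have hb' : BuildInv T (σ + 1) N (s₃.setB bDn (s₂.mem bDn)) W ord := by
    refine hb.congr (by simp [hwf.reg]) (by simp [hwf.reg]) (by simp [hwf.reg]) fun b _ _ => ?_
    rw [State.setB_mem]
    split_ifs with hbd
    · rw [hbd]
    · exact hwf.mem b hbd
  -- The list consists of distinct states other than the auxiliary one, so the cost per state in the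
  -- report is linear in `N`.
  have hord : ord.length ≤ 2 * N + 1 := by
    have hsub : ord.toFinset ⊆ Finset.Ico 1 (s₂.reg rSz) := fun v hv =>
      Finset.mem_Ico.2 ((hb.mem_ord v).1 (List.mem_toFinset.1 hv))
    have := Finset.card_le_card hsub
    rw [List.toFinset_card_of_nodup hb.nodup, Nat.card_Ico] at this
    have := hb.size
    omega
  have hcount : ∀ f : ℕ → List ℕ, ∀ w, suffixCount f N w ≤ N := fun f w => by
    refine (Finset.card_filter_le _ _).trans ?_
    simp
  have hsam := hb.sam
  have hpos := hb.pos
  have hord' := hb.mem_ord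
  rw [← hN] at hsam hpos
  refine wp_block_cons (wp_report (N := N) (L := ℓ + 1) (t := ⌈q * (n : ℝ)⌉₊) hb'
    (by rw [hwf.reg rL (by decide) (by decide) (by decide) (by decide), r0'])
    (by rw [hwf.mem bIn (by decide), m0', i2]) rfl (hwf.mem bUp (by decide))
    (cu := fun v => occCount T N (W v)) (cd := fun v => suffixCount xs N (W v))
    (fun v _ => hb.up (W v)) (fun v _ => hdn (W v)) (fun v _ => hcount _ _) (fun v _ => hcount _ _)
    (by omega) (by omega) ?_)
  intro s₄ τ₄ ho hτ₄
  rw [hwf.mem bLink (by decide), hwf.mem bPos (by decide), hwf.out, o', List.nil_append] at ho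
  rw [hwf.mem bLink (by decide), hwf.mem bPos (by decide)] at hτ₄
  refine wp_block_nil ⟨_, isFrequentReport hT hx hn hsam hpos hord' hb.pw q, ?_, ?_⟩
  · rw [reportWords_toRef hT hn hsam hpos hord', ho, hN]
  · rw [List.length_map, hN]
    obtain ⟨r, hr⟩ : ∃ r, (allRefs (ℓ + 1) W (s₂.mem bLink) (s₂.mem bPos) (fun v =>
      ⌈q * (n : ℝ)⌉₊ + suffixCount xs N (W v) ≤ occCount T N (W v)) ord).length = r := ⟨_, rfl⟩
    rw [hr] at hτ₄ ⊢
    have e1 : n * ((ℓ + 1) * (700 + 60 * (σ + 1)) + 50) = N * (700 + 60 * (σ + 1)) + 50 * n := by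
      rw [← hN]; ring
    rw [e1] at hτ₁
    simp at hτ₁ hτ₂
    nlinarith

end FrequentSubstrings

/-! ### The constants -/

theorem lemma1 (σ : ℕ) :
    ∃ (m k : ℕ) (P : WordRAM.Cmd m k) (C : ℕ),
      ∀ (n ℓ : ℕ), 0 < n → 0 < ℓ →
      ∀ (s : Fin n → List (Fin σ)), (∀ i, (s i).length = ℓ) →
      ∀ q : ℝ, 0 ≤ q → q ≤ 1 →
      ∃ L : List (SubstringRef n),
        IsFrequentReport s q L ∧
        P.RunsWithin (inputWords ℓ s q) (reportWords L)
          (C * (n * ℓ + L.length)) (C * (n * ℓ)) := by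
  -- With `M = n * ℓ`, the capacity will be `12 * (M * (σ + 1))`, so the `9` banks and `17`
  -- registers have `17 + 108 * (M * (σ + 1))` words. As `n * (ℓ + 1) + 1 ≤ 3 * M`, the time is at
  -- most `M * (9000 + 600 * (σ + 1))` plus `60` for each reference.
  refine ⟨17, 8, FrequentSubstrings.program σ, 10000 + 1000 * (σ + 1), ?_⟩
  intro n ℓ hn hℓ s hs q hq hq1
  have ht : ⌈q * (n : ℝ)⌉₊ ≤ n := by
    rw [Nat.ceil_le]
    exact mul_le_of_le_one_left (Nat.cast_nonneg n) hq1
  obtain ⟨M, hM⟩ : ∃ M, n * ℓ = M := ⟨_, rfl⟩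
  have hnM : n ≤ M := by rw [← hM]; exact Nat.le_mul_of_pos_right _ hℓ
  have hℓM : ℓ ≤ M := by rw [← hM]; exact Nat.le_mul_of_pos_left _ hn
  have hN : n * (ℓ + 1) ≤ 2 * M := by rw [Nat.mul_add, hM]; omega
  have hσM : M ≤ M * (σ + 1) := Nat.le_mul_of_pos_right _ (by omega)
  have hσM' : σ + 1 ≤ M * (σ + 1) := Nat.le_mul_of_pos_left _ (by omega)
  have hB : (2 * (n * (ℓ + 1)) + 5) * (σ + 1) < 12 * (M * (σ + 1)) :=
    calc (2 * (n * (ℓ + 1)) + 5) * (σ + 1) ≤ (9 * M) * (σ + 1) :=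
          Nat.mul_le_mul_right _ (by omega)
      _ = 9 * (M * (σ + 1)) := by ring
      _ < 12 * (M * (σ + 1)) := by omega
  obtain ⟨t, s', hexec, R, hR, hout, hτ⟩ :=
    FrequentSubstrings.wp_program hn hs q ht hB (by omega)
  refine ⟨R, hR, _, t, s', ?_, ?_, ?_, ?_, hexec, hout⟩
  · rw [hM]
    nlinarith
  · rw [hM]
    have h1 : (n * (ℓ + 1) + 1) * (3000 + 200 * (σ + 1)) ≤
        (3 * M) * (3000 + 200 * (σ + 1)) := Nat.mul_le_mul_right _ (by omega)
    nlinarith [Nat.zero_le (σ * R.length)]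
  · rw [FrequentSubstrings.length_inputWords hs, hM]
    omega
  · intro x hx
    rw [FrequentSubstrings.inputWords_eq] at hx
    simp only [List.mem_cons, List.mem_map] at hx
    rcases hx with rfl | rfl | rfl | ⟨a, -, rfl⟩
    · omega
    · omega
    · omega
    · have := a.2
      omega
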